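/- **Setting.** Let $L,\nu,k>0$, $U_0\in\mathbb R$, let $h:\mathbb R\to(0,\infty)$ be smooth and $L$-periodic, and put $\Omega=\{0<x_1<L,\ 0<x_2<h(x_1)\}$, $\Gamma_0=\{0<x_1<L,\ x_2=0\}$, $\Gamma_1=\{0<x_1<L,\ x_2=h(x_1)\}$, $K=\{x_1\in\mathbb R,\ 0\le x_2\le h(x_1)\}$. Let $U:\mathbb R\to\mathbb R$ be smooth with $U(0)=U_0$, $U(h(x_1))=0$ for $x_1\in(0,L)$ and $U'(0)=0$, and let $\xi=U(x_2)e_1$. Fields that are $L$-periodic in $x_1$ are regarded as functions on the closed channel $K$. Let $\tilde V$ be the space of $L$-periodic fields $\varphi\in C^\infty(K)^2$ with $\operatorname{div}\varphi=0$ in $\Omega$, $\varphi=0$ on $\Gamma_1$, $\varphi\cdot n=0$ on $\Gamma_0$ ($n=(0,-1)$); $V$ and $H$ are its closures in $H^1(\Omega)^2$ and $L^2(\Omega)^2$. Put $a(u,v)=\int_\Omega\nabla u:\nabla v$, $b(u,v,w)=\int_\Omega((u\cdot\nabla)v)\cdot w$, and $j(u)=\int_0^L k|u(x_1,0)|\,dx_1$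 (trace on $\Gamma_0$). Let $v_0\in H$. **Classical problem.** A pair $(v,p)$ is a *classical solution* if $v$ is regular in the following sense: $v$ is $L$-periodic in $x_1$, continuous on $[0,\infty)\times K$, and $v_t,\partial_i v,\partial_i\partial_j v$ exist and are continuous on $(0,\infty)\times K$; if $p(t)\in C^1(K)$ is $L$-periodic in $x_1$ for each $t>0$; and if, for all $t>0$, $$v_t-\nu\Delta v+(v\cdot\nabla)v+\nabla p=G(v):=-U\,\partial_1v-v_2U'e_1+\nu U''e_1,\quad \operatorname{div}v=0\quad\text{in }\Omega,$$ $v=0$ on $\Gamma_1$, $v\cdot n=0$ on $\Gamma_0$, and on $\Gamma_0$ the Tresca law holds: $|\sigma_\eta|\le k$; $|\sigma_\eta|<k\Rightarrow v_\eta=0$; $|\sigma_\eta|=k\Rightarrow v_\eta=-\lambda\sigma_\eta$ for some $\lambda\ge0$; and $v(0)=v_0$ a.e. in $\Omega$. Here $\sigma=(-p\,\delta_{ij}+\nu(\partial_jv_i+\partial_iv_j))$, $\sigma_\eta=\sigma n-((\sigma n)\cdot n)n$ and $v_\eta=v-(v\cdot n)n$. **Weak problem.** A function $v:[0,\infty)\to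 H$ is a *weak solution* if for all $T>0$ we have $v\in C([0,T];H)\cap L^2(0,T;V)$ and $v_t\in L^2(0,T;V')$, if for all $\Theta\in V$, all $T>0$ and a.e. $t\in[0,T]$ $$\langle v_t,\Theta-v\rangle+\nu a(v,\Theta-v)+b(v,v,\Theta-v)+j(\Theta)-j(v)\ \ge\ (\mathcal L(v),\Theta-v),$$ where $(\mathcal L(v),\Theta)=-\nu a(\xi,\Theta)-b(\xi,v,\Theta)-b(v,\xi,\Theta)$, and if $v(0)=v_0$. **Proposition.** (1) If $(v,p)$ is a classical solution, then $t\mapsto v(t)$ takes values in $H$ for $t\ge 0$ and is a weak solution. (2) If $v$ is a weak solution that is regular in the sense above, then there is a pressure $p$ such that $(v,p)$ is a classical solution. Moreover, for every $t>0$, $\varphi\mapsto\int_\Omega p(t)\varphi$ is a distribution on $\Omega$ which satisfies the momentum equation in the sense of distributions on $\Omega$. -/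

import Mathlib

open MeasureTheory Set Topology
open scoped ContDiff Distributions LineDeriv

noncomputable section

namespace TrescaFlow

/-- The Euclidean plane; the coordinates `x₁, x₂` are `x 0, x 1`. -/
abbrev Plane : Type := EuclideanSpace ℝ (Fin 2)

/-- `2 × 2` matrices with the Euclidean (Frobenius) norm, indexed by pairs `(i, j)`. -/
abbrev Mat : Type := EuclideanSpace ℝ (Fin 2 × Fin 2)

/-- The standard basis vectors `e₁ = e 0`, `e₂ = e 1`. -/
abbrev e (i : Fin 2) : Plane := EuclideanSpace.single i 1

/-- The data of the problem: period `L`, viscosity `ν`, friction coefficient `k`, velocity `U₀` of the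
lower surface, profile `h` of the upper surface and background flow `U(x₂) e₁`. -/
structure Data where
  L : ℝ
  ν : ℝ
  k : ℝ
  U₀ : ℝ
  h : ℝ → ℝ
  U : ℝ → ℝ
  L_pos : 0 < L
  ν_pos : 0 < ν
  k_pos : 0 < k
  h_smooth : ContDiff ℝ ∞ h
  h_pos : ∀ s, 0 < h s
  h_periodic : ∀ s, h (s + L) = h s
  U_smooth : ContDiff ℝ ∞ U
  U_bottom : U 0 = U₀
  U_top : ∀ s ∈ Ioo 0 L, U (h s) = 0
  U_deriv_bottom : deriv U 0 = 0

namespace Data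

variable (D : Data)

/-! ### Geometry -/

/-- The closed infinite channel `0 ≤ x₂ ≤ h(x₁)`. Functions on `Ω` that are `L`-periodic in `x₁` are
regarded as functions on it. -/
def K : Set Plane := {x | 0 ≤ x 1 ∧ x 1 ≤ D.h (x 0)}

/-- The flow domain `Ω = {0 < x₁ < L, 0 < x₂ < h(x₁)}`. -/
def Ω : TopologicalSpace.Opens Plane where
  carrier := {x | (0 < x 0 ∧ x 0 < D.L) ∧ 0 < x 1 ∧ x 1 < D.h (x 0)}
  is_open' := by
    have hc : Continuous D.h := D.h_smooth.continuous
    have h0 : Continuous fun x : Plane => x 0 := by fun_prop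
    have h1 : Continuous fun x : Plane => x 1 := by fun_prop
    exact ((isOpen_lt continuous_const h0).inter (isOpen_lt h0 continuous_const)).inter
      ((isOpen_lt continuous_const h1).inter (isOpen_lt h1 (hc.comp h0)))

/-- The bottom `Γ₀`. -/
def Γ₀ : Set Plane := {x | (0 < x 0 ∧ x 0 < D.L) ∧ x 1 = 0}

/-- The top `Γ₁`. -/
def Γ₁ : Set Plane := {x | (0 < x 0 ∧ x 0 < D.L) ∧ x 1 = D.h (x 0)}

/-- The unit outward normal on `Γ₀`. -/
def n : Plane := -e 1

/-- Lebesgue measure on `Ω`. -/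
abbrev μ : Measure Plane := volume.restrict (D.Ω : Set Plane)

lemma Ω_subset_K : (D.Ω : Set Plane) ⊆ D.K := fun _ hx => ⟨hx.2.1.le, hx.2.2.le⟩

lemma K_mem_nhds {x : Plane} (hx : x ∈ D.Ω) : D.K ∈ 𝓝 x :=
  Filter.mem_of_superset (D.Ω.isOpen.mem_nhds hx) D.Ω_subset_K

/-! ### Derivatives on the closed channel -/

/-- Partial derivative `∂f/∂x_j` on the closed channel: the ordinary one at interior points, the
one-sided one at the boundary. -/
def pd {F : Type*} [NormedAddCommGroup F] [NormedSpace ℝ F] (j : Fin 2) (f : Plane → F)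
    (x : Plane) : F :=
  fderivWithin ℝ f D.K x (e j)

/-- The divergence. -/
def div (f : Plane → Plane) (x : Plane) : ℝ := ∑ j, D.pd j f x j

/-- The Jacobian matrix `(i, j) ↦ ∂f_i/∂x_j`. -/
def grad (f : Plane → Plane) (x : Plane) : Mat := WithLp.toLp 2 fun ij => D.pd ij.2 f x ij.1

/-- The gradient of a scalar function. -/
def sgrad (q : Plane → ℝ) (x : Plane) : Plane := WithLp.toLp 2 fun j => D.pd j q x

/-- The Laplacian of a vector field. -/
def lap (f : Plane → Plane) (x : Plane) : Plane := ∑ j, D.pd j (D.pd j f) x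

/-- The convective term `(w · ∇) f`. -/
def conv (w f : Plane → Plane) (x : Plane) : Plane := ∑ j, w x j • D.pd j f x

lemma pd_add {f g : Plane → Plane} {x : Plane} (j : Fin 2) (hx : x ∈ D.Ω)
    (hf : ContDiffOn ℝ ∞ f D.K) (hg : ContDiffOn ℝ ∞ g D.K) :
    D.pd j (f + g) x = D.pd j f x + D.pd j g x := by
  have hxK := D.Ω_subset_K hx
  have hu : UniqueDiffWithinAt ℝ D.K x := uniqueDiffWithinAt_of_mem_nhds (D.K_mem_nhds hx)
  have h1 := (hf.differentiableOn (by simp)) x hxK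
  have h2 := (hg.differentiableOn (by simp)) x hxK
  simp [pd, fderivWithin_add hu h1 h2]

lemma pd_smul {f : Plane → Plane} {x : Plane} (j : Fin 2) (c : ℝ) (hx : x ∈ D.Ω)
    (hf : ContDiffOn ℝ ∞ f D.K) : D.pd j (c • f) x = c • D.pd j f x := by
  have hxK := D.Ω_subset_K hx
  have hu : UniqueDiffWithinAt ℝ D.K x := uniqueDiffWithinAt_of_mem_nhds (D.K_mem_nhds hx)
  have h1 := (hf.differentiableOn (by simp)) x hxK
  simp [pd, fderivWithin_const_smul hu h1]

/-! ### Function spaces -/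

/-- The space `Ṽ` of smooth (up to the boundary) divergence-free fields, `L`-periodic in `x₁`, that vanish
on `Γ₁` and have zero normal component on `Γ₀`. -/
def Vtilde : Submodule ℝ (Plane → Plane) where
  carrier := {φ | ContDiffOn ℝ ∞ φ D.K ∧ (∀ x ∈ D.K, φ (x + D.L • e 0) = φ x) ∧
    (∀ x ∈ D.Ω, D.div φ x = 0) ∧ (∀ x ∈ D.Γ₁, φ x = 0) ∧ ∀ x ∈ D.Γ₀, inner ℝ (φ x) n = 0}
  zero_mem' := by
    refine ⟨contDiffOn_const, by simp, fun x hx => ?_, by simp, by simp⟩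
    simp [div, pd, show (0 : Plane → Plane) = fun _ => 0 from rfl]
  add_mem' := by
    rintro f g ⟨f1, f2, f3, f4, f5⟩ ⟨g1, g2, g3, g4, g5⟩
    refine ⟨f1.add g1, fun x hx => ?_, fun x hx => ?_, fun x hx => ?_, fun x hx => ?_⟩
    · simp only [Pi.add_apply, f2 x hx, g2 x hx]
    · have hf := f3 x hx
      have hg := g3 x hx
      simp only [div, D.pd_add _ hx f1 g1, PiLp.add_apply, Finset.sum_add_distrib] at *
      rw [hf, hg, add_zero]
    · simp [f4 x hx, g4 x hx]
    · simp [inner_add_left, f5 x hx, g5 x hx]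
  smul_mem' := by
    rintro c f ⟨f1, f2, f3, f4, f5⟩
    refine ⟨contDiffOn_const.smul f1, fun x hx => ?_, fun x hx => ?_, fun x hx => ?_,
      fun x hx => ?_⟩
    · simp only [Pi.smul_apply, f2 x hx]
    · have hf := f3 x hx
      simp only [div, D.pd_smul _ c hx f1, PiLp.smul_apply, smul_eq_mul, ← Finset.mul_sum] at *
      rw [hf, mul_zero]
    · simp [f4 x hx]
    · simp [inner_smul_left, f5 x hx]

/-- `L²(Ω)²`. -/
abbrev L2 : Type := Lp Plane 2 D.μ

/-- Pairs `(u, A)` of a square-integrable field and a square-integrable matrix field with the norm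
`(|u|² + |A|²)^{1/2}`; a field `u ∈ H¹(Ω)²` is identified with the pair `(u, ∇u)`. -/
abbrev H1 : Type := WithLp 2 (D.L2 × Lp Mat 2 D.μ)

/-- `Ṽ` as a subspace of `L²(Ω)²`. -/
def VtildeL2 : Submodule ℝ D.L2 where
  carrier := {u | ∃ φ ∈ D.Vtilde, u =ᵐ[D.μ] φ}
  zero_mem' := ⟨0, D.Vtilde.zero_mem, Lp.coeFn_zero _ _ _⟩
  add_mem' := by
    rintro u w ⟨φ, hφ, hu⟩ ⟨ψ, hψ, hw⟩
    exact ⟨φ + ψ, D.Vtilde.add_mem hφ hψ, (Lp.coeFn_add u w).trans (hu.add hw)⟩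
  smul_mem' := by
    rintro c u ⟨φ, hφ, hu⟩
    exact ⟨c • φ, D.Vtilde.smul_mem c hφ, (Lp.coeFn_smul c u).trans (hu.const_smul c)⟩

/-- `Ṽ` as a subspace of `H¹(Ω)²`. -/
def VtildeH1 : Submodule ℝ D.H1 where
  carrier := {w | ∃ φ ∈ D.Vtilde, w.fst =ᵐ[D.μ] φ ∧ w.snd =ᵐ[D.μ] D.grad φ}
  zero_mem' := by
    refine ⟨0, D.Vtilde.zero_mem, Lp.coeFn_zero _ _ _, (Lp.coeFn_zero _ _ _).trans ?_⟩
    refine Filter.Eventually.of_forall fun x => ?_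
    ext ij
    simp [grad, pd, show (0 : Plane → Plane) = fun _ => 0 from rfl]
  add_mem' := by
    rintro u w ⟨φ, hφ, hu, hu'⟩ ⟨ψ, hψ, hw, hw'⟩
    refine ⟨φ + ψ, D.Vtilde.add_mem hφ hψ, (Lp.coeFn_add _ _).trans (hu.add hw),
      (Lp.coeFn_add _ _).trans ((hu'.add hw').trans ?_)⟩
    filter_upwards [ae_restrict_mem D.Ω.isOpen.measurableSet] with x hx
    ext ij
    simp [grad, D.pd_add _ hx hφ.1 hψ.1]
  smul_mem' := by
    rintro c u ⟨φ, hφ, hu, hu'⟩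
    refine ⟨c • φ, D.Vtilde.smul_mem c hφ, (Lp.coeFn_smul _ _).trans (hu.const_smul c),
      (Lp.coeFn_smul _ _).trans ((hu'.const_smul c).trans ?_)⟩
    filter_upwards [ae_restrict_mem D.Ω.isOpen.measurableSet] with x hx
    ext ij
    simp [grad, D.pd_smul _ c hx hφ.1]

/-- `H`, the closure of `Ṽ` in `L²(Ω)²`. -/
def H : Submodule ℝ D.L2 := D.VtildeL2.topologicalClosure

/-- `V`, the closure of `Ṽ` in `H¹(Ω)²`. -/
def V : Submodule ℝ D.H1 := D.VtildeH1.topologicalClosure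

/-- The field underlying an element of `V`. -/
def fld (w : D.V) : Plane → Plane := (w : D.H1).fst

/-- The gradient of an element of `V`. -/
def dfld (w : D.V) : Plane → Mat := (w : D.H1).snd

/-! ### Forms and functionals -/

/-- `a(u, w) = ∫_Ω ∇u : ∇w`, in terms of the gradients `A = ∇u`, `B = ∇w`. -/
def a (A B : Plane → Mat) : ℝ := ∫ x in (D.Ω : Set Plane), ∑ i, ∑ j, A x (i, j) * B x (i, j)

/-- `b(u, v, w) = ∫_Ω ((u · ∇) v) · w`, in terms of `u`, the gradient `A = ∇v`, and `w`. -/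
def b (u : Plane → Plane) (A : Plane → Mat) (w : Plane → Plane) : ℝ :=
  ∫ x in (D.Ω : Set Plane), ∑ i, ∑ j, u x j * A x (i, j) * w x i

/-- `L²(Γ₀)²`, with `Γ₀` parametrized by `x₁ ∈ (0, L)`. -/
abbrev L2Γ₀ : Type := Lp Plane 2 (volume.restrict (Ioo 0 D.L))

/-- The graph of the restriction map `φ ↦ φ|_{Γ₀}` on `Ṽ`. -/
def restrGraph : Set (D.H1 × D.L2Γ₀) :=
  {z | ∃ φ ∈ D.Vtilde, z.1.fst =ᵐ[D.μ] φ ∧ z.1.snd =ᵐ[D.μ] D.grad φ ∧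
    z.2 =ᵐ[volume.restrict (Ioo 0 D.L)] fun s => φ !₂[s, 0]}

/-- The trace on `Γ₀` of an element of `V`: the trace operator is the closure of the restriction map
`φ ↦ φ|_{Γ₀}`, as an operator from `H¹(Ω)²` to `L²(Γ₀)²`. -/
def trace (w : D.V) : D.L2Γ₀ :=
  Classical.epsilon fun g => ((w : D.H1), g) ∈ closure D.restrGraph

/-- `j(w) = ∫_{Γ₀} k |w(x₁, 0)| dx₁`. -/
def j (w : D.V) : ℝ := ∫ s in Ioo 0 D.L, D.k * ‖D.trace w s‖

/-- The background flow `ξ = U(x₂) e₁`. -/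
def ξ (x : Plane) : Plane := D.U (x 1) • e 0

/-- `(𝓛(v), Θ) = -ν a(ξ, Θ) - b(ξ, v, Θ) - b(v, ξ, Θ)`. -/
def ℒ (v Θ : D.V) : ℝ :=
  -D.ν * D.a (D.grad D.ξ) (D.dfld Θ) - D.b D.ξ (D.dfld v) (D.fld Θ)
    - D.b (D.fld v) (D.grad D.ξ) (D.fld Θ)

/-! ### Weak solutions -/

/-- `v` is a solution of the variational inequality with initial datum `v₀ ∈ H` (only the values
`v t` with `0 ≤ t` matter). `vV` is `v` as a map into `V`, and `vt` is its time derivative, in the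
sense of distributions on `(0, ∞)`, with values in the dual `V'`. -/
def IsWeakSolution (v₀ : D.H) (v : ℝ → D.H) : Prop :=
  ∃ (vV : ℝ → D.V) (vt : ℝ → StrongDual ℝ D.V),
    (∀ T > 0, ContinuousOn v (Icc 0 T)) ∧
    (∀ᵐ t ∂(volume.restrict (Ioi (0 : ℝ))), (vV t : D.H1).fst = (v t : D.L2)) ∧
    (∀ T > 0, MemLp vV 2 (volume.restrict (Ioo 0 T))) ∧
    (∀ T > 0, MemLp vt 2 (volume.restrict (Ioo 0 T))) ∧
    (∀ ψ : ℝ → ℝ, ContDiff ℝ ∞ ψ → HasCompactSupport ψ → tsupport ψ ⊆ Ioi 0 → ∀ Θ : D.V,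
      ∫ t, deriv ψ t * inner ℝ (v t : D.L2) (Θ : D.H1).fst = -∫ t, ψ t * vt t Θ) ∧
    (∀ Θ : D.V, ∀ T > 0, ∀ᵐ t ∂(volume.restrict (Icc 0 T)),
      vt t (Θ - vV t) + D.ν * D.a (D.dfld (vV t)) (D.dfld (Θ - vV t))
          + D.b (D.fld (vV t)) (D.dfld (vV t)) (D.fld (Θ - vV t)) + D.j Θ - D.j (vV t)
        ≥ D.ℒ (vV t) (Θ - vV t)) ∧
    v 0 = v₀

/-! ### Classical solutions -/

/-- The right-hand side `G(v) = -U ∂₁v - v₂ U' e₁ + ν U'' e₁`. -/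
def G (v : Plane → Plane) (x : Plane) : Plane :=
  -(D.U (x 1) • D.pd 0 v x) - (v x 1 * deriv D.U (x 1)) • e 0
    + (D.ν * deriv (deriv D.U) (x 1)) • e 0

/-- The stress tensor `σ_ij(v, p) = -p δ_ij + ν (∂_j v_i + ∂_i v_j)`. -/
def stress (v : Plane → Plane) (p : Plane → ℝ) (x : Plane) : Matrix (Fin 2) (Fin 2) ℝ :=
  Matrix.of fun i l => -p x * (if i = l then 1 else 0) + D.ν * (D.pd l v x i + D.pd i v x l)

/-- The tangential part `y - (y · n) n` of a vector at `Γ₀`. -/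
def tangential (y : Plane) : Plane := y - inner ℝ y n • n

/-- The tangential component `σ_η(v, p)` of the stress on `Γ₀`. -/
def ση (v : Plane → Plane) (p : Plane → ℝ) (x : Plane) : Plane :=
  tangential (WithLp.toLp 2 (Matrix.mulVec (D.stress v p x) (WithLp.ofLp n)))

/-- Tresca's friction law at a point of `Γ₀`. -/
def Tresca (v : Plane → Plane) (p : Plane → ℝ) (x : Plane) : Prop :=
  ‖D.ση v p x‖ ≤ D.k ∧
    (‖D.ση v p x‖ < D.k → tangential (v x) = 0) ∧
    (‖D.ση v p x‖ = D.k → ∃ l : ℝ, 0 ≤ l ∧ tangential (v x) = -(l • D.ση v p x))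

/-- The smoothness required of the velocity: `L`-periodic in `x₁`, continuous for `t ≥ 0`, and with
`∂_t v`, `∂_i v`, `∂_i ∂_j v` existing and continuous for `t > 0`, all of this up to the top and
bottom boundary. -/
structure IsRegular (v : ℝ → Plane → Plane) : Prop where
  periodic : ∀ t ≥ 0, ∀ x ∈ D.K, v t (x + D.L • e 0) = v t x
  cont : ContinuousOn (fun q : ℝ × Plane => v q.1 q.2) (Ici 0 ×ˢ D.K)
  diff_time : ∀ t > 0, ∀ x ∈ D.K, DifferentiableAt ℝ (fun s => v s x) t
  cont_time : ContinuousOn (fun q : ℝ × Plane => deriv (fun s => v s q.2) q.1) (Ioi 0 ×ˢ D.K)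
  contDiff : ∀ t > 0, ContDiffOn ℝ 2 (v t) D.K
  cont_pd : ∀ i, ContinuousOn (fun q : ℝ × Plane => D.pd i (v q.1) q.2) (Ioi 0 ×ˢ D.K)
  cont_pd₂ : ∀ i l,
    ContinuousOn (fun q : ℝ × Plane => D.pd i (D.pd l (v q.1)) q.2) (Ioi 0 ×ˢ D.K)

/-- `(v, p)` is a classical solution of the homogenized problem with initial datum `v₀`. -/
structure IsClassicalSolution (v₀ : D.H) (v : ℝ → Plane → Plane) (p : ℝ → Plane → ℝ) : Prop where
  regular : D.IsRegular v
  p_contDiff : ∀ t > 0, ContDiffOn ℝ 1 (p t) D.K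
  p_periodic : ∀ t > 0, ∀ x ∈ D.K, p t (x + D.L • e 0) = p t x
  momentum : ∀ t > 0, ∀ x ∈ D.Ω,
    deriv (fun s => v s x) t - D.ν • D.lap (v t) x + D.conv (v t) (v t) x + D.sgrad (p t) x
      = D.G (v t) x
  incompressible : ∀ t > 0, ∀ x ∈ D.Ω, D.div (v t) x = 0
  top : ∀ t > 0, ∀ x ∈ D.Γ₁, v t x = 0
  bottom : ∀ t > 0, ∀ x ∈ D.Γ₀, inner ℝ (v t x) n = 0
  tresca : ∀ t > 0, ∀ x ∈ D.Γ₀, D.Tresca (v t) (p t) x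
  initial : v 0 =ᵐ[D.μ] (v₀ : D.L2)

/-- The map `v : [0, ∞) → H` and the function `v(t, x)` are the same vector field. -/
def Represents (w : ℝ → Plane → Plane) (v : ℝ → D.H) : Prop :=
  ∀ t ≥ 0, (v t : D.L2) =ᵐ[D.μ] w t

/-- The distribution `q` on `Ω` is the pressure of the velocity `v` at time `t`: in the sense of
distributions on `Ω`, `v_t - ν Δv + (v · ∇) v + ∇q = G(v)`. -/
def IsDistributionalPressure (v : ℝ → Plane → Plane) (t : ℝ) (q : 𝓓'(D.Ω, ℝ)) : Prop :=
  ∀ (i : Fin 2) (φ : 𝓓(D.Ω, ℝ)),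
    (∫ x in (D.Ω : Set Plane),
      (deriv (fun s => v s x) t - D.ν • D.lap (v t) x + D.conv (v t) (v t) x) i * φ x)
        + (∂_{e i} q) φ
      = ∫ x in (D.Ω : Set Plane), D.G (v t) x i * φ x

end Data

end TrescaFlow

end

/-! Everything at a fixed time t > 0 rests on one identity. Let w be a divergence-free periodic C²
field with the boundary conditions of Ṽ, and let f stand for w_t. Green's formula turns the terms of
the weak problem other than friction into (M, Z) + ∫ σ·Z over Γ₀, where M = f - νΔw + (w·∇)w - G(w)
is the momentum balance without pressure and σ = -ν ∂₂w₁ e₁ is the tangential stress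
(`weak_form_eq`, `inner_resid_visc`). Gradients of periodic C¹ functions are orthogonal to V
(`inner_sgrad`), and Tresca's law says pointwise that |σ| ≤ k and σ·w + k|w| = 0
(`IsAdmissible.tresca_iff`).

Classical to weak. Since M = -∇p, the first term drops out, and |σ| ≤ k with Cauchy-Schwarz gives
the inequality (`IsAdmissible.variational`). Two difficulties remain. (a) V is a closure of smooth
fields, but w(t) is only C² up to the boundary. By the Poincaré lemma on the straightened strip, w
has a stream function (`toH1_mem_V`). An explicit field carrying the flux is subtracted, and the
rest is averaged in x₁ with the kernel cos^{2n}(πs/L). By the addition theorem each average is a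
finite sum of products α(x₁) q(y) with α trigonometric and q of class C², and q is approximated in
C² by smooth functions with the same end conditions (`streamMem_of_hasFDerivAt`). (b) Regularity
says nothing about derivatives as t → 0, yet v must lie in L²(0,T;V) and v_t in L²(0,T;V'). Taking Θ
= 0 bounds (ν/2)‖∇w‖² by the derivative of ct - ‖w‖²/2, where c depends only on sup bounds. That
function is continuous on [0,T] and has a nonnegative derivative, so the derivative is integrable
(`IsClassicalSolution.integrableOn_grad_sq`). The identity above then controls w_t in V'
(`exists_norm_pair_sq_le`).

Weak to classical. The V-valued representative and the weak time derivative agree almost everywhere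
with the pointwise objects. These are continuous on (0,∞), so the variational inequality holds at
every t > 0 (`IsRegular.variational`), and the constraints encoded in V become pointwise ones.
Testing with w ± φ, where φ vanishes on Γ₀, shows that M is orthogonal to all such φ. Hence M is a
gradient: curls of products α(x₁)β(y) are tests to which a du Bois-Reymond lemma applies in each
variable (`exists_potential`). What remains for general φ is 0 ≤ ∫ σ·φ + ∫ k|φ|. Concentrating φ at
a point gives |σ| ≤ k, and Θ = 0 gives σ·w + k|w| = 0 (`IsAdmissible.exists_pressure`). The
distributional equation is integration by parts against test functions. -/

noncomputable section

namespace TrescaFlow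

open Filter
open scoped Pointwise

/-! ### Coordinates -/

/-- The point with coordinates `a, b`. -/
def pt (a b : ℝ) : Plane := a • e 0 + b • e 1

@[simp] lemma pt_apply_zero (a b : ℝ) : pt a b 0 = a := by simp [pt, e]

@[simp] lemma pt_apply_one (a b : ℝ) : pt a b 1 = b := by simp [pt, e]

lemma plane_ext {x y : Plane} (h0 : x 0 = y 0) (h1 : x 1 = y 1) : x = y := by
  ext i
  fin_cases i
  · exact h0
  · exact h1

@[simp] lemma pt_eta (x : Plane) : pt (x 0) (x 1) = x := plane_ext (by simp) (by simp)

lemma pt_eq (a b : ℝ) : pt a b = !₂[a, b] := plane_ext (by simp) (by simp)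

@[simp] lemma pt_add_smul (a b c : ℝ) : pt a b + c • e 0 = pt (a + c) b :=
  plane_ext (by simp) (by simp)

@[fun_prop] lemma continuous_pt {X : Type*} [TopologicalSpace X] {f g : X → ℝ} (hf : Continuous f)
    (hg : Continuous g) : Continuous fun x => pt (f x) (g x) := by
  unfold pt; fun_prop

@[fun_prop] lemma continuousOn_pt {X : Type*} [TopologicalSpace X] {f g : X → ℝ} {s : Set X}
    (hf : ContinuousOn f s) (hg : ContinuousOn g s) :
    ContinuousOn (fun x => pt (f x) (g x)) s := by
  unfold pt; fun_prop

@[fun_prop] lemma contDiff_pt {E : Type*} [NormedAddCommGroup E] [NormedSpace ℝ E] {n : WithTop ℕ∞}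
    {f g : E → ℝ} (hf : ContDiff ℝ n f) (hg : ContDiff ℝ n g) :
    ContDiff ℝ n fun x => pt (f x) (g x) := by
  unfold pt; fun_prop

@[fun_prop] lemma continuous_coord (i : Fin 2) : Continuous fun x : Plane => x i := by fun_prop

/-- Coordinate functionals. -/
abbrev coord (i : Fin 2) : Plane →L[ℝ] ℝ := EuclideanSpace.proj i

lemma clm_apply_eq {E : Type*} [NormedAddCommGroup E] [NormedSpace ℝ E] (T : Plane →L[ℝ] E)
    (v : Plane) : T v = v 0 • T (e 0) + v 1 • T (e 1) := by
  conv_lhs => rw [← pt_eta v, pt, map_add, map_smul, map_smul]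

lemma inner_plane (x y : Plane) : inner ℝ x y = x 0 * y 0 + x 1 * y 1 := by
  simp [PiLp.inner_apply, Fin.sum_univ_two, mul_comm]

lemma inner_n (x : Plane) : inner ℝ x Data.n = - x 1 := by
  simp [inner_plane, Data.n, e]

/-! ### The channel, its period cell, and bounds by compactness -/

namespace Data

variable (D : Data)

@[fun_prop] lemma h_continuous : Continuous D.h := D.h_smooth.continuous

lemma h_differentiable : Differentiable ℝ D.h := D.h_smooth.differentiable (by simp)

@[fun_prop] lemma h_deriv_continuous : Continuous (deriv D.h) :=
  D.h_smooth.continuous_deriv (by simp)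

lemma h_L : D.h D.L = D.h 0 := by simpa using D.h_periodic 0

lemma h_ne (s : ℝ) : D.h s ≠ 0 := (D.h_pos s).ne'

/-- The interior of the channel. -/
def Ki : Set Plane := {x | 0 < x 1 ∧ x 1 < D.h (x 0)}

lemma isOpen_Ki : IsOpen D.Ki :=
  (isOpen_lt (g := fun x : Plane => x 1) continuous_const (by fun_prop)).inter
    (isOpen_lt (f := fun x : Plane => x 1) (g := fun x => D.h (x 0)) (by fun_prop) (by fun_prop))

lemma Ki_subset_K : D.Ki ⊆ D.K := fun _ hx => ⟨hx.1.le, hx.2.le⟩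

lemma Ω_subset_Ki : (D.Ω : Set Plane) ⊆ D.Ki := fun _ hx => hx.2

lemma K_mem_nhds_of_Ki {x : Plane} (hx : x ∈ D.Ki) : D.K ∈ 𝓝 x :=
  mem_of_superset (D.isOpen_Ki.mem_nhds hx) D.Ki_subset_K

lemma add_mem_K {x : Plane} (hx : x ∈ D.K) : x + D.L • e 0 ∈ D.K := by
  refine ⟨by simpa using hx.1, ?_⟩
  simpa [D.h_periodic] using hx.2

lemma sub_mem_K {x : Plane} (hx : x ∈ D.K) : x - D.L • e 0 ∈ D.K := by
  refine ⟨by simpa using hx.1, ?_⟩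
  have := D.h_periodic (x 0 - D.L)
  simp only [sub_add_cancel] at this
  simpa [← this] using hx.2

lemma pt_mem_K {a y : ℝ} (hy : y ∈ Icc (0 : ℝ) 1) : pt a (y * D.h a) ∈ D.K := by
  have := D.h_pos a
  refine ⟨by simpa using mul_nonneg hy.1 this.le, ?_⟩
  simpa using mul_le_mul_of_nonneg_right hy.2 this.le

lemma pt_bot_mem_K (a : ℝ) : pt a 0 ∈ D.K := by
  simpa using D.pt_mem_K (a := a) (y := 0) (by simp)

lemma pt_top_mem_K (a : ℝ) : pt a (D.h a) ∈ D.K := by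
  simpa using D.pt_mem_K (a := a) (y := 1) (by simp)

lemma pt_mem_Ω {a y : ℝ} (ha : a ∈ Ioo 0 D.L) (hy : y ∈ Ioo (0 : ℝ) 1) :
    pt a (y * D.h a) ∈ D.Ω := by
  have := D.h_pos a
  refine ⟨by simpa using ha, by simpa using mul_pos hy.1 this, ?_⟩
  simpa using mul_lt_mul_of_pos_right hy.2 this

/-- One period of the closed channel. -/
def K₀ : Set Plane := {x | x ∈ D.K ∧ x 0 ∈ Icc 0 D.L}

lemma K₀_eq : D.K₀ = (fun z : ℝ × ℝ => pt z.1 (z.2 * D.h z.1)) '' (Icc 0 D.L ×ˢ Icc 0 1) := by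
  ext x
  constructor
  · rintro ⟨hK, hx⟩
    refine ⟨(x 0, x 1 / D.h (x 0)), ⟨hx, div_nonneg hK.1 (D.h_pos _).le, ?_⟩, ?_⟩
    · exact div_le_one_of_le₀ hK.2 (D.h_pos _).le
    · have := D.h_ne (x 0)
      apply plane_ext <;> simp [this]
  · rintro ⟨z, ⟨h1, h2⟩, rfl⟩
    exact ⟨D.pt_mem_K h2, by simpa using h1⟩

lemma isCompact_K₀ : IsCompact D.K₀ := by
  rw [K₀_eq]
  exact (isCompact_Icc.prod isCompact_Icc).image (by fun_prop)

lemma Ω_subset_K₀ : (D.Ω : Set Plane) ⊆ D.K₀ :=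
  fun _ hx => ⟨D.Ω_subset_K hx, hx.1.1.le, hx.1.2.le⟩

lemma K₀_subset_K : D.K₀ ⊆ D.K := fun _ hx => hx.1

lemma periodic_zsmul {E : Type*} {f : Plane → E} (hf : ∀ x ∈ D.K, f (x + D.L • e 0) = f x) (m : ℤ)
    {x : Plane} (hx : x ∈ D.K) : x + (m * D.L) • e 0 ∈ D.K ∧ f (x + (m * D.L) • e 0) = f x := by
  induction m with
  | zero => simpa using hx
  | succ i ih =>
    have h1 : x + ((((i : ℤ) + 1 : ℤ) : ℝ) * D.L) • e 0 = (x + (((i : ℤ) : ℝ) * D.L) • e 0) + D.L • e 0 := by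
      push_cast; module
    rw [h1]
    exact ⟨D.add_mem_K ih.1, (hf _ ih.1).trans ih.2⟩
  | pred i ih =>
    have h1 : x + (((-(i : ℤ) - 1 : ℤ) : ℝ) * D.L) • e 0 = (x + (((-(i : ℤ) : ℤ) : ℝ) * D.L) • e 0) - D.L • e 0 := by
      push_cast; module
    rw [h1]
    have h2 := D.sub_mem_K ih.1
    refine ⟨h2, ?_⟩
    rw [← hf _ h2, sub_add_cancel, ih.2]

lemma exists_mem_K₀ {x : Plane} (hx : x ∈ D.K) : ∃ m : ℤ, x + (m * D.L) • e 0 ∈ D.K₀ := by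
  obtain ⟨m, hm, -⟩ := existsUnique_add_zsmul_mem_Ico D.L_pos (x 0) 0
  refine ⟨m, (D.periodic_zsmul (f := fun _ => (0 : ℝ)) (by simp) m hx).1, ?_⟩
  have := Ico_subset_Icc_self hm
  simpa using this

lemma exists_bound {E : Type*} [NormedAddCommGroup E] {f : Plane → E} (hf : ContinuousOn f D.K) :
    ∃ C, 0 ≤ C ∧ ∀ x ∈ D.K₀, ‖f x‖ ≤ C := by
  obtain ⟨C, hC⟩ := D.isCompact_K₀.exists_bound_of_continuousOn (hf.mono D.K₀_subset_K)
  exact ⟨max C 0, le_max_right _ _, fun x hx => (hC x hx).trans (le_max_left _ _)⟩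

lemma exists_bound_periodic {E : Type*} [NormedAddCommGroup E] {f : Plane → E}
    (hf : ContinuousOn f D.K) (hp : ∀ x ∈ D.K, f (x + D.L • e 0) = f x) :
    ∃ C, 0 ≤ C ∧ ∀ x ∈ D.K, ‖f x‖ ≤ C := by
  obtain ⟨C, hC0, hC⟩ := D.exists_bound hf
  refine ⟨C, hC0, fun x hx => ?_⟩
  obtain ⟨m, hm⟩ := D.exists_mem_K₀ hx
  rw [← (D.periodic_zsmul hp m hx).2]
  exact hC _ hm

lemma volume_Ω_lt_top : volume (D.Ω : Set Plane) < ⊤ :=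
  (measure_mono D.Ω_subset_K₀).trans_lt D.isCompact_K₀.measure_lt_top

instance : IsFiniteMeasure D.μ := ⟨by simpa using D.volume_Ω_lt_top⟩

lemma measurableSet_Ω : MeasurableSet (D.Ω : Set Plane) := D.Ω.isOpen.measurableSet

lemma aestronglyMeasurable {E : Type*} [NormedAddCommGroup E] [SecondCountableTopology E]
    {f : Plane → E} (hf : ContinuousOn f D.Ω) :
    AEStronglyMeasurable f D.μ := hf.aestronglyMeasurable D.measurableSet_Ω

lemma memLp {E : Type*} [NormedAddCommGroup E] [SecondCountableTopology E] {f : Plane → E}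
    (hf : ContinuousOn f D.K) (p : ENNReal) : MemLp f p D.μ := by
  obtain ⟨C, -, hC⟩ := D.exists_bound hf
  refine MemLp.of_bound (D.aestronglyMeasurable (hf.mono D.Ω_subset_K)) C ?_
  filter_upwards [ae_restrict_mem D.measurableSet_Ω] with x hx using hC x (D.Ω_subset_K₀ hx)

lemma integrable {E : Type*} [NormedAddCommGroup E] [SecondCountableTopology E] {f : Plane → E}
    (hf : ContinuousOn f D.K) : Integrable f D.μ := memLp_one_iff_integrable.1 (D.memLp hf 1)

/-! ### Partial derivatives in the interior -/

lemma pd_eq {E : Type*} [NormedAddCommGroup E] [NormedSpace ℝ E] (j : Fin 2) (f : Plane → E)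
    {x : Plane} (hx : x ∈ D.Ki) : D.pd j f x = fderiv ℝ f x (e j) := by
  rw [pd, fderivWithin_of_mem_nhds (D.K_mem_nhds_of_Ki hx)]

lemma fderiv_apply_eq {E : Type*} [NormedAddCommGroup E] [NormedSpace ℝ E] (f : Plane → E)
    {x : Plane} (hx : x ∈ D.Ki) (v : Plane) :
    fderiv ℝ f x v = v 0 • D.pd 0 f x + v 1 • D.pd 1 f x := by
  rw [clm_apply_eq, D.pd_eq 0 f hx, D.pd_eq 1 f hx]

lemma differentiableAt {E : Type*} [NormedAddCommGroup E] [NormedSpace ℝ E] {f : Plane → E}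
    (hf : DifferentiableOn ℝ f D.K) {x : Plane} (hx : x ∈ D.Ki) : DifferentiableAt ℝ f x :=
  (hf x (D.Ki_subset_K hx)).differentiableAt (D.K_mem_nhds_of_Ki hx)

lemma pd_congr {E : Type*} [NormedAddCommGroup E] [NormedSpace ℝ E] (j : Fin 2) {f g : Plane → E}
    (hfg : EqOn f g D.K) {x : Plane} (hx : x ∈ D.K) : D.pd j f x = D.pd j g x := by
  rw [pd, pd, fderivWithin_congr hfg (hfg hx)]

lemma pd_periodic {E : Type*} [NormedAddCommGroup E] [NormedSpace ℝ E] (j : Fin 2) {f : Plane → E}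
    (hf : ∀ x ∈ D.K, f (x + D.L • e 0) = f x) {x : Plane} (hx : x ∈ D.K) :
    D.pd j f (x + D.L • e 0) = D.pd j f x := by
  have h1 : fderivWithin ℝ (fun y => f (y + D.L • e 0)) D.K x
      = fderivWithin ℝ f (D.L • e 0 +ᵥ D.K) (x + D.L • e 0) := fderivWithin_comp_add_right _
  have h2 : D.L • e 0 +ᵥ D.K = D.K := by
    ext y
    rw [Set.mem_vadd_set_iff_neg_vadd_mem, vadd_eq_add]
    refine ⟨fun h => ?_, fun h => ?_⟩
    · have := D.add_mem_K h
      rwa [neg_add_eq_sub, sub_add_cancel] at this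
    · rw [neg_add_eq_sub]
      exact D.sub_mem_K h
  rw [h2] at h1
  rw [pd, ← h1, fderivWithin_congr (fun y hy => hf y hy) (hf x hx), pd]

lemma pd_apply (j i : Fin 2) {f : Plane → Plane} {x : Plane} (hx : x ∈ D.Ki)
    (hf : DifferentiableAt ℝ f x) : D.pd j f x i = D.pd j (fun y => f y i) x := by
  rw [D.pd_eq _ _ hx, D.pd_eq _ _ hx]
  have := ((coord i).hasFDerivAt.comp x hf.hasFDerivAt).fderiv
  change fderiv ℝ (fun y => f y i) x = _ at this
  rw [this]
  simp

lemma grad_apply (f : Plane → Plane) (x : Plane) (i j : Fin 2) :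
    D.grad f x (i, j) = D.pd j f x i := rfl

/-! ### Straightening the channel -/

/-- The map `(x₁, y) ↦ (x₁, y h(x₁))`. -/
def Ψ (x : Plane) : Plane := pt (x 0) (x 1 * D.h (x 0))

/-- The map `(x₁, x₂) ↦ (x₁, x₂ / h(x₁))`. -/
def Φ (x : Plane) : Plane := pt (x 0) (x 1 / D.h (x 0))

lemma contDiff_Ψ : ContDiff ℝ ∞ D.Ψ := by
  have := D.h_smooth
  unfold Ψ
  fun_prop

lemma contDiff_Φ : ContDiff ℝ ∞ D.Φ := by
  have := D.h_smooth
  have h2 : ∀ x : Plane, D.h (x 0) ≠ 0 := fun x => D.h_ne _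
  unfold Φ
  fun_prop (disch := assumption)

lemma Ψ_Φ (x : Plane) : D.Ψ (D.Φ x) = x := by
  have := D.h_ne (x 0)
  apply plane_ext <;> simp [Ψ, Φ, this]

lemma Φ_Ψ (x : Plane) : D.Φ (D.Ψ x) = x := by
  have := D.h_ne (x 0)
  apply plane_ext <;> simp [Ψ, Φ, this]

/-- The closed strip. -/
def S : Set Plane := {x | x 1 ∈ Icc (0 : ℝ) 1}

/-- The open strip. -/
def Si : Set Plane := {x | x 1 ∈ Ioo (0 : ℝ) 1}

lemma Ψ_mem_K {x : Plane} (hx : x ∈ S) : D.Ψ x ∈ D.K := D.pt_mem_K hx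

lemma Ψ_mem_Ki {x : Plane} (hx : x ∈ Si) : D.Ψ x ∈ D.Ki := by
  have := D.h_pos (x 0)
  refine ⟨by simpa [Ψ] using mul_pos hx.1 this, ?_⟩
  simpa [Ψ] using mul_lt_mul_of_pos_right hx.2 this

lemma Φ_mem_S {x : Plane} (hx : x ∈ D.K) : D.Φ x ∈ S :=
  ⟨by simpa [Φ] using div_nonneg hx.1 (D.h_pos _).le,
    by simpa [Φ] using div_le_one_of_le₀ hx.2 (D.h_pos _).le⟩

lemma Φ_mem_Si {x : Plane} (hx : x ∈ D.Ki) : D.Φ x ∈ Si :=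
  ⟨by simpa [Φ] using div_pos hx.1 (D.h_pos _),
    by simpa [Φ] using (div_lt_one (D.h_pos _)).2 hx.2⟩

lemma Φ_periodic (x : Plane) : D.Φ (x + D.L • e 0) = D.Φ x + D.L • e 0 := by
  apply plane_ext <;> simp [Φ, D.h_periodic]

lemma Ψ_periodic (x : Plane) : D.Ψ (x + D.L • e 0) = D.Ψ x + D.L • e 0 := by
  apply plane_ext <;> simp [Ψ, D.h_periodic]

lemma isOpen_Si : IsOpen Si := isOpen_Ioo.preimage (continuous_coord 1)

lemma convex_S : Convex ℝ S := (convex_Icc 0 1).affine_preimage (coord 1).toLinearMap.toAffineMap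

lemma Si_subset_S : Si ⊆ S := fun _ hx => Ioo_subset_Icc_self hx

lemma S_subset_closure_Si : S ⊆ closure Si := by
  intro x hx
  have h1 : x 1 ∈ closure (Ioo (0 : ℝ) 1) := by rwa [closure_Ioo (by norm_num)]
  have h2 : Continuous fun y : ℝ => pt (x 0) y := by fun_prop
  have h3 := h2.continuousOn.image_closure (s := Ioo (0 : ℝ) 1) ⟨x 1, h1, pt_eta x⟩
  refine closure_mono ?_ h3
  rintro _ ⟨y, hy, rfl⟩
  simpa [Si] using hy

lemma uniqueDiffOn_S : UniqueDiffOn ℝ S :=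
  uniqueDiffOn_convex convex_S ⟨pt 0 (1 / 2), interior_maximal Si_subset_S isOpen_Si
    (by norm_num [Si])⟩

lemma hasFDerivAt_Ψ (x : Plane) : HasFDerivAt D.Ψ (fderiv ℝ D.Ψ x) x :=
  (D.contDiff_Ψ.differentiable (by simp) x).hasFDerivAt

lemma hasFDerivAt_Φ (x : Plane) : HasFDerivAt D.Φ (fderiv ℝ D.Φ x) x :=
  (D.contDiff_Φ.differentiable (by simp) x).hasFDerivAt

lemma fderiv_Ψ_Φ (x v : Plane) : fderiv ℝ D.Ψ (D.Φ x) (fderiv ℝ D.Φ x v) = v := by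
  have h := (D.hasFDerivAt_Ψ (D.Φ x)).comp x (D.hasFDerivAt_Φ x)
  have h2 : D.Ψ ∘ D.Φ = id := funext D.Ψ_Φ
  rw [h2] at h
  have := h.unique (hasFDerivAt_id x)
  exact congr($this v)

lemma K_eq_image : D.K = D.Ψ '' S := by
  ext x
  exact ⟨fun hx => ⟨D.Φ x, D.Φ_mem_S hx, D.Ψ_Φ x⟩, by rintro ⟨y, hy, rfl⟩; exact D.Ψ_mem_K hy⟩

/-- `K` is the image of a convex strip with nonempty interior under a diffeomorphism. Hence the
one-sided derivatives in `pd` are unambiguous and continuous up to the boundary for C¹ fields. -/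
lemma uniqueDiffOn_K : UniqueDiffOn ℝ D.K := by
  rw [K_eq_image]
  refine uniqueDiffOn_S.image (fun x _ => (D.hasFDerivAt_Ψ x).hasFDerivWithinAt) fun x _ => ?_
  refine Function.Surjective.denseRange fun v => ⟨fderiv ℝ D.Φ (D.Ψ x) v, ?_⟩
  simpa [D.Φ_Ψ] using D.fderiv_Ψ_Φ (D.Ψ x) v

lemma fderiv_Ψ (x v : Plane) :
    fderiv ℝ D.Ψ x v = pt (v 0) (v 1 * D.h (x 0) + x 1 * (deriv D.h (x 0) * v 0)) := by
  have h0 : HasFDerivAt (fun y : Plane => y 0) (coord 0) x := (coord 0).hasFDerivAt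
  have h1 : HasFDerivAt (fun y : Plane => y 1) (coord 1) x := (coord 1).hasFDerivAt
  have hh := (D.h_differentiable (x 0)).hasDerivAt.comp_hasFDerivAt x h0
  have := (h0.smul_const (e 0)).add ((h1.mul hh).smul_const (e 1))
  change HasFDerivAt D.Ψ _ x at this
  rw [this.fderiv]
  apply plane_ext <;> simp [e]; ring

/-- Obtained by solving DΨ · DΦ = id for DΦ, which avoids differentiating a quotient. -/
lemma fderiv_Φ (x v : Plane) : fderiv ℝ D.Φ x v =
    pt (v 0) (v 1 / D.h (x 0) - x 1 * (deriv D.h (x 0) * v 0) / D.h (x 0) ^ 2) := by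
  have h := D.fderiv_Ψ_Φ x v
  rw [fderiv_Ψ] at h
  have h0 := congr($h 0)
  have h1 := congr($h 1)
  have := D.h_ne (x 0)
  simp only [pt_apply_zero, pt_apply_one, Φ] at h0 h1
  apply plane_ext
  · simpa using h0
  · simp only [pt_apply_one]
    simp only [h0] at h1
    field_simp at h1 ⊢
    linarith

end Data

/-! ### Change of variables and the divergence theorem -/

lemma measurePreserving_pt : MeasurePreserving (fun z : ℝ × ℝ => pt z.1 z.2) := by
  have h := (PiLp.volume_preserving_toLp (Fin 2)).comp (volume_preserving_finTwoArrow ℝ).symm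
  have h2 : (fun z : ℝ × ℝ => pt z.1 z.2)
      = (WithLp.toLp 2 : (Fin 2 → ℝ) → Plane) ∘ (MeasurableEquiv.finTwoArrow (α := ℝ)).symm := by
    funext z
    apply plane_ext <;> simp [MeasurableEquiv.finTwoArrow]
  rw [h2]
  exact h

lemma measurableEmbedding_pt : MeasurableEmbedding (fun z : ℝ × ℝ => pt z.1 z.2) := by
  have h : Function.LeftInverse (fun x : Plane => (x 0, x 1)) (fun z : ℝ × ℝ => pt z.1 z.2) :=
    fun z => by simp
  exact (h.isClosedEmbedding (by fun_prop) (by fun_prop)).measurableEmbedding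

namespace Data

variable (D : Data)

/-- Fubini, then the substitution t = y h(a) in the vertical section (0, h(a)): integrals over Ω
become integrals over a fixed rectangle. -/
lemma integral_Ω {E : Type*} [NormedAddCommGroup E] [NormedSpace ℝ E] {g : Plane → E}
    (hg : Integrable g D.μ) :
    ∫ x in (D.Ω : Set Plane), g x
      = ∫ a in 0..D.L, ∫ y in (0 : ℝ)..1, D.h a • g (pt a (y * D.h a)) := by
  set A : Set (ℝ × ℝ) := (fun z : ℝ × ℝ => pt z.1 z.2) ⁻¹' (D.Ω : Set Plane) with hA
  have hAm : MeasurableSet A := D.measurableSet_Ω.preimage measurePreserving_pt.measurable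
  have h1 : ∫ x in (D.Ω : Set Plane), g x = ∫ z in A, g (pt z.1 z.2) :=
    (measurePreserving_pt.setIntegral_preimage_emb measurableEmbedding_pt g _).symm
  have h2 : IntegrableOn (fun z : ℝ × ℝ => g (pt z.1 z.2)) A :=
    (measurePreserving_pt.integrableOn_comp_preimage measurableEmbedding_pt).2 hg
  rw [h1, ← integral_indicator hAm, Measure.volume_eq_prod,
    integral_prod _ ((integrable_indicator_iff hAm).2 h2),
    intervalIntegral.integral_of_le D.L_pos.le, integral_Ioc_eq_integral_Ioo, ← integral_indicator measurableSet_Ioo]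
  congr 1
  funext a
  by_cases ha : a ∈ Ioo 0 D.L
  · rw [indicator_of_mem ha, intervalIntegral.integral_smul,
      intervalIntegral.smul_integral_comp_mul_right (fun t => g (pt a t)), zero_mul, one_mul,
      intervalIntegral.integral_of_le (D.h_pos a).le, integral_Ioc_eq_integral_Ioo,
      ← integral_indicator measurableSet_Ioo]
    congr 1
    funext t
    by_cases ht : t ∈ Ioo 0 (D.h a)
    · have : (a, t) ∈ A := by
        change (0 < pt a t 0 ∧ pt a t 0 < D.L) ∧ 0 < pt a t 1 ∧ pt a t 1 < D.h (pt a t 0)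
        simpa using ⟨ha, ht⟩
      rw [indicator_of_mem ht, indicator_of_mem this]
    · have : (a, t) ∉ A := fun h => by
        change (0 < pt a t 0 ∧ pt a t 0 < D.L) ∧ 0 < pt a t 1 ∧ pt a t 1 < D.h (pt a t 0) at h
        simp at h
        exact ht h.2
      rw [indicator_of_notMem ht, indicator_of_notMem this]
  · rw [indicator_of_notMem ha]
    have : ∀ t, A.indicator (fun z => g (pt z.1 z.2)) (a, t) = 0 := fun t => by
      refine indicator_of_notMem (fun h => ?_) _
      change (0 < pt a t 0 ∧ pt a t 0 < D.L) ∧ 0 < pt a t 1 ∧ pt a t 1 < D.h (pt a t 0) at h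
      simp at h
      exact ha h.1
    simp [this]

/-- The divergence theorem on `Ω`. -/
theorem integral_div {F : Plane → Plane} {d : Plane → ℝ} (hF : ContinuousOn F D.K)
    (hF' : ∀ x ∈ D.Ω, DifferentiableAt ℝ F x) (hd : ContinuousOn d D.K)
    (hdF : ∀ x ∈ D.Ω, d x = D.div F x)
    (hp : ∀ y ∈ Icc (0 : ℝ) 1, F (pt D.L (y * D.h D.L)) 0 = F (pt 0 (y * D.h 0)) 0) :
    ∫ x in (D.Ω : Set Plane), d x
      = (∫ a in 0..D.L, (F (pt a (D.h a)) 1 - deriv D.h a * F (pt a (D.h a)) 0))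
        - ∫ a in 0..D.L, F (pt a 0) 1 := by
  set P : ℝ × ℝ → Plane := fun z => pt z.1 (z.2 * D.h z.1) with hP
  have hPc : Continuous P := by rw [hP]; fun_prop
  have hmaps : MapsTo P (uIcc 0 D.L ×ˢ uIcc (0 : ℝ) 1) D.K := fun z hz => by
    rw [uIcc_of_le (zero_le_one' ℝ)] at hz
    exact D.pt_mem_K hz.2
  have hFP : ∀ i, ContinuousOn (fun z => F (P z) i) (uIcc 0 D.L ×ˢ uIcc (0 : ℝ) 1) := fun i =>
    (continuous_coord i).comp_continuousOn (hF.comp hPc.continuousOn hmaps)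
  have hfst : ∀ z : ℝ × ℝ, HasFDerivAt (fun z : ℝ × ℝ => z.1) (ContinuousLinearMap.fst ℝ ℝ ℝ) z :=
    fun z => (ContinuousLinearMap.fst ℝ ℝ ℝ).hasFDerivAt
  have hsnd : ∀ z : ℝ × ℝ, HasFDerivAt (fun z : ℝ × ℝ => z.2) (ContinuousLinearMap.snd ℝ ℝ ℝ) z :=
    fun z => (ContinuousLinearMap.snd ℝ ℝ ℝ).hasFDerivAt
  have hh : ∀ z : ℝ × ℝ, HasFDerivAt (fun z : ℝ × ℝ => D.h z.1) _ z := fun z =>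
    (D.h_differentiable z.1).hasDerivAt.comp_hasFDerivAt z (hfst z)
  have hh' : ∀ z : ℝ × ℝ, HasFDerivAt (fun z : ℝ × ℝ => deriv D.h z.1) _ z := fun z =>
    ((((contDiff_infty_iff_deriv.1 D.h_smooth).2).differentiable (by simp) z.1).hasDerivAt).comp_hasFDerivAt z
      (hfst z)
  have hP' : ∀ z : ℝ × ℝ, HasFDerivAt P _ z := fun z =>
    ((hfst z).smul_const (e 0)).add (((hsnd z).mul (hh z)).smul_const (e 1))
  have hbox : ∀ z ∈ Ioo (min 0 D.L) (max 0 D.L) ×ˢ Ioo (min (0 : ℝ) 1) (max 0 1), P z ∈ D.Ω := by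
    rintro z ⟨h1, h2⟩
    rw [min_eq_left D.L_pos.le, max_eq_right D.L_pos.le] at h1
    rw [min_eq_left zero_le_one, max_eq_right zero_le_one] at h2
    exact D.pt_mem_Ω h1 h2
  have hFd : ∀ i, ∀ z ∈ Ioo (min 0 D.L) (max 0 D.L) ×ˢ Ioo (min (0 : ℝ) 1) (max 0 1),
      HasFDerivAt (fun z => F (P z) i) _ z := fun i z hz =>
    (coord i).hasFDerivAt.comp z ((hF' _ (hbox z hz)).hasFDerivAt.comp z (hP' z))
  -- The pair (f, g) is the Piola transform of `F` under (x₁, y) ↦ (x₁, y h(x₁)). Its divergence is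
  -- h times the divergence of `F` at the image point, so the divergence theorem on a rectangle
  -- applies.
  set f : ℝ × ℝ → ℝ := fun z => D.h z.1 * F (P z) 0 with hf
  set g : ℝ × ℝ → ℝ := fun z => F (P z) 1 - z.2 * deriv D.h z.1 * F (P z) 0 with hg
  have hfd : ∀ z ∈ Ioo (min 0 D.L) (max 0 D.L) ×ˢ Ioo (min (0 : ℝ) 1) (max 0 1),
      HasFDerivAt f _ z := fun z hz => (hh z).mul (hFd 0 z hz)
  have hgd : ∀ z ∈ Ioo (min 0 D.L) (max 0 D.L) ×ˢ Ioo (min (0 : ℝ) 1) (max 0 1),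
      HasFDerivAt g _ z := fun z hz =>
    (hFd 1 z hz).sub (((hsnd z).mul (hh' z)).mul (hFd 0 z hz))
  have key : ∀ z ∈ Ioo (min 0 D.L) (max 0 D.L) ×ˢ Ioo (min (0 : ℝ) 1) (max 0 1),
      fderiv ℝ f z (1, 0) + fderiv ℝ g z (0, 1) = D.h z.1 * d (P z) := by
    intro z hz
    rw [(hfd z hz).fderiv, (hgd z hz).fderiv, hdF _ (hbox z hz), div, Fin.sum_univ_two]
    have hz' := D.Ω_subset_Ki (hbox z hz)
    rw [D.pd_eq 0 F hz', D.pd_eq 1 F hz']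
    simp
    ring
  have hfc : ContinuousOn f (uIcc 0 D.L ×ˢ uIcc (0 : ℝ) 1) := by
    have := hFP 0
    fun_prop
  have hgc : ContinuousOn g (uIcc 0 D.L ×ˢ uIcc (0 : ℝ) 1) := by
    have := hFP 0
    have := hFP 1
    fun_prop
  have hdc : ContinuousOn (fun z => D.h z.1 * d (P z)) (uIcc 0 D.L ×ˢ uIcc (0 : ℝ) 1) := by
    have := hd.comp hPc.continuousOn hmaps
    simp only [Function.comp_def] at this
    fun_prop
  have hnull : (Ioo (min 0 D.L) (max 0 D.L) ×ˢ Ioo (min (0 : ℝ) 1) (max 0 1) : Set (ℝ × ℝ))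
      =ᵐ[volume] (uIcc 0 D.L ×ˢ uIcc (0 : ℝ) 1 : Set (ℝ × ℝ)) := by
    rw [Measure.volume_eq_prod]
    exact Measure.set_prod_ae_eq Ioo_ae_eq_Icc Ioo_ae_eq_Icc
  have hae : (fun z => fderiv ℝ f z (1, 0) + fderiv ℝ g z (0, 1))
      =ᵐ[volume.restrict (uIcc 0 D.L ×ˢ uIcc (0 : ℝ) 1)] fun z => D.h z.1 * d (P z) := by
    rw [← Measure.restrict_congr_set hnull]
    filter_upwards [ae_restrict_mem (measurableSet_Ioo.prod measurableSet_Ioo)] with z hz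
    exact key z hz
  have hint : IntegrableOn (fun z => D.h z.1 * d (P z)) (uIcc 0 D.L ×ˢ uIcc (0 : ℝ) 1) :=
    hdc.integrableOn_compact (isCompact_uIcc.prod isCompact_uIcc)
  have main := integral2_divergence_prod_of_hasFDerivAt f g (fderiv ℝ f) (fderiv ℝ g) 0 0 D.L 1
    hfc hgc (fun z hz => (hfd z hz).differentiableAt.hasFDerivAt)
    (fun z hz => (hgd z hz).differentiableAt.hasFDerivAt) (hint.congr hae.symm)
  rw [D.integral_Ω (D.integrable hd)]
  -- The fluxes through the two lateral sides cancel.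
  have hL : ∫ y in (0 : ℝ)..1, f (D.L, y) = ∫ y in (0 : ℝ)..1, f (0, y) := by
    refine intervalIntegral.integral_congr fun y hy => ?_
    rw [uIcc_of_le zero_le_one] at hy
    simp only [hf, hP, D.h_L]
    have := hp y hy
    rw [D.h_L] at this
    rw [this]
  rw [hL, add_sub_cancel_right] at main
  simp only [hg, hP] at main
  simp only [one_mul, zero_mul, sub_zero] at main
  rw [← main]
  refine intervalIntegral.integral_congr_ae ?_
  -- `key` holds in the open rectangle only, so the right end points of the half-open integration
  -- intervals are discarded.
  have h0 : ∀ᵐ a : ℝ, a ≠ D.L := Measure.ae_ne volume D.L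
  have h1 : ∀ᵐ y : ℝ, y ≠ 1 := Measure.ae_ne volume 1
  filter_upwards [h0] with a ha ha2
  refine intervalIntegral.integral_congr_ae ?_
  filter_upwards [h1] with y hy hy2
  rw [uIoc_of_le D.L_pos.le] at ha2
  rw [uIoc_of_le zero_le_one] at hy2
  have hz : ((a, y) : ℝ × ℝ) ∈ Ioo (min 0 D.L) (max 0 D.L) ×ˢ Ioo (min (0 : ℝ) 1) (max 0 1) := by
    rw [min_eq_left D.L_pos.le, max_eq_right D.L_pos.le, min_eq_left zero_le_one,
      max_eq_right zero_le_one]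
    exact ⟨⟨ha2.1, lt_of_le_of_ne ha2.2 ha⟩, ⟨hy2.1, lt_of_le_of_ne hy2.2 hy⟩⟩
  exact (key _ hz).symm

end Data

/-! ### Square-integrable classes, the forms `a` and `b`, and the space `V` -/

lemma L2_inner_eq {α E : Type*} [MeasurableSpace α] {μ : Measure α} [NormedAddCommGroup E]
    [InnerProductSpace ℝ E] {f g : Lp E 2 μ} {u v : α → E} (hu : f =ᵐ[μ] u) (hv : g =ᵐ[μ] v) :
    inner ℝ f g = ∫ x, inner ℝ (u x) (v x) ∂μ := by
  rw [L2.inner_def]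
  refine integral_congr_ae ?_
  filter_upwards [hu, hv] with x h1 h2
  rw [h1, h2]

lemma L2_norm_sq_eq {α E : Type*} [MeasurableSpace α] {μ : Measure α} [NormedAddCommGroup E]
    [InnerProductSpace ℝ E] {f : Lp E 2 μ} {u : α → E} (hu : f =ᵐ[μ] u) :
    ‖f‖ ^ 2 = ∫ x, ‖u x‖ ^ 2 ∂μ := by
  rw [← real_inner_self_eq_norm_sq, L2_inner_eq hu hu]
  simp

lemma inner_mat (A B : Mat) : inner ℝ A B = ∑ i, ∑ j, A (i, j) * B (i, j) := by
  simp [PiLp.inner_apply, Fintype.sum_prod_type, mul_comm]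

namespace Data

variable (D : Data)

/-- The matrix-vector product `(A u)_i = ∑_j u_j A_ij`. -/
def mulVec (u : Plane) (A : Mat) : Plane := WithLp.toLp 2 fun i => ∑ j, u j * A (i, j)

lemma conv_eq (u v : Plane → Plane) (x : Plane) : D.conv u v x = mulVec (u x) (D.grad v x) := by
  ext i
  simp [conv, mulVec, grad]

lemma a_congr {A B A' B' : Plane → Mat} (hA : A =ᵐ[D.μ] A') (hB : B =ᵐ[D.μ] B') :
    D.a A B = D.a A' B' := by
  refine integral_congr_ae ?_
  filter_upwards [hA, hB] with x h1 h2
  rw [h1, h2]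

lemma a_eq_inner {A B : Plane → Mat} {P Q : Lp Mat 2 D.μ} (hA : P =ᵐ[D.μ] A) (hB : Q =ᵐ[D.μ] B) :
    D.a A B = inner ℝ P Q := by
  rw [L2_inner_eq hA hB, a]
  simp only [inner_mat]

lemma b_eq_integral (u : Plane → Plane) (A : Plane → Mat) (w : Plane → Plane) :
    D.b u A w = ∫ x in (D.Ω : Set Plane), inner ℝ (mulVec (u x) (A x)) (w x) := by
  unfold b
  congr 1
  funext x
  simp [inner_plane, mulVec, Fin.sum_univ_two]
  ring

lemma b_congr {u u' : Plane → Plane} {A A' : Plane → Mat} {w w' : Plane → Plane}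
    (hu : u =ᵐ[D.μ] u') (hA : A =ᵐ[D.μ] A') (hw : w =ᵐ[D.μ] w') : D.b u A w = D.b u' A' w' := by
  refine integral_congr_ae ?_
  filter_upwards [hu, hA, hw] with x h1 h2 h3
  rw [h1, h2, h3]

lemma b_eq_inner {u : Plane → Plane} {A : Plane → Mat} {w : Plane → Plane} {P Q : D.L2}
    (hP : P =ᵐ[D.μ] fun x => mulVec (u x) (A x)) (hQ : Q =ᵐ[D.μ] w) :
    D.b u A w = inner ℝ P Q := by
  rw [L2_inner_eq hP hQ, b_eq_integral]

/-- The class in `L²(Ω)` of a function (zero if it is not square integrable). -/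
def toL2 {E : Type*} [NormedAddCommGroup E] (u : Plane → E) : Lp E 2 D.μ :=
  open Classical in if h : MemLp u 2 D.μ then h.toLp u else 0

lemma coeFn_toL2' {E : Type*} [NormedAddCommGroup E] {u : Plane → E} (h : MemLp u 2 D.μ) :
    D.toL2 u =ᵐ[D.μ] u := by
  rw [toL2, dif_pos h]
  exact h.coeFn_toLp

lemma coeFn_toL2 {E : Type*} [NormedAddCommGroup E] [SecondCountableTopology E] {u : Plane → E}
    (h : ContinuousOn u D.K) : D.toL2 u =ᵐ[D.μ] u := D.coeFn_toL2' (D.memLp h 2)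

/-- The element `(u, A)` of `L² × L²`. -/
def toH1 (u : Plane → Plane) (A : Plane → Mat) : D.H1 := WithLp.toLp 2 (D.toL2 u, D.toL2 A)

@[simp] lemma toH1_fst (u : Plane → Plane) (A : Plane → Mat) : (D.toH1 u A).fst = D.toL2 u := rfl

@[simp] lemma toH1_snd (u : Plane → Plane) (A : Plane → Mat) : (D.toH1 u A).snd = D.toL2 A := rfl

lemma H1_ext {w z : D.H1} (h1 : w.fst = z.fst) (h2 : w.snd = z.snd) : w = z :=
  (WithLp.equiv 2 _).injective (Prod.ext h1 h2)

lemma eq_toH1 {w : D.H1} {u : Plane → Plane} {A : Plane → Mat} (hu : ContinuousOn u D.K)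
    (hA : ContinuousOn A D.K) (h1 : w.fst =ᵐ[D.μ] u) (h2 : w.snd =ᵐ[D.μ] A) : w = D.toH1 u A :=
  D.H1_ext (Lp.ext (h1.trans (D.coeFn_toL2 hu).symm)) (Lp.ext (h2.trans (D.coeFn_toL2 hA).symm))

lemma H1_inner (w z : D.H1) : inner ℝ w z = inner ℝ w.fst z.fst + inner ℝ w.snd z.snd :=
  WithLp.prod_inner_apply _ _

lemma H1_norm_sq (w : D.H1) : ‖w‖ ^ 2 = ‖w.fst‖ ^ 2 + ‖w.snd‖ ^ 2 :=
  WithLp.prod_norm_sq_eq_of_L2 _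

lemma norm_fst_le (w : D.H1) : ‖w.fst‖ ≤ ‖w‖ := by
  refine abs_le_of_sq_le_sq' ?_ (norm_nonneg _) |>.2
  rw [H1_norm_sq]
  nlinarith [sq_nonneg ‖w.snd‖]

lemma norm_snd_le (w : D.H1) : ‖w.snd‖ ≤ ‖w‖ := by
  refine abs_le_of_sq_le_sq' ?_ (norm_nonneg _) |>.2
  rw [H1_norm_sq]
  nlinarith [sq_nonneg ‖w.fst‖]

/-- Joint continuity is uniform over the compact period cell, and the L² norm is at most |Ω|^{1/2}
times the sup norm. -/
lemma continuousOn_toL2 {E : Type*} [NormedAddCommGroup E] [SecondCountableTopology E]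
    {F : ℝ → Plane → E} {I : Set ℝ}
    (hF : ContinuousOn (fun q : ℝ × Plane => F q.1 q.2) (I ×ˢ D.K)) :
    ContinuousOn (fun t => D.toL2 (F t)) I := by
  have hFt : ∀ t ∈ I, ContinuousOn (F t) D.K := fun t ht =>
    hF.comp (f := fun x => (t, x)) (by fun_prop) fun x hx => ⟨ht, hx⟩
  intro t₀ ht₀
  rw [Metric.continuousWithinAt_iff']
  intro ε hε
  set M : ℝ := (measureUnivNNReal D.μ : ℝ) ^ ((2 : ENNReal).toReal⁻¹) with hM
  have hM0 : 0 ≤ M := by positivity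
  have hδ : 0 < ε / (M + 1) := by positivity
  obtain ⟨v, hv, hv2⟩ := D.isCompact_K₀.mem_uniformity_of_prod
    (f := F) (hF.mono (prod_mono_right D.K₀_subset_K)) ht₀ (Metric.dist_mem_uniformity hδ)
  filter_upwards [hv, self_mem_nhdsWithin] with t ht htI
  rw [dist_eq_norm]
  have : ‖D.toL2 (F t) - D.toL2 (F t₀)‖ ≤ M * (ε / (M + 1)) := by
    rw [hM]
    refine Lp.norm_le_of_ae_bound hδ.le ?_
    filter_upwards [Lp.coeFn_sub (D.toL2 (F t)) (D.toL2 (F t₀)), D.coeFn_toL2 (hFt t htI),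
      D.coeFn_toL2 (hFt t₀ ht₀), ae_restrict_mem D.measurableSet_Ω] with x h1 h2 h3 h4
    rw [h1, Pi.sub_apply, h2, h3, ← dist_eq_norm]
    exact (hv2 t ht x (D.Ω_subset_K₀ h4)).le
  refine this.trans_lt ?_
  rw [mul_div_assoc', div_lt_iff₀ (by positivity)]
  nlinarith

lemma continuousOn_toH1 {F : ℝ → Plane → Plane} {A : ℝ → Plane → Mat} {I : Set ℝ}
    (hF : ContinuousOn (fun q : ℝ × Plane => F q.1 q.2) (I ×ˢ D.K))
    (hA : ContinuousOn (fun q : ℝ × Plane => A q.1 q.2) (I ×ˢ D.K)) :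
    ContinuousOn (fun t => D.toH1 (F t) (A t)) I :=
  (WithLp.prod_continuous_toLp 2 _ _).comp_continuousOn
    ((D.continuousOn_toL2 hF).prodMk (D.continuousOn_toL2 hA))

/-! ### Continuously differentiable fields on the closed channel -/

lemma continuousOn_pd {E : Type*} [NormedAddCommGroup E] [NormedSpace ℝ E] {f : Plane → E}
    (hf : ContDiffOn ℝ 1 f D.K) (j : Fin 2) : ContinuousOn (D.pd j f) D.K :=
  (hf.continuousOn_fderivWithin D.uniqueDiffOn_K le_rfl).clm_apply continuousOn_const

lemma contDiffOn_pd {E : Type*} [NormedAddCommGroup E] [NormedSpace ℝ E] {f : Plane → E}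
    {m n : WithTop ℕ∞} (hf : ContDiffOn ℝ n f D.K) (hmn : m + 1 ≤ n) (j : Fin 2) :
    ContDiffOn ℝ m (D.pd j f) D.K :=
  (hf.fderivWithin D.uniqueDiffOn_K hmn).clm_apply contDiffOn_const

lemma continuousOn_grad_of {f : Plane → Plane} (hf : ∀ j, ContinuousOn (D.pd j f) D.K) :
    ContinuousOn (D.grad f) D.K := by
  refine (PiLp.continuous_toLp 2 _).comp_continuousOn (continuousOn_pi.2 fun ij => ?_)
  exact (continuous_coord ij.1).comp_continuousOn (hf ij.2)

lemma continuousOn_grad {f : Plane → Plane} (hf : ContDiffOn ℝ 1 f D.K) :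
    ContinuousOn (D.grad f) D.K := D.continuousOn_grad_of fun j => D.continuousOn_pd hf j

lemma differentiableAt' {E : Type*} [NormedAddCommGroup E] [NormedSpace ℝ E] {f : Plane → E}
    (hf : ContDiffOn ℝ 1 f D.K) {x : Plane} (hx : x ∈ D.Ki) : DifferentiableAt ℝ f x :=
  D.differentiableAt (hf.differentiableOn (by simp)) hx

lemma pd_sub {E : Type*} [NormedAddCommGroup E] [NormedSpace ℝ E] {f g : Plane → E} (j : Fin 2)
    (hf : ContDiffOn ℝ 1 f D.K) (hg : ContDiffOn ℝ 1 g D.K) {x : Plane} (hx : x ∈ D.Ki) :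
    D.pd j (f - g) x = D.pd j f x - D.pd j g x := by
  rw [D.pd_eq _ _ hx, D.pd_eq _ _ hx, D.pd_eq _ _ hx,
    fderiv_sub (D.differentiableAt' hf hx) (D.differentiableAt' hg hx)]
  rfl

lemma grad_sub {f g : Plane → Plane}
    (hf : ContDiffOn ℝ 1 f D.K) (hg : ContDiffOn ℝ 1 g D.K) {x : Plane} (hx : x ∈ D.Ki) :
    D.grad (f - g) x = D.grad f x - D.grad g x := by
  ext ij
  simp [grad, D.pd_sub _ hf hg hx]

lemma norm_pd_le (f : Plane → Plane) (x : Plane) (j : Fin 2) : ‖D.pd j f x‖ ^ 2 ≤ ‖D.grad f x‖ ^ 2 := by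
  rw [EuclideanSpace.norm_sq_eq, EuclideanSpace.norm_sq_eq, Fintype.sum_prod_type]
  refine Finset.sum_le_sum fun i _ => ?_
  exact Finset.single_le_sum (f := fun j => ‖D.grad f x (i, j)‖ ^ 2) (fun _ _ => by positivity)
    (Finset.mem_univ j)

lemma div_sq_le (f : Plane → Plane) (x : Plane) : D.div f x ^ 2 ≤ 2 * ‖D.grad f x‖ ^ 2 := by
  rw [EuclideanSpace.norm_sq_eq, Fintype.sum_prod_type]
  simp only [Fin.sum_univ_two, div, grad_apply, Real.norm_eq_abs, sq_abs]
  nlinarith [sq_nonneg (D.pd 0 f x 0 - D.pd 1 f x 1), sq_nonneg (D.pd 0 f x 1),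
    sq_nonneg (D.pd 1 f x 0)]

lemma Vtilde_contDiffOn {φ : Plane → Plane} (hφ : φ ∈ D.Vtilde) : ContDiffOn ℝ 1 φ D.K :=
  hφ.1.of_le (by simp)

lemma toH1_mem_VtildeH1 {φ : Plane → Plane} (hφ : φ ∈ D.Vtilde) :
    D.toH1 φ (D.grad φ) ∈ D.VtildeH1 :=
  ⟨φ, hφ, D.coeFn_toL2 hφ.1.continuousOn,
    D.coeFn_toL2 (D.continuousOn_grad (D.Vtilde_contDiffOn hφ))⟩

lemma VtildeH1_le_V : D.VtildeH1 ≤ D.V := D.VtildeH1.le_topologicalClosure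

lemma isClosed_V : IsClosed (D.V : Set D.H1) := D.VtildeH1.isClosed_topologicalClosure

/-- The element of `V` given by a smooth field. -/
def ofVtilde {φ : Plane → Plane} (hφ : φ ∈ D.Vtilde) : D.V :=
  ⟨D.toH1 φ (D.grad φ), D.VtildeH1_le_V (D.toH1_mem_VtildeH1 hφ)⟩

/-- Closed conditions on `V` may be checked on smooth fields. -/
lemma V_induction {p : D.H1 → Prop} (hp : IsClosed {w | p w})
    (h : ∀ φ ∈ D.Vtilde, p (D.toH1 φ (D.grad φ))) (w : D.H1) (hw : w ∈ D.V) : p w := by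
  have h1 : (D.VtildeH1 : Set D.H1) ⊆ {w | p w} := by
    rintro z ⟨φ, hφ, h1, h2⟩
    rw [D.eq_toH1 hφ.1.continuousOn (D.continuousOn_grad (D.Vtilde_contDiffOn hφ)) h1 h2]
    exact h φ hφ
  exact hp.closure_subset_iff.2 h1 hw

lemma fst_mem_H {w : D.H1} (hw : w ∈ D.V) : w.fst ∈ D.H := by
  refine D.V_induction (p := fun w => w.fst ∈ D.H) ?_ (fun φ hφ => ?_) w hw
  · exact D.VtildeL2.isClosed_topologicalClosure.preimage (WithLp.continuous_fst _ _ _)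
  · exact D.VtildeL2.le_topologicalClosure ⟨φ, hφ, D.coeFn_toL2 hφ.1.continuousOn⟩

end Data

namespace Data

variable (D : Data)

/-! ### Boundary traces -/

/-- A weighted identity for the boundary values of `|u|²`. -/
lemma integral_weight {u : Plane → Plane} (hu : ContDiffOn ℝ 1 u D.K) (α β : ℝ) :
    ∫ x in (D.Ω : Set Plane), (β / D.h (x 0) * ‖u x‖ ^ 2
        + (α + β * (x 1 / D.h (x 0))) * (2 * inner ℝ (u x) (D.pd 1 u x)))
      = (∫ s in 0..D.L, (α + β) * ‖u (pt s (D.h s))‖ ^ 2)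
        - ∫ s in 0..D.L, α * ‖u (pt s 0)‖ ^ 2 := by
  have hne : ∀ x : Plane, D.h (x 0) ≠ 0 := fun x => D.h_ne _
  have hc0 : ContinuousOn u D.K := hu.continuousOn
  have hc1 : ContinuousOn (D.pd 1 u) D.K := D.continuousOn_pd hu 1
  set c : Plane → ℝ := fun x => α + β * (x 1 / D.h (x 0)) with hc
  have hcc : ContDiff ℝ ∞ c := by
    have := D.h_smooth
    rw [hc]; fun_prop (disch := assumption)
  have hcd : ∀ x, HasFDerivAt c (fderiv ℝ c x) x := fun x =>
    (hcc.differentiable (by simp) x).hasFDerivAt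
  have hc' : ∀ x, fderiv ℝ c x (e 1) = β / D.h (x 0) := fun x => by
    have h1 : c = fun x => α + β * D.Φ x 1 := by
      funext x; simp [hc, Φ]
    have h2 := (((coord 1).hasFDerivAt.comp x (D.hasFDerivAt_Φ x)).const_mul β).const_add α
    change HasFDerivAt (fun x => α + β * D.Φ x 1) _ x at h2
    rw [h1, h2.fderiv]
    simp [D.fderiv_Φ, e]
    ring
  -- The flux field is vertical. Hence the lateral sides contribute nothing and `u` need not be
  -- periodic.
  have main := D.integral_div (F := fun x => (c x * ‖u x‖ ^ 2) • e 1)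
    (d := fun x => β / D.h (x 0) * ‖u x‖ ^ 2 + c x * (2 * inner ℝ (u x) (D.pd 1 u x))) ?_ ?_ ?_ ?_ ?_
  · rw [main]
    simp [e, hc, D.h_ne]
  · have := hcc.continuous
    fun_prop
  · intro x hx
    have h1 := D.differentiableAt' hu (D.Ω_subset_Ki hx)
    have h2 := (hcd x).differentiableAt
    exact ((h2.mul (h1.norm_sq ℝ)).smul_const _)
  · have := hcc.continuous
    have h3 : Continuous fun x : Plane => β / D.h (x 0) := by fun_prop (disch := assumption)
    exact (h3.continuousOn.mul (hc0.norm.pow 2)).add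
      (this.continuousOn.mul (continuousOn_const.mul (hc0.inner hc1)))
  · intro x hx
    have h1 := (D.differentiableAt' hu (D.Ω_subset_Ki hx)).hasFDerivAt
    have h2 := (((hcd x).mul h1.norm_sq).smul_const (e 1)).fderiv
    rw [div, Fin.sum_univ_two, D.pd_eq _ _ (D.Ω_subset_Ki hx), D.pd_eq _ _ (D.Ω_subset_Ki hx),
      D.pd_eq _ _ (D.Ω_subset_Ki hx)]
    change fderiv ℝ (fun x => (c x * ‖u x‖ ^ 2) • e 1) x = _ at h2
    rw [h2]
    have h3 := hc' x
    simp [e] at h3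
    simp [h3]
    ring
  · intro y _
    simp [e]

/-- In `integral_weight`, a weight that is affine in x₂/h, zero on one boundary curve and ±1 on the
other isolates one boundary integral. The weight is at most 1 in modulus on Ω, 1/h is bounded on a
period, and 2|u||∂₂u| ≤ |u|² + |∇u|². -/
lemma exists_trace_bound : ∃ C, 0 ≤ C ∧ ∀ u : Plane → Plane, ContDiffOn ℝ 1 u D.K →
    (∫ s in 0..D.L, ‖u (pt s 0)‖ ^ 2)
        ≤ C * ∫ x in (D.Ω : Set Plane), (‖u x‖ ^ 2 + ‖D.grad u x‖ ^ 2) ∧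
    (∫ s in 0..D.L, ‖u (pt s (D.h s))‖ ^ 2)
        ≤ C * ∫ x in (D.Ω : Set Plane), (‖u x‖ ^ 2 + ‖D.grad u x‖ ^ 2) := by
  obtain ⟨C, hC0, hC⟩ := D.exists_bound (f := fun x => 1 / D.h (x 0))
    (by have : ∀ x : Plane, D.h (x 0) ≠ 0 := fun x => D.h_ne _
        have : Continuous fun x : Plane => 1 / D.h (x 0) := by fun_prop (disch := assumption)
        exact this.continuousOn)
  refine ⟨C + 1, by positivity, fun u hu => ?_⟩
  have hne : ∀ x : Plane, D.h (x 0) ≠ 0 := fun x => D.h_ne _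
  have hc0 : ContinuousOn u D.K := hu.continuousOn
  have hc1 : ContinuousOn (D.pd 1 u) D.K := D.continuousOn_pd hu 1
  have hc2 := D.continuousOn_grad hu
  have hi1 : Integrable (fun x => (C + 1) * (‖u x‖ ^ 2 + ‖D.grad u x‖ ^ 2)) D.μ := by
    apply D.integrable
    fun_prop
  have hi2 : ∀ α β : ℝ, Integrable (fun x => (β / D.h (x 0) * ‖u x‖ ^ 2
        + (α + β * (x 1 / D.h (x 0))) * (2 * inner ℝ (u x) (D.pd 1 u x)))) D.μ := fun α β => by
    apply D.integrable
    have h3 : Continuous fun x : Plane => β / D.h (x 0) := by fun_prop (disch := assumption)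
    have h4 : Continuous fun x : Plane => (α + β * (x 1 / D.h (x 0))) := by
      fun_prop (disch := assumption)
    exact (h3.continuousOn.mul (hc0.norm.pow 2)).add
      (h4.continuousOn.mul (continuousOn_const.mul (hc0.inner hc1)))
  have key : ∀ x ∈ D.Ω, ∀ α β : ℝ, |β| ≤ 1 → |α + β * (x 1 / D.h (x 0))| ≤ 1 →
      β / D.h (x 0) * ‖u x‖ ^ 2
        + (α + β * (x 1 / D.h (x 0))) * (2 * inner ℝ (u x) (D.pd 1 u x))
      ≤ (C + 1) * (‖u x‖ ^ 2 + ‖D.grad u x‖ ^ 2) := by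
    intro x hx α β hβ hα
    have h1 := hC x (D.Ω_subset_K₀ hx)
    rw [Real.norm_eq_abs, abs_of_pos (one_div_pos.2 (D.h_pos _))] at h1
    have h2 : β / D.h (x 0) ≤ C := by
      rw [div_eq_mul_one_div]
      have := one_div_pos.2 (D.h_pos (x 0))
      calc β * (1 / D.h (x 0)) ≤ 1 * (1 / D.h (x 0)) :=
            mul_le_mul_of_nonneg_right ((le_abs_self _).trans hβ) this.le
        _ ≤ C := by rw [one_mul]; exact h1
    have h3 : (α + β * (x 1 / D.h (x 0))) * (2 * inner ℝ (u x) (D.pd 1 u x))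
        ≤ ‖u x‖ ^ 2 + ‖D.grad u x‖ ^ 2 := by
      have h4 := norm_inner_le_norm (𝕜 := ℝ) (u x) (D.pd 1 u x)
      have h5 := D.norm_pd_le u x 1
      calc _ ≤ |(α + β * (x 1 / D.h (x 0))) * (2 * inner ℝ (u x) (D.pd 1 u x))| := le_abs_self _
        _ ≤ 1 * |2 * inner ℝ (u x) (D.pd 1 u x)| := by
            rw [abs_mul]; exact mul_le_mul_of_nonneg_right hα (abs_nonneg _)
        _ ≤ 2 * (‖u x‖ * ‖D.pd 1 u x‖) := by
            rw [abs_mul, one_mul, abs_two]; exact mul_le_mul_of_nonneg_left h4 zero_le_two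
        _ ≤ _ := by nlinarith [sq_nonneg (‖u x‖ - ‖D.pd 1 u x‖)]
    nlinarith [mul_le_mul_of_nonneg_right h2 (sq_nonneg ‖u x‖), sq_nonneg ‖D.grad u x‖,
      mul_nonneg hC0 (sq_nonneg ‖D.grad u x‖)]
  have hfrac : ∀ x ∈ D.Ω, 0 ≤ x 1 / D.h (x 0) ∧ x 1 / D.h (x 0) ≤ 1 := fun x hx =>
    ⟨div_nonneg hx.2.1.le (D.h_pos _).le, div_le_one_of_le₀ hx.2.2.le (D.h_pos _).le⟩
  rw [← integral_const_mul]
  constructor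
  -- The weight x₂/h - 1 vanishes on the top and is -1 on the bottom.
  · have h1 := D.integral_weight hu (-1) 1
    have : ∫ s in 0..D.L, ‖u (pt s 0)‖ ^ 2 = ∫ x in (D.Ω : Set Plane), (1 / D.h (x 0) * ‖u x‖ ^ 2
        + (-1 + 1 * (x 1 / D.h (x 0))) * (2 * inner ℝ (u x) (D.pd 1 u x))) := by
      rw [h1]; simp
    rw [this]
    refine setIntegral_mono_on (hi2 _ _) hi1 D.measurableSet_Ω fun x hx => key x hx _ _ (by simp) ?_
    have := hfrac x hx
    rw [abs_le]; constructor <;> linarith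
  -- The weight x₂/h vanishes on the bottom and is 1 on the top.
  · have h1 := D.integral_weight hu 0 1
    have : ∫ s in 0..D.L, ‖u (pt s (D.h s))‖ ^ 2
        = ∫ x in (D.Ω : Set Plane), (1 / D.h (x 0) * ‖u x‖ ^ 2
        + (0 + 1 * (x 1 / D.h (x 0))) * (2 * inner ℝ (u x) (D.pd 1 u x))) := by
      rw [h1]; simp
    rw [this]
    refine setIntegral_mono_on (hi2 _ _) hi1 D.measurableSet_Ω fun x hx => key x hx _ _ (by simp) ?_
    have := hfrac x hx
    rw [abs_le]; constructor <;> linarith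

/-- A constant of the trace inequality. -/
def Ctr : ℝ := D.exists_trace_bound.choose

lemma Ctr_nonneg : 0 ≤ D.Ctr := D.exists_trace_bound.choose_spec.1

lemma integral_norm_sq_of_eq {w : D.H1} {u : Plane → Plane} {A : Plane → Mat}
    (h1 : w.fst =ᵐ[D.μ] u) (h2 : w.snd =ᵐ[D.μ] A) :
    ∫ x in (D.Ω : Set Plane), (‖u x‖ ^ 2 + ‖A x‖ ^ 2) = ‖w‖ ^ 2 := by
  rw [D.H1_norm_sq, L2_norm_sq_eq h1, L2_norm_sq_eq h2, integral_add]
  · exact ((memLp_congr_ae h1).1 (Lp.memLp w.fst)).integrable_norm_pow (by simp)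
  · exact ((memLp_congr_ae h2).1 (Lp.memLp w.snd)).integrable_norm_pow (by simp)

lemma trace_bottom_le {w : D.H1} {u : Plane → Plane} (hu : ContDiffOn ℝ 1 u D.K)
    (h1 : w.fst =ᵐ[D.μ] u) (h2 : w.snd =ᵐ[D.μ] D.grad u) :
    ∫ s in 0..D.L, ‖u (pt s 0)‖ ^ 2 ≤ D.Ctr * ‖w‖ ^ 2 := by
  rw [← D.integral_norm_sq_of_eq h1 h2]
  exact (D.exists_trace_bound.choose_spec.2 u hu).1

lemma trace_top_le {w : D.H1} {u : Plane → Plane} (hu : ContDiffOn ℝ 1 u D.K)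
    (h1 : w.fst =ᵐ[D.μ] u) (h2 : w.snd =ᵐ[D.μ] D.grad u) :
    ∫ s in 0..D.L, ‖u (pt s (D.h s))‖ ^ 2 ≤ D.Ctr * ‖w‖ ^ 2 := by
  rw [← D.integral_norm_sq_of_eq h1 h2]
  exact (D.exists_trace_bound.choose_spec.2 u hu).2

/-- Lebesgue measure on `(0, L)`. -/
abbrev μΓ : Measure ℝ := volume.restrict (Ioo 0 D.L)

lemma continuousOn_bottom {E : Type*} [TopologicalSpace E] {u : Plane → E}
    (hu : ContinuousOn u D.K) : Continuous fun s => u (pt s 0) :=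
  hu.comp_continuous (by fun_prop) fun s => D.pt_bot_mem_K s

lemma continuousOn_top {E : Type*} [TopologicalSpace E] {u : Plane → E}
    (hu : ContinuousOn u D.K) : Continuous fun s => u (pt s (D.h s)) :=
  hu.comp_continuous (by fun_prop) fun s => D.pt_top_mem_K s

lemma memLp_Γ {E : Type*} [NormedAddCommGroup E] [SecondCountableTopology E]
    {f : ℝ → E} (hf : Continuous f) (p : ENNReal) :
    MemLp f p D.μΓ := by
  obtain ⟨C, hC⟩ := isCompact_Icc.exists_bound_of_continuousOn (s := Icc 0 D.L) hf.continuousOn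
  refine MemLp.of_bound hf.aestronglyMeasurable C ?_
  filter_upwards [ae_restrict_mem measurableSet_Ioo] with x hx using hC x (Ioo_subset_Icc_self hx)

lemma integral_Γ (f : ℝ → ℝ) : ∫ s in 0..D.L, f s = ∫ s in Ioo 0 D.L, f s := by
  rw [intervalIntegral.integral_of_le D.L_pos.le, integral_Ioc_eq_integral_Ioo]

/-- The restriction of a field to the bottom, in `L²(Γ₀)`. -/
def bot (u : Plane → Plane) : D.L2Γ₀ :=
  open Classical in if h : MemLp (fun s => u (pt s 0)) 2 D.μΓ then h.toLp _ else 0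

lemma coeFn_bot {u : Plane → Plane} (hu : ContinuousOn u D.K) :
    D.bot u =ᵐ[D.μΓ] fun s => u (pt s 0) := by
  rw [bot, dif_pos (D.memLp_Γ (D.continuousOn_bottom hu) 2)]
  exact MemLp.coeFn_toLp _

/-- The graph of the restriction map as a submodule. -/
def restrSub : Submodule ℝ (D.H1 × D.L2Γ₀) where
  carrier := D.restrGraph
  zero_mem' := by
    obtain ⟨φ, hφ, h1, h2⟩ := D.VtildeH1.zero_mem
    refine ⟨0, D.Vtilde.zero_mem, Lp.coeFn_zero _ _ _, ?_, Lp.coeFn_zero _ _ _⟩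
    refine (Lp.coeFn_zero _ _ _).trans (Eventually.of_forall fun x => ?_)
    ext ij
    simp [grad, pd, show (0 : Plane → Plane) = fun _ => 0 from rfl]
  add_mem' := by
    rintro ⟨u, g⟩ ⟨w, g'⟩ ⟨φ, hφ, hu, hu', hg⟩ ⟨ψ, hψ, hw, hw', hg'⟩
    refine ⟨φ + ψ, D.Vtilde.add_mem hφ hψ, (Lp.coeFn_add _ _).trans (hu.add hw),
      (Lp.coeFn_add _ _).trans ((hu'.add hw').trans ?_), (Lp.coeFn_add _ _).trans (hg.add hg')⟩
    filter_upwards [ae_restrict_mem D.Ω.isOpen.measurableSet] with x hx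
    ext ij
    simp [grad, D.pd_add _ hx hφ.1 hψ.1]
  smul_mem' := by
    rintro c ⟨u, g⟩ ⟨φ, hφ, hu, hu', hg⟩
    refine ⟨c • φ, D.Vtilde.smul_mem c hφ, (Lp.coeFn_smul _ _).trans (hu.const_smul c),
      (Lp.coeFn_smul _ _).trans ((hu'.const_smul c).trans ?_),
      (Lp.coeFn_smul _ _).trans (hg.const_smul c)⟩
    filter_upwards [ae_restrict_mem D.Ω.isOpen.measurableSet] with x hx
    ext ij
    simp [grad, D.pd_smul _ c hx hφ.1]

lemma norm_le_of_mem_restrGraph {z : D.H1 × D.L2Γ₀} (hz : z ∈ D.restrGraph) :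
    ‖z.2‖ ≤ √D.Ctr * ‖z.1‖ := by
  obtain ⟨φ, hφ, h1, h2, h3⟩ := hz
  have := D.trace_bottom_le (D.Vtilde_contDiffOn hφ) h1 h2
  rw [D.integral_Γ] at this
  simp only [pt_eq] at this
  rw [← L2_norm_sq_eq h3] at this
  refine abs_le_of_sq_le_sq' ?_ (by positivity) |>.2
  rw [mul_pow, Real.sq_sqrt D.Ctr_nonneg]
  exact this

lemma norm_le_of_mem_closure {z : D.H1 × D.L2Γ₀} (hz : z ∈ closure D.restrGraph) :
    ‖z.2‖ ≤ √D.Ctr * ‖z.1‖ := by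
  have hcl : IsClosed {z : D.H1 × D.L2Γ₀ | ‖z.2‖ ≤ √D.Ctr * ‖z.1‖} :=
    isClosed_le (by fun_prop) (by fun_prop)
  exact hcl.closure_subset_iff.2 (fun z hz => D.norm_le_of_mem_restrGraph hz) hz

/-- The trace bound persists in the closure, so a pair (0, g) there has g = 0: the restriction map
is closable, and `trace` does not depend on a choice. -/
lemma closure_restrGraph_unique {w : D.H1} {g g' : D.L2Γ₀} (h : (w, g) ∈ closure D.restrGraph)
    (h' : (w, g') ∈ closure D.restrGraph) : g = g' := by
  have h1 : (w, g) - (w, g') ∈ closure D.restrGraph :=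
    D.restrSub.topologicalClosure.sub_mem h h'
  have h2 := D.norm_le_of_mem_closure h1
  simp at h2
  exact sub_eq_zero.1 h2

lemma bot_mem_restrGraph {φ : Plane → Plane} (hφ : φ ∈ D.Vtilde) :
    (D.toH1 φ (D.grad φ), D.bot φ) ∈ D.restrGraph := by
  refine ⟨φ, hφ, D.coeFn_toL2 hφ.1.continuousOn,
    D.coeFn_toL2 (D.continuousOn_grad (D.Vtilde_contDiffOn hφ)), ?_⟩
  simp only [← pt_eq]
  exact D.coeFn_bot hφ.1.continuousOn

/-- By the trace bound, the bottom values of an H¹-convergent sequence in Ṽ are Cauchy in L²(Γ₀).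
This makes the `epsilon` in `trace` pick a genuine limit. -/
lemma exists_mem_closure_restrGraph {w : D.H1} (hw : w ∈ D.V) :
    ∃ g, (w, g) ∈ closure D.restrGraph := by
  obtain ⟨u, hu, hlim⟩ := mem_closure_iff_seq_limit.1 (show w ∈ closure (D.VtildeH1 : Set D.H1) from hw)
  have hg : ∀ n, ∃ g, (u n, g) ∈ D.restrGraph := fun n => by
    obtain ⟨φ, hφ, h1, h2⟩ := hu n
    refine ⟨D.bot φ, ?_⟩
    rw [D.eq_toH1 hφ.1.continuousOn (D.continuousOn_grad (D.Vtilde_contDiffOn hφ)) h1 h2]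
    exact D.bot_mem_restrGraph hφ
  choose g hg using hg
  have hc : CauchySeq g := by
    have hlip : ∀ m n, dist (g m) (g n) ≤ √D.Ctr * dist (u m) (u n) := fun m n => by
      have := D.norm_le_of_mem_restrGraph (D.restrSub.sub_mem (hg m) (hg n))
      simpa [dist_eq_norm] using this
    rw [Metric.cauchySeq_iff']
    intro ε hε
    have hpos : 0 < ε / (√D.Ctr + 1) := by positivity
    obtain ⟨N, hN⟩ := Metric.cauchySeq_iff'.1 hlim.cauchySeq _ hpos
    refine ⟨N, fun n hn => (hlip n N).trans_lt ?_⟩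
    have := hN n hn
    rw [lt_div_iff₀ (by positivity)] at this
    nlinarith [Real.sqrt_nonneg D.Ctr, dist_nonneg (x := u n) (y := u N)]
  obtain ⟨g₀, hg₀⟩ := cauchySeq_tendsto_of_complete hc
  exact ⟨g₀, mem_closure_of_tendsto (hlim.prodMk_nhds hg₀) (Eventually.of_forall hg)⟩

lemma trace_mem (w : D.V) : ((w : D.H1), D.trace w) ∈ closure D.restrGraph :=
  Classical.epsilon_spec (D.exists_mem_closure_restrGraph w.2)

lemma trace_eq_of_mem {w : D.V} {g : D.L2Γ₀} (h : ((w : D.H1), g) ∈ closure D.restrGraph) :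
    D.trace w = g := D.closure_restrGraph_unique (D.trace_mem w) h

/-- The trace as a continuous linear map. -/
def tr : D.V →L[ℝ] D.L2Γ₀ :=
  LinearMap.mkContinuous
    { toFun := D.trace
      map_add' := fun w z => D.trace_eq_of_mem
        (D.restrSub.topologicalClosure.add_mem (D.trace_mem w) (D.trace_mem z))
      map_smul' := fun c w => D.trace_eq_of_mem
        (D.restrSub.topologicalClosure.smul_mem c (D.trace_mem w)) }
    (√D.Ctr) fun w => by
      have h := D.norm_le_of_mem_closure (D.trace_mem w)
      dsimp only at h
      exact h

@[simp] lemma tr_apply (w : D.V) : D.tr w = D.trace w := rfl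

lemma trace_ofVtilde {φ : Plane → Plane} (hφ : φ ∈ D.Vtilde) :
    D.trace (D.ofVtilde hφ) = D.bot φ :=
  D.trace_eq_of_mem (subset_closure (D.bot_mem_restrGraph hφ))

/-- A field in `V` that is `C¹` up to the boundary can be approximated in `H¹` by smooth fields. -/
lemma exists_approx {w : D.H1} (hw : w ∈ D.V) {ε : ℝ} (hε : 0 < ε) :
    ∃ φ ∈ D.Vtilde, ‖w - D.toH1 φ (D.grad φ)‖ ^ 2 ≤ ε := by
  obtain ⟨z, ⟨φ, hφ, h1, h2⟩, hz⟩ := Metric.mem_closure_iff.1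
    (show w ∈ closure (D.VtildeH1 : Set D.H1) from hw) (√ε) (Real.sqrt_pos.2 hε)
  refine ⟨φ, hφ, ?_⟩
  rw [D.eq_toH1 hφ.1.continuousOn (D.continuousOn_grad (D.Vtilde_contDiffOn hφ)) h1 h2,
    dist_eq_norm] at hz
  calc _ ≤ √ε ^ 2 := by gcongr
    _ = ε := Real.sq_sqrt hε.le

lemma sub_ae {w : D.H1} {u φ : Plane → Plane} (hu : ContDiffOn ℝ 1 u D.K)
    (hφ : ContDiffOn ℝ 1 φ D.K) (h1 : w.fst =ᵐ[D.μ] u) (h2 : w.snd =ᵐ[D.μ] D.grad u) :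
    (w - D.toH1 φ (D.grad φ)).fst =ᵐ[D.μ] u - φ ∧
    (w - D.toH1 φ (D.grad φ)).snd =ᵐ[D.μ] D.grad (u - φ) := by
  constructor
  · exact (Lp.coeFn_sub _ _).trans (h1.sub (D.coeFn_toL2 hφ.continuousOn))
  · refine (Lp.coeFn_sub _ _).trans ((h2.sub (D.coeFn_toL2 (D.continuousOn_grad hφ))).trans ?_)
    filter_upwards [ae_restrict_mem D.measurableSet_Ω] with x hx
    rw [D.grad_sub hu hφ (D.Ω_subset_Ki hx)]
    rfl

lemma eq_zero_of_integral_le {f : ℝ → ℝ} (hf : Continuous f) (h0 : ∀ s, 0 ≤ f s)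
    (h : ∫ s in 0..D.L, f s ≤ 0) : ∀ s ∈ Icc 0 D.L, f s = 0 := by
  by_contra! hne
  obtain ⟨s, hs, hs'⟩ := hne
  have := intervalIntegral.integral_pos D.L_pos hf.continuousOn (fun x _ => h0 x)
    ⟨s, hs, lt_of_le_of_ne (h0 s) hs'.symm⟩
  linarith

section boundary_values

variable {w : D.V} {u : Plane → Plane} (hu : ContDiffOn ℝ 1 u D.K)
  (h1 : (w : D.H1).fst =ᵐ[D.μ] u) (h2 : (w : D.H1).snd =ᵐ[D.μ] D.grad u)

include hu h1 h2

/-- The trace bound holds for every C¹ field, in particular for u - φ with φ ∈ Ṽ close to w in H¹.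
So the trace defined by closure agrees with the pointwise restriction. -/
lemma trace_eq : D.trace w = D.bot u := by
  refine D.trace_eq_of_mem ?_
  rw [Metric.mem_closure_iff]
  intro ε hε
  obtain ⟨φ, hφ, hle⟩ := D.exists_approx w.2 (ε := (ε / (2 * (√D.Ctr + 1))) ^ 2) (by positivity)
  refine ⟨_, D.bot_mem_restrGraph hφ, ?_⟩
  have hφ' := D.Vtilde_contDiffOn hφ
  have hs := D.sub_ae hu hφ' h1 h2
  have hb := D.trace_bottom_le (hu.sub hφ') hs.1 hs.2
  have hn : ‖(w : D.H1) - D.toH1 φ (D.grad φ)‖ ≤ ε / (2 * (√D.Ctr + 1)) :=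
    abs_le_of_sq_le_sq' hle (by positivity) |>.2
  have hn2 : ‖D.bot u - D.bot φ‖ ≤ √D.Ctr * ‖(w : D.H1) - D.toH1 φ (D.grad φ)‖ := by
    refine abs_le_of_sq_le_sq' ?_ (by positivity) |>.2
    rw [mul_pow, Real.sq_sqrt D.Ctr_nonneg]
    refine le_trans (le_of_eq ?_) hb
    rw [D.integral_Γ]
    exact L2_norm_sq_eq ((Lp.coeFn_sub _ _).trans
      ((D.coeFn_bot hu.continuousOn).sub (D.coeFn_bot hφ'.continuousOn)))
  rw [Prod.dist_eq, dist_eq_norm, dist_eq_norm]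
  have h0 := Real.sqrt_nonneg D.Ctr
  have hq : ε / (2 * (√D.Ctr + 1)) * (√D.Ctr + 1) = ε / 2 := by field_simp
  have hpos : 0 < ε / (2 * (√D.Ctr + 1)) := by positivity
  refine max_lt ?_ ?_ <;> dsimp only <;> nlinarith

/-- A field φ ∈ Ṽ vanishes on Γ₁, so the boundary integral of |u|² equals that of |u - φ|², which
the trace bound makes arbitrarily small. Continuity of u gives the pointwise claim. -/
lemma top_eq_zero : ∀ s ∈ Icc 0 D.L, u (pt s (D.h s)) = 0 := by
  have hle : ∫ s in 0..D.L, ‖u (pt s (D.h s))‖ ^ 2 ≤ 0 := by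
    refine le_of_forall_pos_le_add fun ε hε => ?_
    obtain ⟨φ, hφ, hle⟩ := D.exists_approx w.2 (ε := ε / (D.Ctr + 1))
      (div_pos hε (by linarith [D.Ctr_nonneg]))
    have hφ' := D.Vtilde_contDiffOn hφ
    have hs := D.sub_ae hu hφ' h1 h2
    have hb := D.trace_top_le (hu.sub hφ') hs.1 hs.2
    have heq : ∫ s in 0..D.L, ‖u (pt s (D.h s))‖ ^ 2
        = ∫ s in 0..D.L, ‖(u - φ) (pt s (D.h s))‖ ^ 2 := by
      rw [D.integral_Γ, D.integral_Γ]
      refine setIntegral_congr_fun measurableSet_Ioo fun s hs => ?_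
      have : φ (pt s (D.h s)) = 0 := hφ.2.2.2.1 _ ⟨by simpa using hs, by simp⟩
      simp [this]
    rw [heq, zero_add]
    refine hb.trans ?_
    have := D.Ctr_nonneg
    calc D.Ctr * ‖(w : D.H1) - D.toH1 φ (D.grad φ)‖ ^ 2 ≤ D.Ctr * (ε / (D.Ctr + 1)) := by gcongr
      _ ≤ (D.Ctr + 1) * (ε / (D.Ctr + 1)) := by gcongr; linarith
      _ = ε := by field_simp
  intro s hs
  have := D.eq_zero_of_integral_le ((D.continuousOn_top hu.continuousOn).norm.pow 2)
    (fun s => sq_nonneg _) hle s hs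
  simpa using this

/-- As on the top, except that only the second component of φ vanishes on Γ₀, so u₂² is merely
dominated by |u - φ|². -/
lemma bottom_eq_zero : ∀ s ∈ Icc 0 D.L, u (pt s 0) 1 = 0 := by
  have hle : ∫ s in 0..D.L, (u (pt s 0) 1) ^ 2 ≤ 0 := by
    refine le_of_forall_pos_le_add fun ε hε => ?_
    obtain ⟨φ, hφ, hle⟩ := D.exists_approx w.2 (ε := ε / (D.Ctr + 1))
      (div_pos hε (by linarith [D.Ctr_nonneg]))
    have hφ' := D.Vtilde_contDiffOn hφ
    have hs := D.sub_ae hu hφ' h1 h2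
    have hb := D.trace_bottom_le (hu.sub hφ') hs.1 hs.2
    have heq : ∫ s in 0..D.L, (u (pt s 0) 1) ^ 2
        ≤ ∫ s in 0..D.L, ‖(u - φ) (pt s 0)‖ ^ 2 := by
      have hc1 := D.continuousOn_bottom hu.continuousOn
      have hc2 := D.continuousOn_bottom hφ'.continuousOn
      rw [D.integral_Γ, D.integral_Γ]
      refine setIntegral_mono_on ?_ ?_ measurableSet_Ioo fun s hs => ?_
      · exact memLp_one_iff_integrable.1
          (D.memLp_Γ (((continuous_coord 1).comp hc1).pow 2) 1)
      · exact memLp_one_iff_integrable.1 (D.memLp_Γ ((hc1.sub hc2).norm.pow 2) 1)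
      have h3 := hφ.2.2.2.2 (pt s 0) ⟨by simpa using hs, by simp⟩
      rw [inner_n, neg_eq_zero] at h3
      rw [EuclideanSpace.norm_sq_eq, Fin.sum_univ_two]
      simp [h3]
      positivity
    rw [zero_add]
    refine heq.trans (hb.trans ?_)
    have := D.Ctr_nonneg
    calc D.Ctr * ‖(w : D.H1) - D.toH1 φ (D.grad φ)‖ ^ 2 ≤ D.Ctr * (ε / (D.Ctr + 1)) := by gcongr
      _ ≤ (D.Ctr + 1) * (ε / (D.Ctr + 1)) := by gcongr; linarith
      _ = ε := by field_simp
  intro s hs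
  have := D.eq_zero_of_integral_le
    (((continuous_coord 1).comp (D.continuousOn_bottom hu.continuousOn)).pow 2)
    (fun s => sq_nonneg _) hle s hs
  simpa using this

/-- For φ ∈ Ṽ one has div u = div (u - φ), whose L² norm is controlled by the H¹ distance. Hence the
continuous function div u has zero L² norm. -/
lemma div_eq_zero : ∀ x ∈ D.Ω, D.div u x = 0 := by
  have hg := D.continuousOn_grad hu
  have hdc : ContinuousOn (D.div u) D.K := by
    have := fun j => D.continuousOn_pd hu j
    unfold div
    fun_prop
  have hle : ∫ x in (D.Ω : Set Plane), D.div u x ^ 2 ≤ 0 := by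
    refine le_of_forall_pos_le_add fun ε hε => ?_
    obtain ⟨φ, hφ, hle⟩ := D.exists_approx w.2 (ε := ε / 2) (by positivity)
    have hφ' := D.Vtilde_contDiffOn hφ
    have hs := D.sub_ae hu hφ' h1 h2
    have hb : ∫ x in (D.Ω : Set Plane), D.div u x ^ 2
        ≤ ∫ x in (D.Ω : Set Plane), 2 * ‖D.grad (u - φ) x‖ ^ 2 := by
      refine setIntegral_mono_on ?_ ?_ D.measurableSet_Ω fun x hx => ?_
      · apply D.integrable; fun_prop
      · apply D.integrable
        have := D.continuousOn_grad (hu.sub hφ')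
        fun_prop
      · have h3 : D.div (u - φ) x = D.div u x := by
          have h4 := hφ.2.2.1 x hx
          simp only [div] at h4 ⊢
          simp only [D.pd_sub _ hu hφ' (D.Ω_subset_Ki hx), PiLp.sub_apply, Finset.sum_sub_distrib, h4,
            sub_zero]
        rw [← h3]
        exact D.div_sq_le _ _
    have hn : ∫ x in (D.Ω : Set Plane), 2 * ‖D.grad (u - φ) x‖ ^ 2 ≤ 2 * (ε / 2) := by
      rw [integral_const_mul, ← L2_norm_sq_eq hs.2]
      gcongr
      refine le_trans ?_ hle
      gcongr
      exact D.norm_snd_le _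
    linarith
  have h0 : ∫ x in (D.Ω : Set Plane), D.div u x ^ 2 = 0 :=
    le_antisymm hle (integral_nonneg fun x => sq_nonneg _)
  rw [setIntegral_eq_zero_iff_of_nonneg_ae (Eventually.of_forall fun x => sq_nonneg _)
    (D.integrable (f := fun x => D.div u x ^ 2) (by fun_prop))] at h0
  have h3 : EqOn (fun x => D.div u x ^ 2) (fun _ => 0) (D.Ω : Set Plane) :=
    Measure.eqOn_open_of_ae_eq h0 D.Ω.isOpen ((hdc.mono D.Ω_subset_K).pow 2) continuousOn_const
  intro x hx
  simpa using h3 hx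

end boundary_values

/-! ### Weak gradients -/

/-- Integration by parts against a test function with compact support in `Ω`. -/
lemma integral_testFunction_mul {q ψ : Plane → ℝ} (hq : ContDiffOn ℝ 1 q D.K) (hψ : ContDiff ℝ ∞ ψ)
    (hs : tsupport ψ ⊆ D.Ω) (j : Fin 2) :
    ∫ x in (D.Ω : Set Plane), (fderiv ℝ ψ x (e j) * q x + ψ x * D.pd j q x) = 0 := by
  have h0 : ∀ x ∉ D.Ω, ψ x = 0 := fun x hx => image_eq_zero_of_notMem_tsupport fun h => hx (hs h)
  have hψd : ∀ x, HasFDerivAt ψ (fderiv ℝ ψ x) x := fun x =>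
    (hψ.differentiable (by simp) x).hasFDerivAt
  have hc := D.continuousOn_pd hq j
  have hcq := hq.continuousOn
  have hcψ := hψ.continuous
  have hcψ' : Continuous fun x => fderiv ℝ ψ x (e j) :=
    (hψ.continuous_fderiv (by simp)).clm_apply continuous_const
  rw [D.integral_div (F := fun x => (ψ x * q x) • e j)]
  · have hb : ∀ s, ψ (pt s 0) = 0 := fun s => h0 _ fun h => by
      have := h.2.1
      simp at this
    have ht : ∀ s, ψ (pt s (D.h s)) = 0 := fun s => h0 _ fun h => by
      have := h.2.2
      simp at this
    simp [hb, ht]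
  · fun_prop
  · intro x hx
    exact ((hψd x).differentiableAt.mul (D.differentiableAt' hq (D.Ω_subset_Ki hx))).smul_const _
  · fun_prop
  · intro x hx
    have h1 := (((hψd x).mul (D.differentiableAt' hq (D.Ω_subset_Ki hx)).hasFDerivAt).smul_const
      (e j)).fderiv
    change fderiv ℝ (fun x => (ψ x * q x) • e j) x = _ at h1
    rw [div, Fin.sum_univ_two, D.pd_eq _ _ (D.Ω_subset_Ki hx), D.pd_eq _ _ (D.Ω_subset_Ki hx),
      D.pd_eq _ _ (D.Ω_subset_Ki hx), h1]
    fin_cases j <;> simp [e] <;> ring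
  · intro y _
    have h1 : ψ (pt D.L (y * D.h D.L)) = 0 := h0 _ fun h => by
      have := h.1.2
      simp at this
    have h2 : ψ (pt 0 (y * D.h 0)) = 0 := h0 _ fun h => by
      have := h.1.1
      simp at this
    simp [h1, h2]

end Data

namespace Data

variable (D : Data)

/-- On `V`, the second component is the weak gradient of the first one. -/
lemma V_integral_testFunction {w : D.H1} (hw : w ∈ D.V) {ψ : Plane → ℝ} (hψ : ContDiff ℝ ∞ ψ)
    (hs : tsupport ψ ⊆ D.Ω) (i j : Fin 2) :
    ∫ x in (D.Ω : Set Plane), (fderiv ℝ ψ x (e j) * w.fst x i + ψ x * w.snd x (i, j)) = 0 := by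
  have hcψ := hψ.continuous
  have hcψ' : Continuous fun x => fderiv ℝ ψ x (e j) :=
    (hψ.continuous_fderiv (by simp)).clm_apply continuous_const
  have hm1 : ContinuousOn (fun x => fderiv ℝ ψ x (e j) • e i) D.K := by fun_prop
  have hm2 : ContinuousOn (fun x => ψ x • (EuclideanSpace.single (i, j) 1 : Mat)) D.K := by fun_prop
  -- For a fixed test function the claim is orthogonality of `w` to one element `T` of L² × L². This
  -- is a closed condition, so it suffices to check it on Ṽ.
  set T : D.H1 := WithLp.toLp 2 (D.toL2 (fun x => fderiv ℝ ψ x (e j) • e i),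
    D.toL2 (fun x => ψ x • (EuclideanSpace.single (i, j) 1 : Mat))) with hT
  have hTw : ∀ z : D.H1, inner ℝ T z
      = ∫ x in (D.Ω : Set Plane), (fderiv ℝ ψ x (e j) * z.fst x i + ψ x * z.snd x (i, j)) := by
    intro z
    have e1 := L2_inner_eq (D.coeFn_toL2 hm1) (ae_eq_refl (z.fst : Plane → Plane))
    have e2 := L2_inner_eq (D.coeFn_toL2 hm2) (ae_eq_refl (z.snd : Plane → Mat))
    have i1 : Integrable (fun x => inner ℝ (fderiv ℝ ψ x (e j) • e i) (z.fst x)) D.μ := by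
      refine (L2.integrable_inner (𝕜 := ℝ) (D.toL2 (fun x => fderiv ℝ ψ x (e j) • e i)) z.fst).congr ?_
      filter_upwards [D.coeFn_toL2 hm1] with x hx
      rw [hx]
    have i2 : Integrable (fun x => inner ℝ (ψ x • (EuclideanSpace.single (i, j) 1 : Mat)) (z.snd x))
        D.μ := by
      refine (L2.integrable_inner (𝕜 := ℝ) (D.toL2
        (fun x => ψ x • (EuclideanSpace.single (i, j) 1 : Mat))) z.snd).congr ?_
      filter_upwards [D.coeFn_toL2 hm2] with x hx
      rw [hx]
    rw [D.H1_inner]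
    change inner ℝ (D.toL2 _) z.fst + inner ℝ (D.toL2 _) z.snd = _
    rw [e1, e2, ← integral_add i1 i2]
    congr 1
    funext x
    simp [inner_smul_left, EuclideanSpace.inner_single_left, e]
  rw [← hTw w]
  refine D.V_induction (p := fun w => inner ℝ T w = 0) ?_ (fun φ hφ => ?_) w hw
  · exact isClosed_eq (by fun_prop) continuous_const
  · have hφ' := D.Vtilde_contDiffOn hφ
    rw [hTw, ← D.integral_testFunction_mul (q := fun x => φ x i) (j := j)
      ((coord i).contDiff.comp_contDiffOn hφ') hψ hs]
    refine integral_congr_ae ?_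
    filter_upwards [ae_restrict_mem D.measurableSet_Ω, D.coeFn_toL2 hφ'.continuousOn,
      D.coeFn_toL2 (D.continuousOn_grad hφ')] with x hx h1 h2
    rw [toH1_fst, toH1_snd, h1, h2, D.grad_apply, D.pd_apply _ _ (D.Ω_subset_Ki hx)
      (D.differentiableAt' hφ' (D.Ω_subset_Ki hx))]

/-- Weak gradients are unique, by the fundamental lemma of the calculus of variations. The weak
problem ties only the first component of the V-valued map to v; this recovers the second. -/
lemma snd_eq_grad {w : D.H1} (hw : w ∈ D.V) {u : Plane → Plane} (hu : ContDiffOn ℝ 1 u D.K)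
    (h1 : w.fst =ᵐ[D.μ] u) : w.snd =ᵐ[D.μ] D.grad u := by
  have hcomp : ∀ i j, ∀ᵐ x ∂D.μ, w.snd x (i, j) - D.grad u x (i, j) = 0 := by
    intro i j
    have hsnd : Integrable (fun x => w.snd x (i, j)) D.μ := by
      have := (Lp.memLp w.snd).integrable (by norm_num : (1 : ENNReal) ≤ 2)
      exact (EuclideanSpace.proj (𝕜 := ℝ) (i, j) : Mat →L[ℝ] ℝ).integrable_comp this
    have hgr : Integrable (fun x => D.grad u x (i, j)) D.μ := by
      have := D.integrable (D.continuousOn_grad hu)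
      exact (EuclideanSpace.proj (𝕜 := ℝ) (i, j) : Mat →L[ℝ] ℝ).integrable_comp this
    have hint : IntegrableOn (fun x => w.snd x (i, j) - D.grad u x (i, j)) (D.Ω : Set Plane) :=
      hsnd.sub hgr
    have := D.Ω.isOpen.ae_eq_zero_of_integral_contDiff_smul_eq_zero
      (μ := volume) hint.locallyIntegrableOn ?_
    · exact (ae_restrict_iff' D.measurableSet_Ω).2 this
    intro ψ hψ hc hs
    have hψ0 : ∀ x ∉ (D.Ω : Set Plane), ψ x • (w.snd x (i, j) - D.grad u x (i, j)) = 0 := fun x hx => by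
      rw [image_eq_zero_of_notMem_tsupport fun h => hx (hs h), zero_smul]
    rw [← setIntegral_eq_integral_of_forall_compl_eq_zero hψ0]
    have e1 := D.V_integral_testFunction hw hψ hs i j
    have e2 := D.integral_testFunction_mul (q := fun x => u x i) (j := j)
      ((coord i).contDiff.comp_contDiffOn hu) hψ hs
    obtain ⟨C, hC⟩ := hψ.continuous.bounded_above_of_compact_support hc
    have hcψ' : Continuous fun x => fderiv ℝ ψ x (e j) :=
      (hψ.continuous_fderiv (by simp)).clm_apply continuous_const
    have hcu := hu.continuousOn
    have i1 : Integrable (fun x => fderiv ℝ ψ x (e j) * u x i) D.μ := by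
      apply D.integrable; fun_prop
    have i2 : Integrable (fun x => ψ x * w.snd x (i, j)) D.μ :=
      hsnd.bdd_mul (hψ.continuous.aestronglyMeasurable) (Eventually.of_forall hC)
    have i3 : Integrable (fun x => ψ x * D.grad u x (i, j)) D.μ :=
      hgr.bdd_mul (hψ.continuous.aestronglyMeasurable) (Eventually.of_forall hC)
    have e1' : ∫ x in (D.Ω : Set Plane), (fderiv ℝ ψ x (e j) * u x i + ψ x * w.snd x (i, j)) = 0 := by
      rw [← e1]
      refine integral_congr_ae ?_
      filter_upwards [h1] with x hx
      rw [hx]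
    have e2' : ∫ x in (D.Ω : Set Plane), (fderiv ℝ ψ x (e j) * u x i + ψ x * D.grad u x (i, j)) = 0 := by
      rw [← e2]
      refine setIntegral_congr_fun D.measurableSet_Ω fun x hx => ?_
      simp only [D.grad_apply]
      rw [D.pd_apply _ _ (D.Ω_subset_Ki hx) (D.differentiableAt' hu (D.Ω_subset_Ki hx))]
    rw [integral_add i1 i2] at e1'
    rw [integral_add i1 i3] at e2'
    simp only [smul_eq_mul, mul_sub]
    rw [integral_sub i2 i3]
    linarith
  filter_upwards [hcomp 0 0, hcomp 0 1, hcomp 1 0, hcomp 1 1] with x h00 h01 h10 h11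
  ext ⟨i, j⟩
  fin_cases i <;> fin_cases j <;> simp only [Fin.mk_zero, Fin.mk_one] <;> linarith

/-! ### Solenoidal test fields -/

/-- The field `(∂₂F, -∂₁F)`. -/
def curl (F : Plane → ℝ) (x : Plane) : Plane := pt (fderiv ℝ F x (e 1)) (-fderiv ℝ F x (e 0))

lemma contDiff_curl {F : Plane → ℝ} (hF : ContDiff ℝ ∞ F) : ContDiff ℝ ∞ (curl F) := by
  have h : ∀ j, ContDiff ℝ ∞ fun x => fderiv ℝ F x (e j) := fun j =>
    (hF.fderiv_right (m := ∞) (by simp)).clm_apply contDiff_const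
  have h0 := h 0
  have h1 := h 1
  unfold curl
  fun_prop

/-- The divergence vanishes by symmetry of second derivatives. On the top the whole gradient of `F`
must vanish (no slip), on the bottom only its tangential derivative (no penetration). -/
lemma curl_mem_Vtilde {F : Plane → ℝ} (hF : ContDiff ℝ ∞ F)
    (hp : ∀ x, F (x + D.L • e 0) = F x) (h1 : ∀ s, fderiv ℝ F (pt s (D.h s)) = 0)
    (h0 : ∀ s, fderiv ℝ F (pt s 0) (e 0) = 0) : curl F ∈ D.Vtilde := by
  refine ⟨(contDiff_curl hF).contDiffOn, fun x _ => ?_, fun x hx => ?_, fun x hx => ?_, fun x hx => ?_⟩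
  · have h : fderiv ℝ F (x + D.L • e 0) = fderiv ℝ F x := by
      rw [← fderiv_comp_add_right (D.L • e 0)]
      congr 1
      exact funext hp
    simp only [curl, h]
  · have hx' := D.Ω_subset_Ki hx
    have hd : DifferentiableAt ℝ (curl F) x := (contDiff_curl hF).differentiable (by simp) x
    have hd2 : DifferentiableAt ℝ (fderiv ℝ F) x :=
      (hF.fderiv_right (m := ∞) (by simp)).differentiable (by simp) x
    have hsymm : IsSymmSndFDerivAt ℝ F x := hF.contDiffAt.isSymmSndFDerivAt 
      (by simpa using (WithTop.coe_le_coe.2 (le_top : (2 : ℕ∞) ≤ ⊤) : ((2 : ℕ∞) : WithTop ℕ∞) ≤ ∞))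
    rw [div, Fin.sum_univ_two, D.pd_apply _ _ hx' hd, D.pd_apply _ _ hx' hd, D.pd_eq _ _ hx',
      D.pd_eq _ _ hx']
    simp only [curl, pt_apply_zero, pt_apply_one]
    have e1 := ((ContinuousLinearMap.apply ℝ ℝ (e 1)).hasFDerivAt.comp x hd2.hasFDerivAt).fderiv
    have e0 := (((ContinuousLinearMap.apply ℝ ℝ (e 0)).hasFDerivAt.comp x hd2.hasFDerivAt).neg).fderiv
    change fderiv ℝ (fun x => fderiv ℝ F x (e 1)) x = _ at e1
    change fderiv ℝ (fun x => -fderiv ℝ F x (e 0)) x = _ at e0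
    rw [e1, e0]
    have := hsymm.eq (e 0) (e 1)
    simp [this]
  · have : x = pt (x 0) (D.h (x 0)) := plane_ext (by simp) (by simpa using hx.2)
    rw [curl, this, h1]
    simp [pt]
  · have : x = pt (x 0) 0 := plane_ext (by simp) (by simpa using hx.2)
    rw [inner_n, curl, this, h0]
    simp

/-- The stream function `α(x₁) β(x₂ / h(x₁))`. -/
def tens (α β : ℝ → ℝ) (x : Plane) : ℝ := α (D.Φ x 0) * β (D.Φ x 1)

lemma contDiff_tens {α β : ℝ → ℝ} (hα : ContDiff ℝ ∞ α) (hβ : ContDiff ℝ ∞ β) :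
    ContDiff ℝ ∞ (D.tens α β) := by
  have h := D.contDiff_Φ
  have h0 : ContDiff ℝ ∞ fun x => D.Φ x 0 := (coord 0).contDiff.comp h
  have h1 : ContDiff ℝ ∞ fun x => D.Φ x 1 := (coord 1).contDiff.comp h
  exact (hα.comp h0).mul (hβ.comp h1)

lemma fderiv_tens {α β : ℝ → ℝ} (hα : ContDiff ℝ ∞ α) (hβ : ContDiff ℝ ∞ β) (x v : Plane) :
    fderiv ℝ (D.tens α β) x v = deriv α (x 0) * β (D.Φ x 1) * v 0
      + α (x 0) * deriv β (D.Φ x 1) * fderiv ℝ D.Φ x v 1 := by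
  have h0 := (coord 0).hasFDerivAt.comp x (D.hasFDerivAt_Φ x)
  have h1 := (coord 1).hasFDerivAt.comp x (D.hasFDerivAt_Φ x)
  have ha := ((hα.differentiable (by simp)) (D.Φ x 0)).hasDerivAt.comp_hasFDerivAt x h0
  have hb := ((hβ.differentiable (by simp)) (D.Φ x 1)).hasDerivAt.comp_hasFDerivAt x h1
  have := (ha.mul hb).fderiv
  change fderiv ℝ (D.tens α β) x = _ at this
  rw [this]
  have h3 : D.Φ x 0 = x 0 := by simp [Φ]
  have h4 : fderiv ℝ D.Φ x v 0 = v 0 := by simp [D.fderiv_Φ]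
  simp [h3, h4]
  ring

/-- The end conditions involve the products α'β(0) and α'β(1) so that α = 1 is allowed with β(0) ≠
β(1). Such fields carry a nonzero flux through the channel. -/
lemma curl_tens_mem_Vtilde {α β : ℝ → ℝ} (hα : ContDiff ℝ ∞ α) (hβ : ContDiff ℝ ∞ β)
    (hp : ∀ s, α (s + D.L) = α s) (h0 : ∀ s, deriv α s * β 0 = 0) (h1 : ∀ s, deriv α s * β 1 = 0)
    (h1' : deriv β 1 = 0) : curl (D.tens α β) ∈ D.Vtilde := by
  have hne := D.h_ne
  refine D.curl_mem_Vtilde (D.contDiff_tens hα hβ) (fun x => ?_) (fun s => ?_) (fun s => ?_)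
  · simp [tens, D.Φ_periodic, hp]
  · ext v
    rw [D.fderiv_tens hα hβ]
    simp [Φ, hne, h1, h1']
  · rw [D.fderiv_tens hα hβ, D.fderiv_Φ]
    simp [Φ, h0]

lemma curl_tens_apply_zero {α β : ℝ → ℝ} (hα : ContDiff ℝ ∞ α) (hβ : ContDiff ℝ ∞ β) (a y : ℝ) :
    curl (D.tens α β) (pt a (y * D.h a)) 0 = α a * deriv β y / D.h a := by
  have hne := D.h_ne
  simp [curl, D.fderiv_tens hα hβ, D.fderiv_Φ, Φ, hne, e]
  ring

lemma curl_tens_apply_one {α β : ℝ → ℝ} (hα : ContDiff ℝ ∞ α) (hβ : ContDiff ℝ ∞ β) (a y : ℝ) :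
    curl (D.tens α β) (pt a (y * D.h a)) 1
      = -(deriv α a * β y) + α a * deriv β y * y * deriv D.h a / D.h a := by
  have hne := D.h_ne a
  simp [curl, D.fderiv_tens hα hβ, D.fderiv_Φ, Φ, hne, e]
  field_simp
  ring

end Data

lemma norm_pt_le (a b : ℝ) : ‖pt a b‖ ≤ |a| + |b| := by
  unfold pt
  refine (norm_add_le _ _).trans ?_
  simp [norm_smul, e]

namespace Data

variable (D : Data)

/-- Bounded pointwise convergence implies convergence in `L²(Ω)`. -/
lemma exists_tendsto_L2 {E : Type*} [NormedAddCommGroup E] [InnerProductSpace ℝ E]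
    {P : ℕ → Lp E 2 D.μ} {u : ℕ → Plane → E} {v : Plane → E} (hP : ∀ n, P n =ᵐ[D.μ] u n) {C : ℝ}
    (hC : ∀ n, ∀ x ∈ D.Ω, ‖u n x‖ ≤ C) (hlim : ∀ x ∈ D.Ω, Tendsto (fun n => u n x) atTop (𝓝 (v x))) :
    ∃ Q : Lp E 2 D.μ, Q =ᵐ[D.μ] v ∧ Tendsto P atTop (𝓝 Q) := by
  have hΩ := ae_restrict_mem (μ := volume) D.measurableSet_Ω
  have hm : ∀ n, AEStronglyMeasurable (u n) D.μ := fun n =>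
    (Lp.aestronglyMeasurable (P n)).congr (hP n)
  have hv : AEStronglyMeasurable v D.μ := by
    refine aestronglyMeasurable_of_tendsto_ae atTop hm ?_
    filter_upwards [hΩ] with x hx using hlim x hx
  have hvC : ∀ x ∈ D.Ω, ‖v x‖ ≤ C := fun x hx =>
    le_of_tendsto (hlim x hx).norm (Eventually.of_forall fun n => hC n x hx)
  have hvL : MemLp v 2 D.μ := by
    refine MemLp.of_bound hv C ?_
    filter_upwards [hΩ] with x hx using hvC x hx
  refine ⟨hvL.toLp v, hvL.coeFn_toLp, ?_⟩
  rw [tendsto_iff_norm_sub_tendsto_zero]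
  have hsq : Tendsto (fun n => ‖P n - hvL.toLp v‖ ^ 2) atTop (𝓝 0) := by
    have heq : ∀ n, ‖P n - hvL.toLp v‖ ^ 2 = ∫ x, ‖u n x - v x‖ ^ 2 ∂D.μ := fun n =>
      L2_norm_sq_eq ((Lp.coeFn_sub _ _).trans ((hP n).sub hvL.coeFn_toLp))
    simp only [heq]
    have h0 : (0 : ℝ) = ∫ x, (0 : ℝ) ∂D.μ := by simp
    rw [h0]
    refine tendsto_integral_of_dominated_convergence (fun _ => (C + C) ^ 2)
      (fun n => (((hm n).sub hv).norm.pow 2)) (integrable_const _) (fun n => ?_) ?_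
    · filter_upwards [hΩ] with x hx
      have : ‖u n x - v x‖ ≤ C + C := (norm_sub_le _ _).trans (add_le_add (hC n x hx) (hvC x hx))
      simp only [norm_pow, norm_norm]
      gcongr
    · filter_upwards [hΩ] with x hx
      have := (tendsto_iff_norm_sub_tendsto_zero.1 (hlim x hx)).pow 2
      simpa using this
  have := hsq.sqrt
  simpa using this

/-! ### Fields given by derivatives of a stream function in straightened coordinates -/

/-- The second derivative of the stream function `f ∘ Φ`, where `f₁, f₂` are the first two derivatives
of `f`. -/
def hess (f₁ : Plane → Plane →L[ℝ] ℝ) (f₂ : Plane → Plane →L[ℝ] Plane →L[ℝ] ℝ) (x v k : Plane) : ℝ :=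
  f₂ (D.Φ x) (fderiv ℝ D.Φ x v) (fderiv ℝ D.Φ x k) + f₁ (D.Φ x) (fderiv ℝ (fderiv ℝ D.Φ) x v k)

/-- The field with stream function `f ∘ Φ`. -/
def field (f₁ : Plane → Plane →L[ℝ] ℝ) (x : Plane) : Plane :=
  pt (f₁ (D.Φ x) (fderiv ℝ D.Φ x (e 1))) (-f₁ (D.Φ x) (fderiv ℝ D.Φ x (e 0)))

/-- The gradient of the field with stream function `f ∘ Φ`. -/
def fieldGrad (f₁ : Plane → Plane →L[ℝ] ℝ) (f₂ : Plane → Plane →L[ℝ] Plane →L[ℝ] ℝ) (x : Plane) :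
    Mat :=
  WithLp.toLp 2 fun ij => pt (D.hess f₁ f₂ x (e ij.2) (e 1)) (-D.hess f₁ f₂ x (e ij.2) (e 0)) ij.1

/-- The open cell `(0, L) × (0, 1)`. -/
def cell : Set Plane := {z | z 0 ∈ Ioo 0 D.L ∧ z 1 ∈ Ioo (0 : ℝ) 1}

lemma Φ_mem_cell {x : Plane} (hx : x ∈ D.Ω) : D.Φ x ∈ D.cell :=
  ⟨by simpa [Φ] using hx.1, D.Φ_mem_Si (D.Ω_subset_Ki hx)⟩

lemma cell_subset_Si : D.cell ⊆ Si := fun _ hz => hz.2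

/-- The field with stream function `f ∘ Φ` belongs to `V`. -/
def StreamMem (f₁ : Plane → Plane →L[ℝ] ℝ) (f₂ : Plane → Plane →L[ℝ] Plane →L[ℝ] ℝ) : Prop :=
  ∃ w ∈ D.V, w.fst =ᵐ[D.μ] D.field f₁ ∧ w.snd =ᵐ[D.μ] D.fieldGrad f₁ f₂

section

variable {f₁ g₁ : Plane → Plane →L[ℝ] ℝ} {f₂ g₂ : Plane → Plane →L[ℝ] Plane →L[ℝ] ℝ}

variable {D} in
lemma StreamMem.congr (hf : D.StreamMem f₁ f₂) (h1 : ∀ z ∈ D.cell, f₁ z = g₁ z)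
    (h2 : ∀ z ∈ D.cell, f₂ z = g₂ z) : D.StreamMem g₁ g₂ := by
  obtain ⟨w, hw, e1, e2⟩ := hf
  refine ⟨w, hw, e1.trans ?_, e2.trans ?_⟩
  · filter_upwards [ae_restrict_mem D.measurableSet_Ω] with x hx
    simp only [field, h1 _ (D.Φ_mem_cell hx)]
  · filter_upwards [ae_restrict_mem D.measurableSet_Ω] with x hx
    simp only [fieldGrad, hess, h1 _ (D.Φ_mem_cell hx), h2 _ (D.Φ_mem_cell hx)]

variable {D} in
lemma StreamMem.add (hf : D.StreamMem f₁ f₂) (hg : D.StreamMem g₁ g₂) :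
    D.StreamMem (fun z => f₁ z + g₁ z) (fun z => f₂ z + g₂ z) := by
  obtain ⟨w, hw, e1, e2⟩ := hf
  obtain ⟨w', hw', e1', e2'⟩ := hg
  refine ⟨w + w', D.V.add_mem hw hw', (Lp.coeFn_add _ _).trans ((e1.add e1').trans ?_),
    (Lp.coeFn_add _ _).trans ((e2.add e2').trans ?_)⟩
  · refine Eventually.of_forall fun x => ?_
    simp [field, pt]
    module
  · refine Eventually.of_forall fun x => ?_
    ext ⟨i, j⟩
    fin_cases i <;> simp [fieldGrad, hess] <;> ring

variable {D} in
lemma StreamMem.smul (c : ℝ) (hf : D.StreamMem f₁ f₂) :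
    D.StreamMem (fun z => c • f₁ z) (fun z => c • f₂ z) := by
  obtain ⟨w, hw, e1, e2⟩ := hf
  refine ⟨c • w, D.V.smul_mem c hw, (Lp.coeFn_smul _ _).trans ((e1.const_smul c).trans ?_),
    (Lp.coeFn_smul _ _).trans ((e2.const_smul c).trans ?_)⟩
  · refine Eventually.of_forall fun x => ?_
    simp [field, pt]
    module
  · refine Eventually.of_forall fun x => ?_
    ext ⟨i, j⟩
    fin_cases i <;> simp [fieldGrad, hess] <;> ring

lemma streamMem_zero : D.StreamMem (fun _ => 0) (fun _ => 0) := by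
  refine ⟨0, D.V.zero_mem, (Lp.coeFn_zero _ _ _).trans ?_, (Lp.coeFn_zero _ _ _).trans ?_⟩
  · refine Eventually.of_forall fun x => ?_
    simp [field, pt]
  · refine Eventually.of_forall fun x => ?_
    ext ⟨i, j⟩
    simp [fieldGrad, hess, pt]

variable {D} in
lemma StreamMem.sum {ι : Type*} (s : Finset ι) {f₁ : ι → Plane → Plane →L[ℝ] ℝ}
    {f₂ : ι → Plane → Plane →L[ℝ] Plane →L[ℝ] ℝ} (h : ∀ i ∈ s, D.StreamMem (f₁ i) (f₂ i)) :
    D.StreamMem (fun z => ∑ i ∈ s, f₁ i z) (fun z => ∑ i ∈ s, f₂ i z) := by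
  classical
  induction s using Finset.induction_on with
  | empty => simpa using D.streamMem_zero
  | insert a s ha ih =>
    simp only [Finset.sum_insert ha]
    exact (h a (by simp)).add (ih fun i hi => h i (by simp [hi]))

end

/-- `StreamMem` is stable under bounded pointwise convergence of the derivatives. -/
lemma streamMem_of_tendsto {f₁ : ℕ → Plane → Plane →L[ℝ] ℝ}
    {f₂ : ℕ → Plane → Plane →L[ℝ] Plane →L[ℝ] ℝ} {g₁ : Plane → Plane →L[ℝ] ℝ}
    {g₂ : Plane → Plane →L[ℝ] Plane →L[ℝ] ℝ} (hf : ∀ n, D.StreamMem (f₁ n) (f₂ n)) {C : ℝ}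
    (h1 : ∀ n, ∀ z ∈ D.cell, ‖f₁ n z‖ ≤ C) (h2 : ∀ n, ∀ z ∈ D.cell, ‖f₂ n z‖ ≤ C)
    (l1 : ∀ z ∈ D.cell, Tendsto (fun n => f₁ n z) atTop (𝓝 (g₁ z)))
    (l2 : ∀ z ∈ D.cell, Tendsto (fun n => f₂ n z) atTop (𝓝 (g₂ z))) : D.StreamMem g₁ g₂ := by
  choose w hw e1 e2 using hf
  have hΦ1 : Continuous (fderiv ℝ D.Φ) := D.contDiff_Φ.continuous_fderiv (by simp)
  have hΦ2 : Continuous (fderiv ℝ (fderiv ℝ D.Φ)) :=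
    (D.contDiff_Φ.fderiv_right (m := ∞) (by simp)).continuous_fderiv (by simp)
  obtain ⟨M, hM0, hM⟩ := D.exists_bound hΦ1.continuousOn
  obtain ⟨N, hN0, hN⟩ := D.exists_bound (E := Plane →L[ℝ] Plane →L[ℝ] Plane) hΦ2.continuousOn
  have he : ∀ i, ‖e i‖ = 1 := fun i => by simp [e]
  have b1 : ∀ x ∈ D.Ω, ∀ i, ‖fderiv ℝ D.Φ x (e i)‖ ≤ M := fun x hx i => by
    have := (fderiv ℝ D.Φ x).le_opNorm (e i)
    rw [he, mul_one] at this
    exact this.trans (hM x (D.Ω_subset_K₀ hx))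
  have b2 : ∀ x ∈ D.Ω, ∀ i j, ‖fderiv ℝ (fderiv ℝ D.Φ) x (e i) (e j)‖ ≤ N := fun x hx i j => by
    have := (fderiv ℝ (fderiv ℝ D.Φ) x).le_opNorm₂ (e i) (e j)
    rw [he, he, mul_one, mul_one] at this
    exact this.trans (hN x (D.Ω_subset_K₀ hx))
  have b3 : ∀ n, ∀ x ∈ D.Ω, ∀ i, |f₁ n (D.Φ x) (fderiv ℝ D.Φ x (e i))| ≤ C * M := fun n x hx i => by
    have h3 := h1 n _ (D.Φ_mem_cell hx)
    have h4 := (f₁ n (D.Φ x)).le_opNorm (fderiv ℝ D.Φ x (e i))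
    exact h4.trans (mul_le_mul h3 (b1 x hx i) (norm_nonneg _) ((norm_nonneg _).trans h3))
  have b4 : ∀ n, ∀ x ∈ D.Ω, ∀ i j, |D.hess (f₁ n) (f₂ n) x (e i) (e j)| ≤ C * M * M + C * N := by
    intro n x hx i j
    have h3 := h1 n _ (D.Φ_mem_cell hx)
    have h4 := h2 n _ (D.Φ_mem_cell hx)
    have hC0 := (norm_nonneg _).trans h3
    refine (abs_add_le _ _).trans (add_le_add ?_ ?_)
    · refine ((f₂ n (D.Φ x)).le_opNorm₂ _ _).trans ?_
      gcongr
      · exact b1 x hx i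
      · exact b1 x hx j
    · refine ((f₁ n (D.Φ x)).le_opNorm _).trans ?_
      gcongr
      exact b2 x hx i j
  have t1 : ∀ x ∈ D.Ω, ∀ v, Tendsto (fun n => f₁ n (D.Φ x) v) atTop (𝓝 (g₁ (D.Φ x) v)) :=
    fun x hx v => ((ContinuousLinearMap.apply ℝ ℝ v).continuous.tendsto _).comp
      (l1 _ (D.Φ_mem_cell hx))
  have t2 : ∀ x ∈ D.Ω, ∀ v k, Tendsto (fun n => D.hess (f₁ n) (f₂ n) x v k) atTop
      (𝓝 (D.hess g₁ g₂ x v k)) := fun x hx v k =>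
    (((ContinuousLinearMap.apply ℝ ℝ (fderiv ℝ D.Φ x k)).continuous.tendsto _).comp
      (((ContinuousLinearMap.apply ℝ (Plane →L[ℝ] ℝ) (fderiv ℝ D.Φ x v)).continuous.tendsto _).comp
        (l2 _ (D.Φ_mem_cell hx)))).add (t1 x hx _)
  have hpt : ∀ {a b : ℕ → ℝ} {a' b' : ℝ}, Tendsto a atTop (𝓝 a') → Tendsto b atTop (𝓝 b') →
      Tendsto (fun n => pt (a n) (b n)) atTop (𝓝 (pt a' b')) := fun ha hb =>
    (ha.smul_const _).add (hb.smul_const _)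
  obtain ⟨Q1, hQ1, hl1⟩ := D.exists_tendsto_L2 (v := D.field g₁) e1 (C := C * M + C * M)
    (fun n x hx => (norm_pt_le _ _).trans (add_le_add (b3 n x hx 1) (by
      rw [abs_neg]; exact b3 n x hx 0)))
    (fun x hx => hpt (t1 x hx _) (t1 x hx _).neg)
  obtain ⟨Q2, hQ2, hl2⟩ := D.exists_tendsto_L2 (v := D.fieldGrad g₁ g₂) e2
    (C := √(4 * (C * M * M + C * N) ^ 2))
    (fun n x hx => by
      rw [EuclideanSpace.norm_eq]
      refine Real.sqrt_le_sqrt ?_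
      have h3 : ∀ ij : Fin 2 × Fin 2, ‖D.fieldGrad (f₁ n) (f₂ n) x ij‖ ^ 2
          ≤ (C * M * M + C * N) ^ 2 := by
        rintro ⟨i, j⟩
        rw [Real.norm_eq_abs, sq_abs, sq_le_sq]
        refine le_trans ?_ (le_abs_self _)
        fin_cases i
        · simpa [fieldGrad] using b4 n x hx j 1
        · simpa [fieldGrad] using b4 n x hx j 0
      refine (Finset.sum_le_sum fun ij _ => h3 ij).trans (le_of_eq ?_)
      simp [Fintype.card_prod])
    (fun x hx => by
      refine (PiLp.continuous_toLp 2 _).continuousAt.tendsto.comp (tendsto_pi_nhds.2 fun ij => ?_)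
      exact ((continuous_coord ij.1).continuousAt.tendsto).comp
        (hpt (t2 x hx _ _) (t2 x hx _ _).neg))
  -- Fields and gradients converge separately in L²; closedness of `V` in the product keeps the
  -- limit pair in `V`.
  refine ⟨WithLp.toLp 2 (Q1, Q2), ?_, hQ1, hQ2⟩
  have hl : Tendsto w atTop (𝓝 (WithLp.toLp 2 (Q1, Q2))) :=
    ((WithLp.prod_continuous_toLp 2 _ _).continuousAt.tendsto).comp (hl1.prodMk_nhds hl2)
  exact D.isClosed_V.mem_of_tendsto hl (Eventually.of_forall hw)

/-- Chain and product rule. Only `f₁` and its derivative enter, so no stream function has to be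
given. -/
lemma hasFDerivAt_field {f₁ : Plane → Plane →L[ℝ] ℝ} {f₂ : Plane → Plane →L[ℝ] Plane →L[ℝ] ℝ}
    {x : Plane} (h : HasFDerivAt f₁ (f₂ (D.Φ x)) (D.Φ x)) (hx : x ∈ D.Ω) :
    D.grad (D.field f₁) x = D.fieldGrad f₁ f₂ x := by
  have hd : HasFDerivAt (fderiv ℝ D.Φ) (fderiv ℝ (fderiv ℝ D.Φ) x) x :=
    ((D.contDiff_Φ.fderiv_right (m := ∞) (by simp)).differentiable (by simp) x).hasFDerivAt
  have h1 := h.comp x (D.hasFDerivAt_Φ x)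
  have h2 : ∀ k, HasFDerivAt (fun x => f₁ (D.Φ x) (fderiv ℝ D.Φ x k)) _ x := fun k =>
    h1.clm_apply (hd.clm_apply (hasFDerivAt_const k x))
  have h3 := (((h2 (e 1)).smul_const (e 0)).add ((h2 (e 0)).neg.smul_const (e 1))).fderiv
  change fderiv ℝ (D.field f₁) x = _ at h3
  have hx' := D.Ω_subset_Ki hx
  have h4 : ∀ j, D.pd j (D.field f₁) x
      = pt (D.hess f₁ f₂ x (e j) (e 1)) (-D.hess f₁ f₂ x (e j) (e 0)) := fun j => by
    rw [D.pd_eq _ _ hx', h3]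
    simp [hess, pt]
    module
  ext ij
  simp only [grad, fieldGrad, h4]

/-- The gradient of a product `a(z₁) b(z₂)`. -/
def prodD (a a' b b' : ℝ → ℝ) (z : Plane) : Plane →L[ℝ] ℝ :=
  (a' (z 0) * b (z 1)) • coord 0 + (a (z 0) * b' (z 1)) • coord 1

/-- The second derivative of a product `a(z₁) b(z₂)`. -/
def prodD2 (a a' a'' b b' b'' : ℝ → ℝ) (z : Plane) : Plane →L[ℝ] Plane →L[ℝ] ℝ :=
  (a'' (z 0) * b (z 1)) • (coord 0).smulRight (coord 0)
    + (a' (z 0) * b' (z 1)) • ((coord 1).smulRight (coord 0) + (coord 0).smulRight (coord 1))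
    + (a (z 0) * b'' (z 1)) • (coord 1).smulRight (coord 1)

lemma hasFDerivAt_prod {a a' b b' : ℝ → ℝ} {z : Plane} (ha : HasDerivAt a (a' (z 0)) (z 0))
    (hb : HasDerivAt b (b' (z 1)) (z 1)) :
    HasFDerivAt (fun z : Plane => a (z 0) * b (z 1)) (prodD a a' b b' z) z := by
  have h0 : HasFDerivAt (fun y : Plane => y 0) (coord 0) z := (coord 0).hasFDerivAt
  have h1 : HasFDerivAt (fun y : Plane => y 1) (coord 1) z := (coord 1).hasFDerivAt
  refine ((ha.comp_hasFDerivAt z h0).mul (hb.comp_hasFDerivAt z h1)).congr_fderiv ?_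
  ext v
  simp [prodD]
  ring

set_option synthInstance.maxHeartbeats 200000 in
lemma hasFDerivAt_prodD {a a' a'' b b' b'' : ℝ → ℝ} {z : Plane}
    (ha : HasDerivAt a (a' (z 0)) (z 0)) (ha' : HasDerivAt a' (a'' (z 0)) (z 0))
    (hb : HasDerivAt b (b' (z 1)) (z 1)) (hb' : HasDerivAt b' (b'' (z 1)) (z 1)) :
    HasFDerivAt (prodD a a' b b') (prodD2 a a' a'' b b' b'' z) z := by
  refine (((hasFDerivAt_prod (a' := a'') (b' := b') ha' hb).smul_const (coord 0)).add
    ((hasFDerivAt_prod (a' := a') (b' := b'') ha hb').smul_const (coord 1))).congr_fderiv ?_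
  ext v k
  simp [prodD, prodD2]
  ring

/-- The base case of the approximation: with smooth factors the field lies in Ṽ itself. -/
lemma streamMem_tens {α β : ℝ → ℝ} (hα : ContDiff ℝ ∞ α) (hβ : ContDiff ℝ ∞ β)
    (hp : ∀ s, α (s + D.L) = α s) (h0 : ∀ s, deriv α s * β 0 = 0) (h1 : ∀ s, deriv α s * β 1 = 0)
    (h1' : deriv β 1 = 0) :
    D.StreamMem (prodD α (deriv α) β (deriv β))
      (prodD2 α (deriv α) (deriv (deriv α)) β (deriv β) (deriv (deriv β))) := by
  have hd : ∀ {a : ℝ → ℝ}, ContDiff ℝ ∞ a → ∀ s, HasDerivAt a (deriv a s) s := fun ha s =>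
    (ha.differentiable (by simp) s).hasDerivAt
  have hd' : ∀ {a : ℝ → ℝ}, ContDiff ℝ ∞ a → ContDiff ℝ ∞ (deriv a) := fun ha =>
    (contDiff_infty_iff_deriv.1 ha).2
  have hmem := D.curl_tens_mem_Vtilde hα hβ hp h0 h1 h1'
  have hfield : ∀ x, curl (D.tens α β) x = D.field (prodD α (deriv α) β (deriv β)) x := by
    intro x
    have hh : HasFDerivAt (D.tens α β) _ x := (hasFDerivAt_prod (a := α) (b := β)
      (hd hα (D.Φ x 0)) (hd hβ (D.Φ x 1))).comp x (D.hasFDerivAt_Φ x)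
    simp [curl, field, hh.fderiv]
  refine ⟨_, D.VtildeH1_le_V (D.toH1_mem_VtildeH1 hmem), ?_, ?_⟩
  · exact (D.coeFn_toL2 hmem.1.continuousOn).trans (Eventually.of_forall hfield)
  · refine (D.coeFn_toL2 (D.continuousOn_grad (D.Vtilde_contDiffOn hmem))).trans ?_
    filter_upwards [ae_restrict_mem D.measurableSet_Ω] with x hx
    rw [funext hfield]
    exact D.hasFDerivAt_field (hasFDerivAt_prodD (hd hα _) (hd (hd' hα) _) (hd hβ _)
      (hd (hd' hβ) _)) hx

end Data

/-! ### One-dimensional approximation and parameter integrals -/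

/-- One-dimensional approximation in `C²[0, 1]` by smooth functions, preserving boundary
conditions. -/
lemma exists_smooth_approx {q q₁ q₂ : ℝ → ℝ} (hq : ContinuousOn q (Icc 0 1))
    (hq1 : ContinuousOn q₁ (Icc 0 1)) (hq2 : ContinuousOn q₂ (Icc 0 1))
    (hd : ∀ y ∈ Ioo (0 : ℝ) 1, HasDerivAt q (q₁ y) y)
    (hd1 : ∀ y ∈ Ioo (0 : ℝ) 1, HasDerivAt q₁ (q₂ y) y) (h0 : q 0 = 0) (h1 : q 1 = 0)
    (h11 : q₁ 1 = 0) {ε : ℝ} (hε : 0 < ε) :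
    ∃ p : ℝ → ℝ, ContDiff ℝ ∞ p ∧ p 0 = 0 ∧ p 1 = 0 ∧ deriv p 1 = 0 ∧
      ∀ y ∈ Icc (0 : ℝ) 1, |p y - q y| ≤ ε ∧ |deriv p y - q₁ y| ≤ ε ∧
        |deriv (deriv p) y - q₂ y| ≤ ε := by
  -- The second derivative is approximated by a polynomial, which is integrated twice from 1. The
  -- conditions at 1 then hold automatically, and the error passes to the lower derivatives because
  -- the interval has length 1.
  obtain ⟨P, hP⟩ := exists_polynomial_near_of_continuousOn 0 1 q₂ hq2 (ε / 3) (by positivity)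
  set r₂ : ℝ → ℝ := fun y => P.eval y with hr2
  have hr2s : ContDiff ℝ ∞ r₂ := by simpa using P.contDiff_aeval (𝕜 := ℝ) ∞
  set r₁ : ℝ → ℝ := fun y => ∫ s in (1 : ℝ)..y, r₂ s with hr1
  have hr1d : ∀ y, HasDerivAt r₁ (r₂ y) y := fun y =>
    intervalIntegral.integral_hasDerivAt_right (hr2s.continuous.intervalIntegrable _ _)
      (hr2s.continuous.stronglyMeasurableAtFilter _ _) hr2s.continuous.continuousAt
  have hr1s : ContDiff ℝ ∞ r₁ := contDiff_infty_iff_deriv.2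
    ⟨fun y => (hr1d y).differentiableAt, by rwa [funext fun y => (hr1d y).deriv]⟩
  set r : ℝ → ℝ := fun y => ∫ s in (1 : ℝ)..y, r₁ s with hr
  have hrd : ∀ y, HasDerivAt r (r₁ y) y := fun y =>
    intervalIntegral.integral_hasDerivAt_right (hr1s.continuous.intervalIntegrable _ _)
      (hr1s.continuous.stronglyMeasurableAtFilter _ _) hr1s.continuous.continuousAt
  have hrs : ContDiff ℝ ∞ r := contDiff_infty_iff_deriv.2
    ⟨fun y => (hrd y).differentiableAt, by rwa [funext fun y => (hrd y).deriv]⟩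
  have bound : ∀ {f f' : ℝ → ℝ} {δ : ℝ}, ContinuousOn f (Icc 0 1) →
      (∀ y ∈ Ioo (0 : ℝ) 1, HasDerivAt f (f' y) y) → (∀ y ∈ Icc (0 : ℝ) 1, |f' y| ≤ δ) → f 1 = 0 →
      ∀ y ∈ Icc (0 : ℝ) 1, |f y| ≤ δ := by
    intro f f' δ hf hf' hb hf1 y hy
    have hδ : 0 ≤ δ := (abs_nonneg _).trans (hb 1 (by simp))
    rcases eq_or_lt_of_le hy.2 with rfl | hy1
    · simpa [hf1] using hδ
    obtain ⟨ξ, hξ, hξ2⟩ := exists_hasDerivAt_eq_slope f f' hy1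
      (hf.mono (Icc_subset_Icc_left hy.1)) fun x hx => hf' x ⟨hy.1.trans_lt hx.1, hx.2⟩
    have h3 := hb ξ ⟨hy.1.trans hξ.1.le, hξ.2.le⟩
    rw [hξ2, hf1, abs_div, zero_sub, abs_neg, div_le_iff₀ (abs_pos.2 (by linarith)),
      abs_of_pos (show 0 < 1 - y by linarith)] at h3
    nlinarith [hy.1]
  have d1 : ∀ y ∈ Icc (0 : ℝ) 1, |r₁ y - q₁ y| ≤ ε / 3 :=
    bound (f' := fun y => r₂ y - q₂ y) (hr1s.continuous.continuousOn.sub hq1)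
      (fun y hy => (hr1d y).sub (hd1 y hy)) (fun y hy => (hP y hy).le) (by simp [hr1, h11])
  have d0 : ∀ y ∈ Icc (0 : ℝ) 1, |r y - q y| ≤ ε / 3 :=
    bound (f' := fun y => r₁ y - q₁ y) (hrs.continuous.continuousOn.sub hq)
      (fun y hy => (hrd y).sub (hd y hy)) d1 (by simp [hr, h1])
  have hc : |r 0| ≤ ε / 3 := by simpa [h0] using d0 0 (by simp)
  -- Subtracting r(0)(y - 1)² restores p(0) = 0 and leaves the conditions at 1 intact. Since |r(0)|
  -- ≤ ε/3, its second derivative costs 2ε/3; this is why the polynomial is taken within ε/3.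
  have hpd : ∀ y, HasDerivAt (fun y => r y - r 0 * (y - 1) ^ 2) (r₁ y - r 0 * (2 * (y - 1))) y := by
    intro y
    have := (hrd y).sub ((((hasDerivAt_id y).sub_const 1).pow 2).const_mul (r 0))
    refine this.congr_deriv ?_
    simp
  have hpd2 : ∀ y, HasDerivAt (fun y => r₁ y - r 0 * (2 * (y - 1))) (r₂ y - r 0 * 2) y := by
    intro y
    have := (hr1d y).sub ((((hasDerivAt_id y).sub_const 1).const_mul 2).const_mul (r 0))
    refine this.congr_deriv ?_
    simp
  have e1 : deriv (fun y => r y - r 0 * (y - 1) ^ 2) = fun y => r₁ y - r 0 * (2 * (y - 1)) :=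
    funext fun y => (hpd y).deriv
  refine ⟨fun y => r y - r 0 * (y - 1) ^ 2, by fun_prop, by simp, by simp [hr], ?_, fun y hy => ?_⟩
  · rw [e1]; simp [hr1]
  · rw [e1]
    simp only [(hpd2 y).deriv]
    have h3 := d0 y hy
    have h4 := d1 y hy
    have h5 := (hP y hy).le
    rw [abs_le] at h3 h4 h5 hc
    have hy0 := hy.1
    have hy1 := hy.2
    have hs0 : 0 ≤ (y - 1) ^ 2 := sq_nonneg _
    have hs1 : (y - 1) ^ 2 ≤ 1 := by nlinarith
    refine ⟨abs_le.2 ⟨?_, ?_⟩, abs_le.2 ⟨?_, ?_⟩, abs_le.2 ⟨?_, ?_⟩⟩ <;> try nlinarith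

/-- Differentiation under the integral sign along translates. -/
lemma hasFDerivAt_integral_translate {E F : Type*} [NormedAddCommGroup E] [NormedSpace ℝ E]
    [NormedAddCommGroup F] [NormedSpace ℝ F] [CompleteSpace F] {G : Plane → F}
    {G' : Plane → Plane →L[ℝ] F} (hd : ∀ z ∈ Data.Si, HasFDerivAt G (G' z) z)
    (hc : ContinuousOn G' Data.Si) {C : ℝ} (hC : ∀ z ∈ Data.Si, ‖G' z‖ ≤ C) {κ : ℝ → ℝ}
    (hκ : Continuous κ) (A : E →L[ℝ] Plane) {w : Plane} (hw : w 1 = 0) (a b : ℝ) {x : E}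
    (hx : A x ∈ Data.Si) :
    HasFDerivAt (fun x => ∫ s in a..b, κ s • G (A x + s • w))
      (∫ s in a..b, κ s • (G' (A x + s • w)).comp A) x := by
  have hU : IsOpen (A ⁻¹' Data.Si) := Data.isOpen_Si.preimage A.continuous
  have hmem : ∀ y ∈ A ⁻¹' Data.Si, ∀ s : ℝ, A y + s • w ∈ Data.Si := fun y hy s => by
    have h1 : (A y) 1 ∈ Ioo (0 : ℝ) 1 := hy
    change (A y + s • w) 1 ∈ Ioo (0 : ℝ) 1
    simpa [hw] using h1
  have hcG : ContinuousOn G Data.Si := fun z hz => (hd z hz).continuousAt.continuousWithinAt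
  have hline : ∀ y, Continuous fun s : ℝ => A y + s • w := fun y => by fun_prop
  have hc1 : ∀ y ∈ A ⁻¹' Data.Si, Continuous fun s => κ s • G (A y + s • w) := fun y hy =>
    hκ.smul (hcG.comp_continuous (hline y) (hmem y hy))
  have hc2 : Continuous fun s => κ s • (G' (A x + s • w)).comp A :=
    hκ.smul ((hc.comp_continuous (hline x) (hmem x hx)).clm_comp continuous_const)
  have := intervalIntegral.hasFDerivAt_integral_of_dominated_of_fderiv_le (μ := volume) (𝕜 := ℝ)
    (F := fun x s => κ s • G (A x + s • w)) (F' := fun x s => κ s • (G' (A x + s • w)).comp A)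
    (a := a) (b := b) (bound := fun s => |κ s| * (C * ‖A‖)) (hU.mem_nhds hx) ?_
    ((hc1 x hx).intervalIntegrable _ _) hc2.aestronglyMeasurable ?_ ?_ ?_
  · exact this
  · filter_upwards [hU.mem_nhds hx] with y hy using (hc1 y hy).aestronglyMeasurable
  · refine Eventually.of_forall fun s _ y hy => ?_
    rw [norm_smul, Real.norm_eq_abs]
    gcongr
    exact (ContinuousLinearMap.opNorm_comp_le _ _).trans
      (mul_le_mul_of_nonneg_right (hC _ (hmem y hy s)) (norm_nonneg _))
  · exact (hκ.abs.mul continuous_const).intervalIntegrable _ _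
  · refine Eventually.of_forall fun s _ y hy => ?_
    exact ((hd _ (hmem y hy s)).comp y ((A.hasFDerivAt).add_const _)).const_smul (κ s)

/-- Continuity of an integral over horizontal lines. -/
lemma continuousOn_integral_line {G : Plane → ℝ} (hG : ContinuousOn G Data.S) {κ : ℝ → ℝ}
    (hκ : Continuous κ) (a b : ℝ) :
    ContinuousOn (fun y => ∫ s in a..b, κ s * G (pt s y)) (Icc 0 1) := by
  -- Clamping y to [0, 1] gives a function that is continuous on all of ℝ.
  have h : Continuous fun y => ∫ s in a..b, κ s * G (pt s (max 0 (min 1 y))) := by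
    refine intervalIntegral.continuous_parametric_intervalIntegral_of_continuous' ?_ a b
    have : Continuous fun p : ℝ × ℝ => G (pt p.2 (max 0 (min 1 p.1))) := by
      refine hG.comp_continuous (by fun_prop) fun p => ?_
      change (pt p.2 (max 0 (min 1 p.1))) 1 ∈ Icc (0 : ℝ) 1
      simp
    exact (hκ.comp continuous_snd).mul this
  refine h.continuousOn.congr fun y hy => ?_
  simp only [min_eq_right hy.2, max_eq_right hy.1]

lemma norm_prodD_le {a a' b b' : ℝ → ℝ} {z : Plane} {A B : ℝ} (h1 : |a (z 0)| ≤ A)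
    (h2 : |a' (z 0)| ≤ A) (h3 : |b (z 1)| ≤ B) (h4 : |b' (z 1)| ≤ B) :
    ‖Data.prodD a a' b b' z‖ ≤ A * B * (‖coord 0‖ + ‖coord 1‖) := by
  have hA : 0 ≤ A := (abs_nonneg _).trans h1
  unfold Data.prodD
  refine (norm_add_le _ _).trans ?_
  rw [norm_smul, norm_smul, Real.norm_eq_abs, Real.norm_eq_abs, abs_mul, abs_mul, mul_add]
  gcongr

set_option maxSynthPendingDepth 3 in
set_option synthInstance.maxHeartbeats 400000 in
lemma norm_prodD2_le {a a' a'' b b' b'' : ℝ → ℝ} {z : Plane} {A B : ℝ} (h1 : |a (z 0)| ≤ A)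
    (h2 : |a' (z 0)| ≤ A) (h2' : |a'' (z 0)| ≤ A) (h3 : |b (z 1)| ≤ B) (h4 : |b' (z 1)| ≤ B)
    (h4' : |b'' (z 1)| ≤ B) :
    ‖Data.prodD2 a a' a'' b b' b'' z‖ ≤ A * B * (‖(coord 0).smulRight (coord 0)‖
      + ‖(coord 1).smulRight (coord 0) + (coord 0).smulRight (coord 1)‖
      + ‖(coord 1).smulRight (coord 1)‖) := by
  have hA : 0 ≤ A := (abs_nonneg _).trans h1
  unfold Data.prodD2
  refine (norm_add_le (E := Plane →L[ℝ] Plane →L[ℝ] ℝ) _ _).trans ((add_le_add_left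
    (norm_add_le (E := Plane →L[ℝ] Plane →L[ℝ] ℝ) _ _) _).trans ?_)
  rw [norm_smul, norm_smul, norm_smul, Real.norm_eq_abs, Real.norm_eq_abs, Real.norm_eq_abs,
    abs_mul, abs_mul, abs_mul, mul_add, mul_add]
  gcongr

lemma exists_abs_le_Icc {a b : ℝ} {f : ℝ → ℝ} (hf : ContinuousOn f (Icc a b)) :
    ∃ C, ∀ y ∈ Icc a b, |f y| ≤ C := by
  obtain ⟨C, hC⟩ := isCompact_Icc.exists_bound_of_continuousOn hf
  exact ⟨C, hC⟩

namespace Data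

variable (D : Data)

-- The factor α is kept and q is replaced by smooth functions converging in C²[0, 1] with the same
-- end conditions; the derivatives of the products then converge boundedly on the cell.
set_option maxSynthPendingDepth 3 in
set_option synthInstance.maxHeartbeats 400000 in
lemma streamMem_prod {α q q₁ q₂ : ℝ → ℝ} (hα : ContDiff ℝ ∞ α) (hp : ∀ s, α (s + D.L) = α s)
    (hq : ContinuousOn q (Icc 0 1)) (hq1 : ContinuousOn q₁ (Icc 0 1))
    (hq2 : ContinuousOn q₂ (Icc 0 1)) (hd : ∀ y ∈ Ioo (0 : ℝ) 1, HasDerivAt q (q₁ y) y)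
    (hd1 : ∀ y ∈ Ioo (0 : ℝ) 1, HasDerivAt q₁ (q₂ y) y) (h0 : q 0 = 0) (h1 : q 1 = 0)
    (h11 : q₁ 1 = 0) :
    D.StreamMem (prodD α (deriv α) q q₁) (prodD2 α (deriv α) (deriv (deriv α)) q q₁ q₂) := by
  have hα' := (contDiff_infty_iff_deriv.1 hα).2
  have hα'' := (contDiff_infty_iff_deriv.1 hα').2
  choose p hps hp0 hp1 hp11 hpe using fun n : ℕ =>
    exists_smooth_approx hq hq1 hq2 hd hd1 h0 h1 h11 (ε := 1 / ((n : ℝ) + 1)) (by positivity)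
  obtain ⟨A0, hA0⟩ := exists_abs_le_Icc (a := 0) (b := D.L) hα.continuous.continuousOn
  obtain ⟨A1, hA1⟩ := exists_abs_le_Icc (a := 0) (b := D.L) hα'.continuous.continuousOn
  obtain ⟨A2, hA2⟩ := exists_abs_le_Icc (a := 0) (b := D.L) hα''.continuous.continuousOn
  obtain ⟨B0, hB0⟩ := exists_abs_le_Icc hq
  obtain ⟨B1, hB1⟩ := exists_abs_le_Icc hq1
  obtain ⟨B2, hB2⟩ := exists_abs_le_Icc hq2
  have hε : ∀ n : ℕ, 1 / ((n : ℝ) + 1) ≤ 1 := fun n => by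
    rw [div_le_one (by positivity)]
    linarith [(Nat.cast_nonneg n : (0 : ℝ) ≤ n)]
  have close : ∀ {u v B : ℝ} (n : ℕ), |u - v| ≤ 1 / ((n : ℝ) + 1) → |v| ≤ B → |u| ≤ B + 1 := by
    intro u v B n h2 h3
    have := abs_add_le (u - v) v
    rw [sub_add_cancel] at this
    linarith [hε n]
  set A := max A0 (max A1 A2)
  set B := max (B0 + 1) (max (B1 + 1) (B2 + 1))
  have a0 : ∀ z ∈ D.cell, |α (z 0)| ≤ A := fun z hz =>
    (hA0 _ (Ioo_subset_Icc_self hz.1)).trans (le_max_left _ _)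
  have a1 : ∀ z ∈ D.cell, |deriv α (z 0)| ≤ A := fun z hz =>
    (hA1 _ (Ioo_subset_Icc_self hz.1)).trans ((le_max_left _ _).trans (le_max_right _ _))
  have a2 : ∀ z ∈ D.cell, |deriv (deriv α) (z 0)| ≤ A := fun z hz =>
    (hA2 _ (Ioo_subset_Icc_self hz.1)).trans ((le_max_right _ _).trans (le_max_right _ _))
  have b0 : ∀ n, ∀ z ∈ D.cell, |p n (z 1)| ≤ B := fun n z hz =>
    (close n (hpe n _ (Ioo_subset_Icc_self hz.2)).1 (hB0 _ (Ioo_subset_Icc_self hz.2))).trans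
      (le_max_left _ _)
  have b1 : ∀ n, ∀ z ∈ D.cell, |deriv (p n) (z 1)| ≤ B := fun n z hz =>
    (close n (hpe n _ (Ioo_subset_Icc_self hz.2)).2.1 (hB1 _ (Ioo_subset_Icc_self hz.2))).trans
      ((le_max_left _ _).trans (le_max_right _ _))
  have b2 : ∀ n, ∀ z ∈ D.cell, |deriv (deriv (p n)) (z 1)| ≤ B := fun n z hz =>
    (close n (hpe n _ (Ioo_subset_Icc_self hz.2)).2.2 (hB2 _ (Ioo_subset_Icc_self hz.2))).trans
      ((le_max_right _ _).trans (le_max_right _ _))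
  have lim : ∀ {u : ℕ → ℝ} {v : ℝ}, (∀ n : ℕ, |u n - v| ≤ 1 / ((n : ℝ) + 1)) →
      Tendsto u atTop (𝓝 v) := fun h => by
    rw [tendsto_iff_norm_sub_tendsto_zero]
    exact squeeze_zero (fun _ => norm_nonneg _) h tendsto_one_div_add_atTop_nhds_zero_nat
  have t0 : ∀ z ∈ D.cell, Tendsto (fun n => p n (z 1)) atTop (𝓝 (q (z 1))) := fun z hz =>
    lim fun n => (hpe n _ (Ioo_subset_Icc_self hz.2)).1
  have t1 : ∀ z ∈ D.cell, Tendsto (fun n => deriv (p n) (z 1)) atTop (𝓝 (q₁ (z 1))) := fun z hz =>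
    lim fun n => (hpe n _ (Ioo_subset_Icc_self hz.2)).2.1
  have t2 : ∀ z ∈ D.cell, Tendsto (fun n => deriv (deriv (p n)) (z 1)) atTop (𝓝 (q₂ (z 1))) :=
    fun z hz => lim fun n => (hpe n _ (Ioo_subset_Icc_self hz.2)).2.2
  refine D.streamMem_of_tendsto (fun n => D.streamMem_tens hα (hps n) hp (by simp [hp0])
    (by simp [hp1]) (hp11 n)) (C := max (A * B * (‖coord 0‖ + ‖coord 1‖))
      (A * B * (‖(coord 0).smulRight (coord 0)‖
      + ‖(coord 1).smulRight (coord 0) + (coord 0).smulRight (coord 1)‖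
      + ‖(coord 1).smulRight (coord 1)‖))) ?_ ?_ ?_ ?_
  · exact fun n z hz => (norm_prodD_le (a0 z hz) (a1 z hz) (b0 n z hz) (b1 n z hz)).trans
      (le_max_left _ _)
  · exact fun n z hz => (norm_prodD2_le (a0 z hz) (a1 z hz) (a2 z hz) (b0 n z hz) (b1 n z hz)
      (b2 n z hz)).trans (le_max_right _ _)
  · exact fun z hz => (((t0 z hz).const_mul _).smul_const _).add
      (((t1 z hz).const_mul _).smul_const _)
  · exact fun z hz => ((((t0 z hz).const_mul _).smul_const _).add
      (((t1 z hz).const_mul _).smul_const _)).add (((t2 z hz).const_mul _).smul_const _)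

/-! ### Averaging in the periodic direction -/

/-- The kernel `cos²(πs/L)`. -/
def kern (s : ℝ) : ℝ := Real.cos (Real.pi * s / D.L) ^ 2

lemma continuous_kern : Continuous D.kern := by unfold kern; fun_prop

lemma kern_nonneg (s : ℝ) : 0 ≤ D.kern s := sq_nonneg _

lemma kern_add (s : ℝ) : D.kern (s + D.L) = D.kern s := by
  have hL := D.L_pos.ne'
  have : Real.pi * (s + D.L) / D.L = Real.pi * s / D.L + Real.pi := by field_simp
  simp [kern, this, Real.cos_add_pi]

/-- For 0 < |s| ≤ L/2 the angle is nonzero and lies in [-π/2, π/2], so its sine does not vanish and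
cos² < 1. -/
lemma kern_lt {s : ℝ} (hs : s ∈ Icc (-(D.L / 2)) (D.L / 2)) (h0 : s ≠ 0) : D.kern s < D.kern 0 := by
  have hL := D.L_pos
  have h1 : |Real.pi * s / D.L| ≤ Real.pi / 2 := by
    rw [abs_div, abs_mul, abs_of_pos Real.pi_pos, abs_of_pos hL, div_le_iff₀ hL]
    have : |s| ≤ D.L / 2 := abs_le.2 hs
    nlinarith [Real.pi_pos]
  have h2 : Real.pi * s / D.L ≠ 0 := by
    have := Real.pi_pos.ne'
    have := hL.ne'
    positivity
  have h3 : Real.sin (Real.pi * s / D.L) ≠ 0 := by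
    rw [abs_le] at h1
    rw [Ne, Real.sin_eq_zero_iff_of_lt_of_lt (by linarith [Real.pi_pos]) (by linarith [Real.pi_pos])]
    exact h2
  have h4 := Real.sin_sq_add_cos_sq (Real.pi * s / D.L)
  have h5 : 0 < Real.sin (Real.pi * s / D.L) ^ 2 := by positivity
  simp only [kern, mul_zero, zero_div, Real.cos_zero]
  linarith

/-- The average of `G` in the `z₁` direction with the normalized kernel `cos^{2n}(πs/L)`. -/
def avg {F : Type*} [NormedAddCommGroup F] [NormedSpace ℝ F] (n : ℕ) (G : Plane → F) (z : Plane) : F :=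
  (∫ s in (-(D.L / 2))..(D.L / 2), D.kern s ^ n)⁻¹
    • ∫ s in (-(D.L / 2))..(D.L / 2), D.kern s ^ n • G (z + s • (-e 0))

section

variable {F : Type*} [NormedAddCommGroup F] [NormedSpace ℝ F] {G : Plane → F}

lemma translate_mem_S {z : Plane} (hz : z ∈ S) (s : ℝ) : z + s • (-e 0) ∈ S := by
  have h1 : z 1 ∈ Icc (0 : ℝ) 1 := hz
  change (z + s • (-e 0)) 1 ∈ Icc (0 : ℝ) 1
  simpa [e] using h1

/-- Normalized powers of a nonnegative continuous function concentrate at its unique maximum, here s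
= 0. -/
lemma tendsto_avg [CompleteSpace F] (hG : ContinuousOn G S) {z : Plane} (hz : z ∈ S) :
    Tendsto (fun n => D.avg n G z) atTop (𝓝 (G z)) := by
  have hL := D.L_pos
  have hc : ContinuousOn (fun s : ℝ => G (z + s • (-e 0))) (Icc (-(D.L / 2)) (D.L / 2)) :=
    (hG.comp_continuous (by fun_prop) (translate_mem_S hz)).continuousOn
  have := tendsto_setIntegral_pow_smul_of_unique_maximum_of_isCompact_of_continuousOn
    (μ := volume) (c := D.kern) (g := fun s : ℝ => G (z + s • (-e 0))) (x₀ := 0)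
    (isCompact_Icc (a := -(D.L / 2)) (b := D.L / 2)) D.continuous_kern.continuousOn
    (fun y hy hy0 => D.kern_lt hy hy0) (fun s _ => D.kern_nonneg s) (by simp [kern])
    (by
      rw [interior_Icc, closure_Ioo (by linarith)]
      constructor <;> linarith)
    hc
  simp only [zero_smul, add_zero] at this
  refine this.congr fun n => ?_
  simp only [avg, intervalIntegral.integral_of_le (show -(D.L / 2) ≤ D.L / 2 by linarith),
    integral_Icc_eq_integral_Ioc]

lemma norm_avg_le {C : ℝ} (hC : ∀ z ∈ S, ‖G z‖ ≤ C) (n : ℕ) {z : Plane} (hz : z ∈ S) :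
    ‖D.avg n G z‖ ≤ C := by
  have hL := D.L_pos
  have hC0 : 0 ≤ C := (norm_nonneg _).trans (hC z hz)
  have hle : -(D.L / 2) ≤ D.L / 2 := by linarith
  have hZ : 0 ≤ ∫ s in (-(D.L / 2))..(D.L / 2), D.kern s ^ n :=
    intervalIntegral.integral_nonneg hle fun s _ => pow_nonneg (D.kern_nonneg s) n
  have hI : ‖∫ s in (-(D.L / 2))..(D.L / 2), D.kern s ^ n • G (z + s • (-e 0))‖
      ≤ ∫ s in (-(D.L / 2))..(D.L / 2), D.kern s ^ n * C := by
    refine intervalIntegral.norm_integral_le_of_norm_le hle (Eventually.of_forall fun s _ => ?_)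
      (((D.continuous_kern.pow n).mul continuous_const).intervalIntegrable _ _)
    rw [norm_smul, Real.norm_of_nonneg (pow_nonneg (D.kern_nonneg s) n)]
    exact mul_le_mul_of_nonneg_left (hC _ (translate_mem_S hz s)) (pow_nonneg (D.kern_nonneg s) n)
  rw [avg, norm_smul, norm_inv, Real.norm_of_nonneg hZ]
  refine (mul_le_mul_of_nonneg_left hI (inv_nonneg.2 hZ)).trans ?_
  rw [intervalIntegral.integral_mul_const, ← mul_assoc]
  exact mul_le_of_le_one_left hC0 (inv_mul_le_one)

/-- The translations are horizontal, so they preserve the strip, and averaging commutes with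
differentiation. -/
lemma hasFDerivAt_avg [CompleteSpace F] {G' : Plane → Plane →L[ℝ] F}
    (hd : ∀ z ∈ Si, HasFDerivAt G (G' z) z) (hc : ContinuousOn G' Si) {C : ℝ}
    (hC : ∀ z ∈ Si, ‖G' z‖ ≤ C) (n : ℕ) {z : Plane} (hz : z ∈ Si) :
    HasFDerivAt (D.avg n G) (D.avg n G' z) z := by
  have := (hasFDerivAt_integral_translate hd hc hC (κ := fun s => D.kern s ^ n)
    (D.continuous_kern.pow n) (ContinuousLinearMap.id ℝ Plane) (w := -e 0) (by simp [e])
    (-(D.L / 2)) (D.L / 2) (x := z) hz).const_smul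
      (∫ s in (-(D.L / 2))..(D.L / 2), D.kern s ^ n)⁻¹
  exact this

end

end Data

namespace Data

variable (D : Data)

lemma exists_bound_S {F : Type*} [NormedAddCommGroup F] {G : Plane → F} (hG : ContinuousOn G S)
    (hp : ∀ z ∈ S, G (z + D.L • e 0) = G z) : ∃ C, ∀ z ∈ S, ‖G z‖ ≤ C := by
  obtain ⟨C, -, hC⟩ := D.exists_bound_periodic (f := fun x => G (D.Φ x))
    (hG.comp D.contDiff_Φ.continuous.continuousOn fun x hx => D.Φ_mem_S hx)
    (fun x hx => by simp only [D.Φ_periodic, hp _ (D.Φ_mem_S hx)])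
  refine ⟨C, fun z hz => ?_⟩
  simpa [D.Φ_Ψ] using hC _ (D.Ψ_mem_K hz)

/-- The products of powers of `cos (πs/L)` and `sin (πs/L)` of total degree `2n`. -/
def trig (n m : ℕ) (s : ℝ) : ℝ :=
  Real.cos (Real.pi * s / D.L) ^ m * Real.sin (Real.pi * s / D.L) ^ (2 * n - m)

lemma contDiff_trig (n m : ℕ) : ContDiff ℝ ∞ (D.trig n m) := by
  unfold trig
  exact (((contDiff_const.mul contDiff_id).div_const _).cos.pow _).mul
    (((contDiff_const.mul contDiff_id).div_const _).sin.pow _)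

/-- Cosine and sine both change sign under s ↦ s + L, and the total degree 2n is even. The bound on
m keeps the truncated subtraction in the exponent exact. -/
lemma trig_add (n m : ℕ) (hm : m ≤ 2 * n) (s : ℝ) : D.trig n m (s + D.L) = D.trig n m s := by
  have hL := D.L_pos.ne'
  have : Real.pi * (s + D.L) / D.L = Real.pi * s / D.L + Real.pi := by field_simp
  simp only [trig, this, Real.cos_add_pi, Real.sin_add_pi]
  rw [neg_pow (Real.cos _), neg_pow (Real.sin _), mul_mul_mul_comm, ← pow_add,
    show m + (2 * n - m) = 2 * n by omega]
  simp

/-- Addition theorem for the cosine and the binomial theorem. The kernel separates its two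
variables, so an average becomes a finite sum of products of a function of `z 0` and a function of
`z 1`. -/
lemma kern_sub_pow (n : ℕ) (x t : ℝ) : D.kern (x - t) ^ n
    = ∑ m ∈ Finset.range (2 * n + 1), ((2 * n).choose m : ℝ) * (D.trig n m x * D.trig n m t) := by
  have : Real.pi * (x - t) / D.L = Real.pi * x / D.L - Real.pi * t / D.L := by ring
  rw [kern, ← pow_mul, this, Real.cos_sub, add_pow]
  refine Finset.sum_congr rfl fun m _ => ?_
  simp only [trig, mul_pow]
  ring

/-- The integral of `G` with weight `κ` over a horizontal line. -/
def line (κ : ℝ → ℝ) (G : Plane → ℝ) (y : ℝ) : ℝ := ∫ s in (0 : ℝ)..D.L, κ s * G (pt s y)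

lemma hasDerivAt_line {G : Plane → ℝ} {G' : Plane → Plane →L[ℝ] ℝ}
    (hd : ∀ z ∈ Si, HasFDerivAt G (G' z) z) (hc : ContinuousOn G' Si) {C : ℝ}
    (hC : ∀ z ∈ Si, ‖G' z‖ ≤ C) {κ : ℝ → ℝ} (hκ : Continuous κ) {y : ℝ} (hy : y ∈ Ioo (0 : ℝ) 1) :
    HasDerivAt (D.line κ G) (D.line κ (fun z => G' z (e 1)) y) y := by
  set A : ℝ →L[ℝ] Plane := (ContinuousLinearMap.id ℝ ℝ).smulRight (e 1) with hA
  have hpt : ∀ s y, A y + s • e 0 = pt s y := fun s y => by simp [hA, pt, add_comm]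
  have hmem : ∀ s, pt s y ∈ Si := fun s => by
    change (pt s y) 1 ∈ Ioo (0 : ℝ) 1
    simpa using hy
  have h := (hasFDerivAt_integral_translate hd hc hC hκ A (w := e 0) (by simp [e]) 0 D.L (x := y)
    (by change (A y) 1 ∈ Ioo (0 : ℝ) 1; simpa [hA, e] using hy)).hasDerivAt
  simp only [hpt] at h
  have hint : IntervalIntegrable (fun s => κ s • (G' (pt s y)).comp A) volume 0 D.L := by
    refine (hκ.smul (Continuous.clm_comp (hc.comp_continuous ?_ hmem)
      continuous_const)).intervalIntegrable _ _
    fun_prop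
  rw [ContinuousLinearMap.intervalIntegral_apply hint] at h
  refine h.congr_deriv ?_
  simp [line, hA]

/-- Substitute t = z 0 - s and move the window to [0, L] by periodicity. The dependence on `z 0`
then sits in the kernel alone. -/
lemma integral_kern_translate {G : Plane → ℝ} (hp : ∀ z ∈ S, G (z + D.L • e 0) = G z) (n : ℕ)
    {z : Plane} (hz : z ∈ S) :
    ∫ s in (-(D.L / 2))..(D.L / 2), D.kern s ^ n • G (z + s • (-e 0))
      = ∫ t in (0 : ℝ)..D.L, D.kern (z 0 - t) ^ n * G (pt t (z 1)) := by
  have hmem : ∀ s, pt s (z 1) ∈ S := fun s => by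
    have : z 1 ∈ Icc (0 : ℝ) 1 := hz
    change (pt s (z 1)) 1 ∈ Icc (0 : ℝ) 1
    simpa using this
  have hper : Function.Periodic (fun t => D.kern (z 0 - t) ^ n * G (pt t (z 1))) D.L := by
    intro t
    have h1 : D.kern (z 0 - (t + D.L)) = D.kern (z 0 - t) := by
      rw [← D.kern_add (z 0 - (t + D.L))]
      congr 1
      ring
    have h2 : pt (t + D.L) (z 1) = pt t (z 1) + D.L • e 0 := by
      simp [pt]
      module
    simp only [h1, h2, hp _ (hmem t)]
  have h2 := intervalIntegral.integral_comp_sub_left (a := -(D.L / 2)) (b := D.L / 2)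
    (fun t => D.kern (z 0 - t) ^ n * G (pt t (z 1))) (z 0)
  have h3 := hper.intervalIntegral_add_eq (z 0 - D.L / 2) 0
  rw [show z 0 - D.L / 2 + D.L = z 0 - -(D.L / 2) by ring, zero_add] at h3
  rw [← h3, ← h2]
  refine intervalIntegral.integral_congr fun s _ => ?_
  have h4 : z + s • (-e 0) = pt (z 0 - s) (z 1) := by
    ext i
    fin_cases i <;> simp [e, sub_eq_add_neg]
  simp only [h4, smul_eq_mul, sub_sub_cancel]

lemma avg_eq_sum {G : Plane → ℝ} (hG : ContinuousOn G S)
    (hp : ∀ z ∈ S, G (z + D.L • e 0) = G z) (n : ℕ) {z : Plane} (hz : z ∈ S) :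
    D.avg n G z = ∑ m ∈ Finset.range (2 * n + 1), D.trig n m (z 0) *
      (((∫ s in (-(D.L / 2))..(D.L / 2), D.kern s ^ n)⁻¹ * ((2 * n).choose m : ℝ))
        * D.line (D.trig n m) G (z 1)) := by
  have hmem : ∀ s, pt s (z 1) ∈ S := fun s => by
    have : z 1 ∈ Icc (0 : ℝ) 1 := hz
    change (pt s (z 1)) 1 ∈ Icc (0 : ℝ) 1
    simpa using this
  have hcont : Continuous fun t => G (pt t (z 1)) := hG.comp_continuous (by fun_prop) hmem
  rw [avg, D.integral_kern_translate hp n hz]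
  simp only [D.kern_sub_pow, Finset.sum_mul]
  rw [intervalIntegral.integral_finsetSum]
  · rw [smul_eq_mul, Finset.mul_sum]
    refine Finset.sum_congr rfl fun m _ => ?_
    have : ∀ t, ((2 * n).choose m : ℝ) * (D.trig n m (z 0) * D.trig n m t) * G (pt t (z 1))
        = (((2 * n).choose m : ℝ) * D.trig n m (z 0)) * (D.trig n m t * G (pt t (z 1))) :=
      fun t => by ring
    simp only [this, intervalIntegral.integral_const_mul, line]
    ring
  · intro m _
    exact ((continuous_const.mul (continuous_const.mul (D.contDiff_trig n m).continuous)).mul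
      hcont).intervalIntegrable _ _

set_option maxSynthPendingDepth 3 in
set_option synthInstance.maxHeartbeats 400000 in
/-- The field whose stream function is `g ∘ Φ` belongs to `V`. -/
lemma streamMem_of_hasFDerivAt {g : Plane → ℝ} {g₁ : Plane → Plane →L[ℝ] ℝ}
    {g₂ : Plane → Plane →L[ℝ] Plane →L[ℝ] ℝ} (hc : ContinuousOn g S) (hc1 : ContinuousOn g₁ S)
    (hc2 : ContinuousOn g₂ S) (hd : ∀ z ∈ Si, HasFDerivAt g (g₁ z) z)
    (hd1 : ∀ z ∈ Si, HasFDerivAt g₁ (g₂ z) z) (hp : ∀ z ∈ S, g (z + D.L • e 0) = g z)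
    (hp1 : ∀ z ∈ S, g₁ (z + D.L • e 0) = g₁ z) (hp2 : ∀ z ∈ S, g₂ (z + D.L • e 0) = g₂ z)
    (h0 : ∀ s, g (pt s 0) = 0) (h1 : ∀ s, g (pt s 1) = 0) (h11 : ∀ s, g₁ (pt s 1) (e 1) = 0) :
    D.StreamMem g₁ g₂ := by
  obtain ⟨C1, hC1⟩ := D.exists_bound_S hc1 hp1
  obtain ⟨C2, hC2⟩ := D.exists_bound_S (F := Plane →L[ℝ] Plane →L[ℝ] ℝ) hc2 hp2
  have hC1' : ∀ z ∈ Si, ‖g₁ z‖ ≤ C1 := fun z hz => hC1 z (Si_subset_S hz)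
  have hC2' : ∀ z ∈ Si, ‖g₂ z‖ ≤ C2 := fun z hz => hC2 z (Si_subset_S hz)
  have hcell : ∀ z ∈ D.cell, z ∈ S := fun z hz => Si_subset_S (D.cell_subset_Si hz)
  -- Each averaged stream function is a finite sum of products to which `streamMem_prod` applies.
  -- The averages converge boundedly as n → ∞.
  have key : ∀ n, D.StreamMem (D.avg n g₁) (D.avg n g₂) := by
    intro n
    set c : ℕ → ℝ := fun m =>
      (∫ s in (-(D.L / 2))..(D.L / 2), D.kern s ^ n)⁻¹ * ((2 * n).choose m : ℝ) with hcdef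
    set q : ℕ → ℝ → ℝ := fun m y => c m * D.line (D.trig n m) g y with hq
    set q1 : ℕ → ℝ → ℝ := fun m y => c m * D.line (D.trig n m) (fun z => g₁ z (e 1)) y with hq1
    set q2 : ℕ → ℝ → ℝ := fun m y => c m * D.line (D.trig n m) (fun z => g₂ z (e 1) (e 1)) y with hq2
    have ht : ∀ m, Continuous (D.trig n m) := fun m => (D.contDiff_trig n m).continuous
    have dq : ∀ m, ∀ y ∈ Ioo (0 : ℝ) 1, HasDerivAt (q m) (q1 m y) y := fun m y hy =>
      (D.hasDerivAt_line hd (hc1.mono Si_subset_S) hC1' (ht m) hy).const_mul (c m)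
    have dq1 : ∀ m, ∀ y ∈ Ioo (0 : ℝ) 1, HasDerivAt (q1 m) (q2 m y) y := fun m y hy => by
      set ev : (Plane →L[ℝ] ℝ) →L[ℝ] ℝ := ContinuousLinearMap.apply ℝ ℝ (e 1)
      refine (D.hasDerivAt_line (G := fun z => g₁ z (e 1)) (G' := fun z => ev.comp (g₂ z))
        (C := ‖ev‖ * C2) (fun z hz => ev.hasFDerivAt.comp z (hd1 z hz))
        (continuousOn_const.clm_comp (hc2.mono Si_subset_S)) (fun z hz => ?_) (ht m) hy).const_mul
        (c m)
      exact (ContinuousLinearMap.opNorm_comp_le _ _).trans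
        (mul_le_mul_of_nonneg_left (hC2' z hz) (norm_nonneg _))
    have cq : ∀ m, ContinuousOn (q m) (Icc 0 1) := fun m =>
      continuousOn_const.mul (continuousOn_integral_line hc (ht m) _ _)
    have cq1 : ∀ m, ContinuousOn (q1 m) (Icc 0 1) := fun m =>
      continuousOn_const.mul (continuousOn_integral_line (hc1.clm_apply continuousOn_const) (ht m) _ _)
    have cq2 : ∀ m, ContinuousOn (q2 m) (Icc 0 1) := fun m =>
      continuousOn_const.mul (continuousOn_integral_line
        ((hc2.clm_apply continuousOn_const).clm_apply continuousOn_const) (ht m) _ _)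
    have dt : ∀ m s, HasDerivAt (D.trig n m) (deriv (D.trig n m) s) s := fun m s =>
      ((D.contDiff_trig n m).differentiable (by simp) s).hasDerivAt
    have dt1 : ∀ m s, HasDerivAt (deriv (D.trig n m)) (deriv (deriv (D.trig n m)) s) s := fun m s =>
      ((contDiff_infty_iff_deriv.1 (D.contDiff_trig n m)).2.differentiable (by simp) s).hasDerivAt
    have hsum : ∀ z ∈ Si, D.avg n g₁ z = ∑ m ∈ Finset.range (2 * n + 1),
        prodD (D.trig n m) (deriv (D.trig n m)) (q m) (q1 m) z := by
      intro z hz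
      -- Both sides are the derivative at z of the averaged stream function, once as an average and
      -- once as a finite sum.
      refine (hasFDerivAt_avg D hd (hc1.mono Si_subset_S) hC1' n hz).unique ?_
      refine HasFDerivAt.congr_of_eventuallyEq (HasFDerivAt.fun_sum fun m _ =>
        hasFDerivAt_prod (dt m (z 0)) (dq m (z 1) hz)) ?_
      filter_upwards [isOpen_Si.mem_nhds hz] with y hy
      exact D.avg_eq_sum hc hp n (Si_subset_S hy)
    have hsum2 : ∀ z ∈ Si, D.avg n g₂ z = ∑ m ∈ Finset.range (2 * n + 1),
        prodD2 (D.trig n m) (deriv (D.trig n m)) (deriv (deriv (D.trig n m))) (q m) (q1 m) (q2 m) z := by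
      intro z hz
      refine (hasFDerivAt_avg D hd1 (hc2.mono Si_subset_S) hC2' n hz).unique ?_
      refine HasFDerivAt.congr_of_eventuallyEq (HasFDerivAt.fun_sum fun m _ =>
        hasFDerivAt_prodD (dt m (z 0)) (dt1 m (z 0)) (dq m (z 1) hz) (dq1 m (z 1) hz)) ?_
      filter_upwards [isOpen_Si.mem_nhds hz] with y hy
      exact hsum y hy
    refine (StreamMem.sum (Finset.range (2 * n + 1)) fun m hm => D.streamMem_prod
      (D.contDiff_trig n m) (D.trig_add n m (by simpa [Nat.lt_succ_iff] using hm)) (cq m) (cq1 m) (cq2 m)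
      (dq m) (dq1 m) ?_ ?_ ?_).congr (fun z hz => (hsum z (D.cell_subset_Si hz)).symm)
      (fun z hz => (hsum2 z (D.cell_subset_Si hz)).symm)
    · simp [hq, line, h0]
    · simp [hq, line, h1]
    · simp [hq1, line, h11]
  exact D.streamMem_of_tendsto key (C := max C1 C2)
    (fun n z hz => (D.norm_avg_le hC1 n (hcell z hz)).trans (le_max_left _ _))
    (fun n z hz => (D.norm_avg_le hC2 n (hcell z hz)).trans (le_max_right _ _))
    (fun z hz => D.tendsto_avg hc1 (hcell z hz)) (fun z hz => D.tendsto_avg hc2 (hcell z hz))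

end Data

/-! ### Stream functions of C² fields, and their membership in `V` -/

namespace Data

variable (D : Data)

lemma eqOn_K_of_Ω {E : Type*} [TopologicalSpace E] [T2Space E] {f g : Plane → E}
    (hf : ContinuousOn f D.K) (hg : ContinuousOn g D.K)
    (hfp : ∀ x ∈ D.K, f (x + D.L • e 0) = f x) (hgp : ∀ x ∈ D.K, g (x + D.L • e 0) = g x)
    (h : ∀ x ∈ D.Ω, f x = g x) : ∀ x ∈ D.K, f x = g x := by
  have hcl : D.K₀ ⊆ closure (D.Ω : Set Plane) := by
    rw [D.K₀_eq]
    rintro _ ⟨z, hz, rfl⟩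
    have hz' : z ∈ closure (Ioo 0 D.L ×ˢ Ioo (0 : ℝ) 1) := by
      rw [closure_prod_eq, closure_Ioo D.L_pos.ne, closure_Ioo (by norm_num)]
      exact hz
    refine map_mem_closure (f := fun z : ℝ × ℝ => pt z.1 (z.2 * D.h z.1)) ?_ hz'
      fun y hy => D.pt_mem_Ω hy.1 hy.2
    have := D.h_continuous
    fun_prop
  have h0 : EqOn f g D.K₀ := EqOn.of_subset_closure (s := (D.Ω : Set Plane)) h
    (hf.mono D.K₀_subset_K) (hg.mono D.K₀_subset_K) D.Ω_subset_K₀ hcl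
  intro x hx
  obtain ⟨m, hm⟩ := D.exists_mem_K₀ hx
  have h1 := h0 hm
  rwa [(D.periodic_zsmul hfp m hx).2, (D.periodic_zsmul hgp m hx).2] at h1

lemma eq_of_eqOn_Ioo {E : Type*} [TopologicalSpace E] [T2Space E] {f g : ℝ → E} (hf : Continuous f)
    (hg : Continuous g) (hfp : ∀ s, f (s + D.L) = f s) (hgp : ∀ s, g (s + D.L) = g s)
    (h : ∀ s ∈ Ioo 0 D.L, f s = g s) (s : ℝ) : f s = g s := by
  have h1 : EqOn f g (closure (Ioo 0 D.L)) := EqOn.closure h hf hg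
  rw [closure_Ioo D.L_pos.ne] at h1
  obtain ⟨y, hy, hy2⟩ := Function.Periodic.exists_mem_Ico₀
    (f := fun s => (f s, g s)) (fun s => by simp [hfp, hgp]) D.L_pos s
  have h2 := h1 (Ico_subset_Icc_self hy)
  rw [Prod.ext_iff] at hy2
  exact hy2.1.trans (h2.trans hy2.2.symm)

/-- Γ₁ covers only 0 < x₁ < L; continuity and periodicity supply the remaining points. -/
lemma top_eq_zero_of_Γ₁ {u : Plane → Plane} (hu : ContinuousOn u D.K)
    (hp : ∀ x ∈ D.K, u (x + D.L • e 0) = u x) (h : ∀ x ∈ D.Γ₁, u x = 0) (s : ℝ) :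
    u (pt s (D.h s)) = 0 := by
  refine D.eq_of_eqOn_Ioo (f := fun s => u (pt s (D.h s))) (g := fun _ => 0)
    (D.continuousOn_top hu) continuous_const (fun s => ?_) (fun _ => rfl) (fun s hs => ?_) s
  · rw [D.h_periodic, ← pt_add_smul, hp _ (D.pt_top_mem_K s)]
  · exact h _ ⟨by simpa using hs, by simp⟩

lemma bottom_eq_zero_of_Γ₀ {u : Plane → Plane} (hu : ContinuousOn u D.K)
    (hp : ∀ x ∈ D.K, u (x + D.L • e 0) = u x) (h : ∀ x ∈ D.Γ₀, inner ℝ (u x) n = 0) (s : ℝ) :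
    u (pt s 0) 1 = 0 := by
  refine D.eq_of_eqOn_Ioo (f := fun s => u (pt s 0) 1) (g := fun _ => 0)
    ((continuous_coord 1).comp (D.continuousOn_bottom hu)) continuous_const (fun s => ?_)
    (fun _ => rfl) (fun s hs => ?_) s
  · rw [← pt_add_smul, hp _ (D.pt_bot_mem_K s)]
  · have := h (pt s 0) ⟨by simpa using hs, by simp⟩
    simpa [inner_n] using this

/-- The form `w₁ dx₂ - w₂ dx₁`. -/
def form (w : Plane → Plane) (x : Plane) : Plane →L[ℝ] ℝ := w x 0 • coord 1 - w x 1 • coord 0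

/-- The pullback of `form w` to the straight strip. -/
def pullForm (w : Plane → Plane) (z : Plane) : Plane →L[ℝ] ℝ :=
  (form w (D.Ψ z)).comp (fderiv ℝ D.Ψ z)

/-- `form w` is what the differential of a stream function of w must be. A primitive of `pullForm w`
on the strip is therefore a stream function of w in straightened coordinates. -/
lemma field_pullForm (w : Plane → Plane) : D.field (D.pullForm w) = w := by
  funext x
  simp only [field, pullForm, ContinuousLinearMap.comp_apply, D.fderiv_Ψ_Φ, D.Ψ_Φ, form]
  apply plane_ext <;> simp [e]

lemma contDiffOn_form {w : Plane → Plane} {n : WithTop ℕ∞} (hw : ContDiffOn ℝ n w D.K) :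
    ContDiffOn ℝ n (form w) D.K :=
  (((coord 0).contDiff.comp_contDiffOn hw).smul contDiffOn_const).sub
    (((coord 1).contDiff.comp_contDiffOn hw).smul contDiffOn_const)

lemma contDiffOn_pullForm {w : Plane → Plane} {n : ℕ∞} (hw : ContDiffOn ℝ n w D.K) :
    ContDiffOn ℝ n (D.pullForm w) S := by
  have h1 : ContDiff ℝ n D.Ψ := D.contDiff_Ψ.of_le (WithTop.coe_le_coe.2 le_top)
  have h2 : ContDiff ℝ n (fderiv ℝ D.Ψ) :=
    (D.contDiff_Ψ.fderiv_right (m := ∞) (by simp)).of_le (WithTop.coe_le_coe.2 le_top)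
  exact ((D.contDiffOn_form hw).comp h1.contDiffOn fun z hz => D.Ψ_mem_K hz).clm_comp h2.contDiffOn

lemma pullForm_periodic {w : Plane → Plane} (hp : ∀ x ∈ D.K, w (x + D.L • e 0) = w x) {z : Plane}
    (hz : z ∈ S) : D.pullForm w (z + D.L • e 0) = D.pullForm w z := by
  have h1 : fderiv ℝ D.Ψ (z + D.L • e 0) = fderiv ℝ D.Ψ z := by
    ext1 v
    have h2 : deriv D.h (z 0 + D.L) = deriv D.h (z 0) := by
      rw [← deriv_comp_add_const]
      simp only [D.h_periodic]
    simp [D.fderiv_Ψ, e, D.h_periodic, h2]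
  simp only [pullForm, form, h1, D.Ψ_periodic, hp _ (D.Ψ_mem_K hz)]

/-- The exterior derivative of w₁ dx₂ - w₂ dx₁ is div w times the area form, so the form is closed,
and so is its pullback. The second derivative of Ψ contributes only a symmetric term. -/
lemma fderiv_pullForm_symm {w : Plane → Plane} (hw : ContDiffOn ℝ 1 w D.K)
    (hdiv : ∀ x ∈ D.Ki, D.div w x = 0) {z : Plane} (hz : z ∈ Si) (u v : Plane) :
    fderiv ℝ (D.pullForm w) z u v = fderiv ℝ (D.pullForm w) z v u := by
  have hx := D.Ψ_mem_Ki hz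
  have hd := (D.differentiableAt' hw hx).hasFDerivAt
  have h1 : HasFDerivAt (form w) _ (D.Ψ z) :=
    (((coord 0).hasFDerivAt.comp _ hd).smul_const (coord 1)).sub
      (((coord 1).hasFDerivAt.comp _ hd).smul_const (coord 0))
  have h2 : HasFDerivAt (fderiv ℝ D.Ψ) (fderiv ℝ (fderiv ℝ D.Ψ) z) z :=
    ((D.contDiff_Ψ.fderiv_right (m := ∞) (by simp)).differentiable (by simp) z).hasFDerivAt
  have h3 : HasFDerivAt (D.pullForm w) _ z := (h1.comp z (D.hasFDerivAt_Ψ z)).clm_comp h2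
  have hsymm : fderiv ℝ (fderiv ℝ D.Ψ) z u v = fderiv ℝ (fderiv ℝ D.Ψ) z v u :=
    (D.contDiff_Ψ.contDiffAt.isSymmSndFDerivAt
      (by simpa using WithTop.coe_le_coe.2 (le_top : (2 : ℕ∞) ≤ ⊤))) u v
  have hdiv' := hdiv _ hx
  simp only [div, Fin.sum_univ_two] at hdiv'
  rw [h3.fderiv]
  simp only [add_apply, ContinuousLinearMap.comp_apply,
    ContinuousLinearMap.compL_apply, ContinuousLinearMap.flip_apply, hsymm, add_right_inj]
  generalize fderiv ℝ D.Ψ z u = U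
  generalize fderiv ℝ D.Ψ z v = W
  simp [D.fderiv_apply_eq w hx]
  linear_combination (U 0 * W 1 - U 1 * W 0) * hdiv'

set_option maxSynthPendingDepth 3 in
set_option synthInstance.maxHeartbeats 400000 in
/-- A divergence-free periodic `C²` field with the boundary conditions of `Ṽ` belongs to `V`. -/
theorem toH1_mem_V {w : Plane → Plane} (hw : ContDiffOn ℝ 2 w D.K)
    (hp : ∀ x ∈ D.K, w (x + D.L • e 0) = w x) (hdiv : ∀ x ∈ D.Ω, D.div w x = 0)
    (htop : ∀ x ∈ D.Γ₁, w x = 0) (hbot : ∀ x ∈ D.Γ₀, inner ℝ (w x) n = 0) :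
    D.toH1 w (D.grad w) ∈ D.V := by
  have hw1 : ContDiffOn ℝ 1 w D.K := hw.of_le (by norm_num)
  have hcd : ContinuousOn (D.div w) D.K := by
    unfold div
    exact continuousOn_finsetSum _ fun j _ =>
      (continuous_coord j).comp_continuousOn (D.continuousOn_pd hw1 j)
  have hdivK : ∀ x ∈ D.K, D.div w x = 0 := D.eqOn_K_of_Ω (g := fun _ => 0) hcd continuousOn_const
    (fun x hx => by simp only [div, D.pd_periodic _ hp hx]) (fun _ _ => rfl) hdiv
  have htop' := D.top_eq_zero_of_Γ₁ hw.continuousOn hp htop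
  have hbot' := D.bottom_eq_zero_of_Γ₀ hw.continuousOn hp hbot
  set θ := D.pullForm w with hθ
  have hθ1 : ContDiffOn ℝ 1 θ S := D.contDiffOn_pullForm (n := 1) hw1
  have hθd : DifferentiableOn ℝ θ S := hθ1.differentiableOn (by simp)
  have hθc : ContinuousOn (fderivWithin ℝ θ S) S := hθ1.continuousOn_fderivWithin uniqueDiffOn_S le_rfl
  have hθp : ∀ z ∈ S, θ (z + D.L • e 0) = θ z := fun z hz => D.pullForm_periodic hp hz
  have hθi : ∀ z ∈ Si, HasFDerivAt θ (fderivWithin ℝ θ S z) z := fun z hz =>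
    (hθd z (Si_subset_S hz)).hasFDerivWithinAt.hasFDerivAt
      (mem_of_superset (isOpen_Si.mem_nhds hz) Si_subset_S)
  have hsymm : ∀ z ∈ S, ∀ u v, fderivWithin ℝ θ S z u v = fderivWithin ℝ θ S z v u := by
    intro z hz u v
    refine EqOn.of_subset_closure (s := Si) (t := S) (f := fun z => fderivWithin ℝ θ S z u v)
      (g := fun z => fderivWithin ℝ θ S z v u) (fun z hz => ?_)
      ((hθc.clm_apply continuousOn_const).clm_apply continuousOn_const)
      ((hθc.clm_apply continuousOn_const).clm_apply continuousOn_const)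
      Si_subset_S S_subset_closure_Si hz
    simp only [← (hθi z hz).fderiv]
    exact D.fderiv_pullForm_symm hw1 (fun x hx => hdivK x (D.Ki_subset_K hx)) hz u v
  -- Poincaré lemma on the convex strip: f is the stream function in straightened coordinates.
  obtain ⟨f, hf⟩ := convex_S.exists_forall_hasFDerivWithinAt_of_fderivWithin_symmetric hθd
    fun z hz u _ v _ => hsymm z hz u v
  have hθtop : ∀ s, θ (pt s 1) = 0 := fun s => by
    have : D.Ψ (pt s 1) = pt s (D.h s) := by simp [Ψ]
    simp [hθ, pullForm, this, form, htop']
  have hθbot : ∀ s, θ (pt s 0) (e 0) = 0 := fun s => by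
    have : D.Ψ (pt s 0) = pt s 0 := by simp [Ψ]
    simp [hθ, pullForm, this, form, hbot', D.fderiv_Ψ]
  have hline : ∀ y ∈ Icc (0 : ℝ) 1, (∀ s, θ (pt s y) (e 0) = 0) → ∀ s, f (pt s y) = f (pt 0 y) := by
    intro y hy h s
    have hd : ∀ s, HasDerivAt (fun s => f (pt s y)) 0 s := by
      intro s
      have h1 : HasDerivAt (fun s : ℝ => pt s y) (e 0) s := by
        have := ((hasDerivAt_id s).smul_const (e 0)).add_const (y • e 1)
        simpa [pt] using this
      have h2 := (hf (pt s y) (by simpa [S] using hy)).comp_hasDerivWithinAt (s := univ) s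
        h1.hasDerivWithinAt (fun t _ => by simpa [S] using hy)
      rw [h s, hasDerivWithinAt_univ] at h2
      exact h2
    exact is_const_of_deriv_eq_zero (fun s => (hd s).differentiableAt) (fun s => (hd s).deriv) s 0
  have hfbot := hline 0 (by simp) hθbot
  have hftop := hline 1 (by simp) fun s => by simp [hθtop]
  -- The increment of f over a period has zero derivative, hence is constant on the strip. It
  -- vanishes at the origin because f is constant along the bottom.
  have hfp : ∀ z ∈ S, f (z + D.L • e 0) = f z := by
    have hmaps : MapsTo (fun z => z + D.L • e 0) S S := fun z hz => by
      have : z 1 ∈ Icc (0 : ℝ) 1 := hz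
      change (z + D.L • e 0) 1 ∈ Icc (0 : ℝ) 1
      simpa [e] using this
    have hd : ∀ z ∈ S, HasFDerivWithinAt (fun z => f (z + D.L • e 0) - f z) (0 : Plane →L[ℝ] ℝ) S z := by
      intro z hz
      have h1 := (hf _ (hmaps hz)).comp z ((hasFDerivWithinAt_id z S).add_const (D.L • e 0)) hmaps
      refine (h1.sub (hf z hz)).congr_fderiv ?_
      rw [hθp z hz]
      ext1 v
      simp
    intro z hz
    have h2 := convex_S.is_const_of_fderivWithin_eq_zero (𝕜 := ℝ)
      (fun z hz => (hd z hz).differentiableWithinAt)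
      (fun z hz => (hd z hz).fderivWithin (uniqueDiffOn_S z hz)) hz
      (show pt 0 0 ∈ S by simp [S])
    simp only [pt_add_smul, zero_add, hfbot D.L, sub_self] at h2
    exact sub_eq_zero.1 h2
  -- c is the flux through the channel. The profile β has β(0) = 0, β(1) = 1 and β'(1) = 0, so f
  -- minus its bottom value minus cβ vanishes on both edges, as the approximation requires. The
  -- field with stream function β is itself in Ṽ and is added back at the end.
  set c := f (pt 0 1) - f (pt 0 0) with hc
  set β : ℝ → ℝ := fun y => y * (2 - y) with hβ
  have hβs : ContDiff ℝ ∞ β := by fun_prop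
  have hβ1 : deriv β = fun y => 2 - 2 * y := by
    funext y
    have := (hasDerivAt_id y).mul ((hasDerivAt_id y).const_sub 2)
    refine this.deriv.trans ?_
    simp
    ring
  have hβ2 : deriv (fun y : ℝ => 2 - 2 * y) = fun _ => -2 := by
    funext y
    have := ((hasDerivAt_id y).const_mul 2).const_sub 2
    exact this.deriv.trans (by simp)
  have hone : ∀ {a : ℝ}, deriv (fun _ : ℝ => a) = fun _ => 0 := fun {a} => by
    funext
    simp
  have hB := D.streamMem_tens (α := fun _ => 1) contDiff_const hβs (fun _ => rfl) (by simp) (by simp)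
    (by simp [hβ1])
  simp only [hone, hβ1, hβ2] at hB
  set b₁ : Plane → Plane →L[ℝ] ℝ := prodD (fun _ => 1) (fun _ => 0) β (fun y => 2 - 2 * y) with hb1
  set b₂ : Plane → Plane →L[ℝ] Plane →L[ℝ] ℝ :=
    prodD2 (fun _ => 1) (fun _ => 0) (fun _ => 0) β (fun y => 2 - 2 * y) (fun _ => -2) with hb2
  have db : ∀ z, HasFDerivAt (fun z : Plane => β (z 1)) (b₁ z) z := fun z => by
    have h1 : HasDerivAt β (2 - 2 * z 1) (z 1) := by
      have := (hβs.differentiable (by simp) (z 1)).hasDerivAt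
      rwa [hβ1] at this
    have := hasFDerivAt_prod (a := fun _ => 1) (a' := fun _ => 0) (z := z)
      (b' := fun y => 2 - 2 * y) (hasDerivAt_const _ _) h1
    simpa using this
  have db1 : ∀ z, HasFDerivAt b₁ (b₂ z) z := fun z => by
    refine hasFDerivAt_prodD (hasDerivAt_const _ _) (hasDerivAt_const _ _) ?_ ?_
    · have := (hβs.differentiable (by simp) (z 1)).hasDerivAt
      rwa [hβ1] at this
    · have := ((hasDerivAt_id (z 1)).const_mul 2).const_sub 2
      simpa using this
  have cb1 : Continuous b₁ := continuous_iff_continuousAt.2 fun z => (db1 z).continuousAt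
  have cb2 : b₂ = fun _ => (-2 : ℝ) • (coord 1).smulRight (coord 1) := by
    funext z
    simp [hb2, prodD2]
  have key : D.StreamMem (fun z => θ z - c • b₁ z) (fun z => fderivWithin ℝ θ S z - c • b₂ z) := by
    refine D.streamMem_of_hasFDerivAt (g := fun z => f z - f (pt 0 0) - c * β (z 1)) ?_ ?_ ?_ ?_ ?_ ?_ ?_
      ?_ ?_ ?_ ?_
    · refine (ContinuousOn.sub (fun z hz => (hf z hz).continuousWithinAt) continuousOn_const).sub ?_
      exact Continuous.continuousOn (by fun_prop)
    · exact hθ1.continuousOn.sub (cb1.const_smul c).continuousOn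
    · rw [cb2]
      exact hθc.sub continuousOn_const
    · intro z hz
      exact (((hf z (Si_subset_S hz)).hasFDerivAt (mem_of_superset (isOpen_Si.mem_nhds hz)
        Si_subset_S)).sub_const _).sub ((db z).const_mul c)
    · intro z hz
      exact (hθi z hz).sub ((db1 z).const_smul c)
    · intro z hz
      simp [hfp z hz, e]
    · intro z hz
      simp only [hθp z hz, hb1, prodD]
      simp [e]
    · intro z hz
      have h1 : fderivWithin ℝ θ S (z + D.L • e 0) = fderivWithin ℝ θ S z := by
        have h2 : fderivWithin ℝ (fun y => θ (y + D.L • e 0)) S z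
            = fderivWithin ℝ θ (D.L • e 0 +ᵥ S) (z + D.L • e 0) := fderivWithin_comp_add_right _
        have h3 : D.L • e 0 +ᵥ S = S := by
          ext y
          rw [Set.mem_vadd_set_iff_neg_vadd_mem, vadd_eq_add]
          simp [S, e]
        rw [h3] at h2
        rw [← h2, fderivWithin_congr (fun y hy => hθp y hy) (hθp z hz)]
      rw [h1, cb2]
    · intro s
      simp [hfbot s, hβ]
    · intro s
      simp [hftop s, hβ, hc]
      norm_num
    · intro s
      simp [hθtop, hb1, prodD]
  have key2 : D.StreamMem θ (fderivWithin ℝ θ S) :=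
    (key.add (hB.smul c)).congr (fun z _ => sub_add_cancel _ _) (fun z _ => sub_add_cancel _ (c • b₂ z))
  obtain ⟨W, hW, e1, e2⟩ := key2
  rw [hθ, D.field_pullForm] at e1
  have e3 : W.snd =ᵐ[D.μ] D.grad w := by
    refine e2.trans ?_
    filter_upwards [ae_restrict_mem D.measurableSet_Ω] with x hx
    rw [← D.hasFDerivAt_field (hθi _ (D.Φ_mem_Si (D.Ω_subset_Ki hx))) hx, hθ, D.field_pullForm]
  rwa [D.eq_toH1 hw.continuousOn (D.continuousOn_grad hw1) e1 e3] at hW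

end Data

/-! ### Admissible fields, Green's formula and the weak form -/

namespace Data

variable (D : Data)

/-- Divergence-free periodic `C²` fields with the boundary conditions of `Ṽ`. -/
structure IsAdmissible (w : Plane → Plane) : Prop where
  contDiff : ContDiffOn ℝ 2 w D.K
  periodic : ∀ x ∈ D.K, w (x + D.L • e 0) = w x
  div_eq : ∀ x ∈ D.Ω, D.div w x = 0
  top : ∀ x ∈ D.Γ₁, w x = 0
  bottom : ∀ x ∈ D.Γ₀, inner ℝ (w x) n = 0

variable {D} in
lemma IsAdmissible.contDiff_one {w : Plane → Plane} (hw : D.IsAdmissible w) : ContDiffOn ℝ 1 w D.K :=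
  hw.contDiff.of_le (by norm_num)

variable {D} in
lemma IsAdmissible.toH1_mem {w : Plane → Plane} (hw : D.IsAdmissible w) :
    D.toH1 w (D.grad w) ∈ D.V :=
  D.toH1_mem_V hw.contDiff hw.periodic hw.div_eq hw.top hw.bottom

/-- An admissible field as an element of `V`. -/
def IsAdmissible.toV {D : Data} {w : Plane → Plane} (hw : D.IsAdmissible w) : D.V :=
  ⟨D.toH1 w (D.grad w), hw.toH1_mem⟩

lemma V_induction' {p : D.V → Prop} (hp : IsClosed {w | p w})
    (h : ∀ φ, ∀ hφ : φ ∈ D.Vtilde, p (D.ofVtilde hφ)) (w : D.V) : p w := by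
  obtain ⟨z, hz, hl⟩ := mem_closure_iff_seq_limit.1 (show (w : D.H1) ∈ closure (D.VtildeH1 : Set D.H1)
    from w.2)
  have hl' : Tendsto (fun n => (⟨z n, D.VtildeH1_le_V (hz n)⟩ : D.V)) atTop (𝓝 w) :=
    tendsto_subtype_rng.2 hl
  refine hp.mem_of_tendsto hl' (Eventually.of_forall fun n => ?_)
  obtain ⟨φ, hφ, h1, h2⟩ := hz n
  have h3 := D.eq_toH1 hφ.1.continuousOn (D.continuousOn_grad (D.Vtilde_contDiffOn hφ)) h1 h2
  have h4 : (⟨z n, D.VtildeH1_le_V (hz n)⟩ : D.V) = D.ofVtilde hφ := Subtype.ext h3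
  simpa [h4] using h φ hφ

lemma toL2_add {E : Type*} [NormedAddCommGroup E] [SecondCountableTopology E] {u v : Plane → E}
    (hu : ContinuousOn u D.K) (hv : ContinuousOn v D.K) :
    D.toL2 (fun x => u x + v x) = D.toL2 u + D.toL2 v :=
  Lp.ext ((D.coeFn_toL2 (hu.add hv)).trans
    (((D.coeFn_toL2 hu).add (D.coeFn_toL2 hv)).symm.trans (Lp.coeFn_add _ _).symm))

lemma toL2_smul {E : Type*} [NormedAddCommGroup E] [NormedSpace ℝ E] [SecondCountableTopology E]
    (c : ℝ) {u : Plane → E} (hu : ContinuousOn u D.K) : D.toL2 (fun x => c • u x) = c • D.toL2 u :=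
  Lp.ext ((D.coeFn_toL2 (hu.const_smul c)).trans
    (((D.coeFn_toL2 hu).const_smul c).symm.trans (Lp.coeFn_smul _ _).symm))

lemma toL2_congr {E : Type*} [NormedAddCommGroup E] [SecondCountableTopology E] {u v : Plane → E}
    (hu : ContinuousOn u D.K) (hv : ContinuousOn v D.K) (h : ∀ x ∈ D.Ω, u x = v x) :
    D.toL2 u = D.toL2 v := by
  refine Lp.ext ((D.coeFn_toL2 hu).trans (EventuallyEq.trans ?_ (D.coeFn_toL2 hv).symm))
  filter_upwards [ae_restrict_mem D.measurableSet_Ω] with x hx using h x hx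

lemma contDiff_ξ : ContDiff ℝ ∞ D.ξ :=
  (D.U_smooth.comp (coord 1).contDiff).smul contDiff_const

lemma pd_eq_fderiv {f : Plane → Plane} (hf : Differentiable ℝ f) (j : Fin 2) {x : Plane}
    (hx : x ∈ D.K) : D.pd j f x = fderiv ℝ f x (e j) := by
  rw [pd, (hf x).fderivWithin (D.uniqueDiffOn_K x hx)]

lemma pd_shear {g : ℝ → ℝ} (hg : Differentiable ℝ g) (j : Fin 2) {x : Plane} (hx : x ∈ D.K) :
    D.pd j (fun x => g (x 1) • e 0) x = (deriv g (x 1) * e j 1) • e 0 := by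
  have h1 : HasFDerivAt (fun y : Plane => y 1) (coord 1) x := (coord 1).hasFDerivAt
  have h2 : ∀ y : Plane, HasFDerivAt (fun y : Plane => g (y 1) • e 0) _ y := fun y =>
    ((hg (y 1)).hasDerivAt.comp_hasFDerivAt y (coord 1).hasFDerivAt).smul_const (e 0)
  rw [D.pd_eq_fderiv (fun y => (h2 y).differentiableAt) j hx, (h2 x).fderiv]
  simp

lemma pd_ξ (j : Fin 2) {x : Plane} (hx : x ∈ D.K) : D.pd j D.ξ x = (deriv D.U (x 1) * e j 1) • e 0 :=
  D.pd_shear (D.U_smooth.differentiable (by simp)) j hx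

lemma lap_ξ {x : Plane} (hx : x ∈ D.K) : D.lap D.ξ x = deriv (deriv D.U) (x 1) • e 0 := by
  have h1 : Differentiable ℝ (deriv D.U) :=
    (contDiff_infty_iff_deriv.1 D.U_smooth).2.differentiable (by simp)
  have h2 : D.pd 1 (D.pd 1 D.ξ) x = deriv (deriv D.U) (x 1) • e 0 := by
    rw [D.pd_congr 1 (g := fun x => deriv D.U (x 1) • e 0) (fun y hy => by simp [D.pd_ξ 1 hy]) hx,
      D.pd_shear h1 1 hx]
    simp
  have h3 : D.pd 0 (D.pd 0 D.ξ) x = 0 := by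
    have h4 := D.pd_shear (g := fun _ => 0) (by fun_prop) 0 hx
    rw [D.pd_congr 0 (g := fun _ => (0 : ℝ) • e 0) (fun y hy => by simp [D.pd_ξ 0 hy]) hx, h4]
    simp
  rw [lap, Fin.sum_univ_two, h2, h3, zero_add]

lemma continuousOn_conv {u v : Plane → Plane} (hu : ContinuousOn u D.K)
    (hv : ∀ j, ContinuousOn (D.pd j v) D.K) : ContinuousOn (D.conv u v) D.K := by
  unfold conv
  exact continuousOn_finsetSum _ fun j _ =>
    ((continuous_coord j).comp_continuousOn hu).smul (hv j)

lemma continuousOn_lap {u : Plane → Plane} (hu : ContDiffOn ℝ 2 u D.K) :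
    ContinuousOn (D.lap u) D.K := by
  unfold lap
  exact continuousOn_finsetSum _ fun j _ =>
    D.continuousOn_pd (D.contDiffOn_pd hu (m := 1) (by norm_num) j) j

lemma contDiffOn_ξ : ContDiffOn ℝ 2 D.ξ D.K :=
  (D.contDiff_ξ.of_le (WithTop.coe_le_coe.2 (le_top : (2 : ℕ∞) ≤ ⊤))).contDiffOn

lemma contDiffOn_ξ_one : ContDiffOn ℝ 1 D.ξ D.K := D.contDiffOn_ξ.of_le (by norm_num)

lemma pd_inner {f g : Plane → Plane} {x : Plane} (hx : x ∈ D.Ki) (hf : DifferentiableAt ℝ f x)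
    (hg : DifferentiableAt ℝ g x) (j : Fin 2) :
    D.pd j (fun y => inner ℝ (f y) (g y)) x
      = inner ℝ (D.pd j f x) (g x) + inner ℝ (f x) (D.pd j g x) := by
  rw [D.pd_eq _ _ hx, D.pd_eq _ _ hx, D.pd_eq _ _ hx, fderiv_inner_apply ℝ hf hg, add_comm]

lemma inner_grad (u φ : Plane → Plane) (x : Plane) :
    inner ℝ (D.grad u x) (D.grad φ x) = ∑ l, inner ℝ (D.pd l u x) (D.pd l φ x) := by
  simp only [inner_mat, grad_apply, inner_plane, Fin.sum_univ_two]
  ring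

/-- Green's formula. -/
lemma integral_inner_grad {u φ : Plane → Plane} (hu : ContDiffOn ℝ 2 u D.K)
    (hup : ∀ x ∈ D.K, u (x + D.L • e 0) = u x) (hφ : ContDiffOn ℝ 1 φ D.K)
    (hφp : ∀ x ∈ D.K, φ (x + D.L • e 0) = φ x) (htop : ∀ s, φ (pt s (D.h s)) = 0) :
    ∫ x in (D.Ω : Set Plane), inner ℝ (D.grad u x) (D.grad φ x)
      = -(∫ x in (D.Ω : Set Plane), inner ℝ (D.lap u x) (φ x))
        - ∫ s in 0..D.L, inner ℝ (D.pd 1 u (pt s 0)) (φ (pt s 0)) := by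
  have hpd : ∀ l, ContDiffOn ℝ 1 (D.pd l u) D.K := fun l => D.contDiffOn_pd hu (by norm_num) l
  have hpdc : ∀ l, ContinuousOn (D.pd l u) D.K := fun l => (hpd l).continuousOn
  -- The divergence theorem is applied to Q_l = ∂_l u · φ. The field φ vanishes on the top and the
  -- sides cancel, so only the bottom flux of Q₂ survives.
  set Q : Plane → Plane := fun x => pt (inner ℝ (D.pd 0 u x) (φ x)) (inner ℝ (D.pd 1 u x) (φ x))
    with hQ
  have hQd : ContDiffOn ℝ 1 Q D.K :=
    (((hpd 0).inner ℝ hφ).smul contDiffOn_const).add (((hpd 1).inner ℝ hφ).smul contDiffOn_const)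
  have hcont1 : ContinuousOn (fun x => inner ℝ (D.lap u x) (φ x)) D.K :=
    (D.continuousOn_lap hu).inner hφ.continuousOn
  have hcont2 : ContinuousOn (fun x => inner ℝ (D.grad u x) (D.grad φ x)) D.K :=
    (D.continuousOn_grad (hu.of_le (by norm_num))).inner (D.continuousOn_grad hφ)
  have h := D.integral_div (F := Q)
    (d := fun x => inner ℝ (D.lap u x) (φ x) + inner ℝ (D.grad u x) (D.grad φ x)) hQd.continuousOn
    (fun x hx => D.differentiableAt' hQd (D.Ω_subset_Ki hx)) (hcont1.add hcont2) ?_ ?_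
  · rw [integral_add (D.integrable hcont1) (D.integrable hcont2)] at h
    simp only [hQ, htop, inner_zero_right, pt_apply_one, pt_apply_zero, mul_zero, sub_zero,
      intervalIntegral.integral_zero, zero_sub] at h
    linarith
  · intro x hx
    have hx' := D.Ω_subset_Ki hx
    rw [inner_grad, lap, sum_inner, ← Finset.sum_add_distrib, div]
    refine Finset.sum_congr rfl fun l _ => ?_
    rw [D.pd_apply l l hx' (D.differentiableAt' hQd hx')]
    have hl : (fun y => Q y l) = fun y => inner ℝ (D.pd l u y) (φ y) := by
      fin_cases l <;> simp [hQ]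
    rw [hl, D.pd_inner hx' (D.differentiableAt' (hpd l) hx') (D.differentiableAt' hφ hx')]
  · intro y hy
    have hK : pt 0 (y * D.h 0) ∈ D.K := D.pt_mem_K hy
    have h1 : pt D.L (y * D.h D.L) = pt 0 (y * D.h 0) + D.L • e 0 := by
      rw [pt_add_smul, zero_add, ← D.h_periodic 0, zero_add]
    simp only [hQ, pt_apply_zero, h1, D.pd_periodic 0 hup hK, hφp _ hK]

/-- `f + (w · ∇) w + (ξ · ∇) w + (w · ∇) ξ`. -/
def resid (f w : Plane → Plane) (x : Plane) : Plane :=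
  f x + (D.conv w w x + (D.conv D.ξ w x + D.conv w D.ξ x))

/-- `ν ∇(w + ξ)`. -/
def visc (w : Plane → Plane) (x : Plane) : Mat := D.ν • D.grad w x + D.ν • D.grad D.ξ x

/-- `f - ν Δw + (w · ∇) w - G(w)`; with `f = w_t` this is the momentum balance without pressure. -/
def mom (f w : Plane → Plane) (x : Plane) : Plane :=
  f x - D.ν • D.lap w x + D.conv w w x - D.G w x

/-- The tangential stress `-ν ∂₂w₁ e₁` on `Γ₀`. -/
def shear (w : Plane → Plane) (x : Plane) : Plane := -(D.ν * D.pd 1 w x 0) • e 0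

section

variable {f w : Plane → Plane}

lemma continuousOn_resid (hf : ContinuousOn f D.K) (hw : ContDiffOn ℝ 1 w D.K) :
    ContinuousOn (D.resid f w) D.K :=
  hf.add ((D.continuousOn_conv hw.continuousOn (D.continuousOn_pd hw)).add
    ((D.continuousOn_conv D.contDiff_ξ.continuous.continuousOn (D.continuousOn_pd hw)).add
      (D.continuousOn_conv hw.continuousOn (D.continuousOn_pd D.contDiffOn_ξ_one))))

lemma continuousOn_visc (hw : ContDiffOn ℝ 1 w D.K) : ContinuousOn (D.visc w) D.K := by
  have h1 : ContinuousOn (fun x => D.ν • D.grad w x) D.K :=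
    (continuous_const_smul D.ν).comp_continuousOn (D.continuousOn_grad hw)
  have h2 : ContinuousOn (fun x => D.ν • D.grad D.ξ x) D.K :=
    (continuous_const_smul D.ν).comp_continuousOn (D.continuousOn_grad D.contDiffOn_ξ_one)
  exact h1.add h2

lemma continuousOn_shear (hw : ContDiffOn ℝ 1 w D.K) : ContinuousOn (D.shear w) D.K :=
  ((continuousOn_const.mul ((continuous_coord 0).comp_continuousOn (D.continuousOn_pd hw 1))).neg).smul
    continuousOn_const

/-- On `K` one has G(w) = -(ξ·∇)w - (w·∇)ξ + νΔξ, so `mom` is the strong form of the pair (`resid`,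
`visc`). -/
lemma mom_eq {x : Plane} (hx : x ∈ D.K) :
    D.mom f w x = D.resid f w x - D.ν • D.lap w x - D.ν • D.lap D.ξ x := by
  simp only [mom, resid, D.lap_ξ hx, G, conv, D.pd_ξ _ hx, Fin.sum_univ_two]
  simp [ξ]
  module

lemma continuousOn_mom (hf : ContinuousOn f D.K) (hw : ContDiffOn ℝ 2 w D.K) :
    ContinuousOn (D.mom f w) D.K :=
  (((D.continuousOn_resid hf (hw.of_le (by norm_num))).sub
    ((D.continuousOn_lap hw).const_smul D.ν)).sub
      ((D.continuousOn_lap D.contDiffOn_ξ).const_smul D.ν)).congr fun _ hx => D.mom_eq hx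

/-- The terms of the variational inequality without the friction functional. -/
lemma weak_form_eq (hf : ContinuousOn f D.K) (hw : ContDiffOn ℝ 1 w D.K) {W : D.V}
    (hW : (W : D.H1) = D.toH1 w (D.grad w)) (Z : D.V) :
    inner ℝ (D.toL2 f) (Z : D.H1).fst + D.ν * D.a (D.dfld W) (D.dfld Z)
        + D.b (D.fld W) (D.dfld W) (D.fld Z) - D.ℒ W Z
      = inner ℝ (D.toH1 (D.resid f w) (D.visc w)) (Z : D.H1) := by
  have hξ := D.contDiffOn_ξ_one
  have hξc := D.contDiff_ξ.continuous.continuousOn (s := D.K)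
  have hpd := D.continuousOn_pd hw
  have hpdξ := D.continuousOn_pd hξ
  have h1 : D.fld W =ᵐ[D.μ] w := by rw [fld, hW]; exact D.coeFn_toL2 hw.continuousOn
  have h2 : D.dfld W =ᵐ[D.μ] D.grad w := by rw [dfld, hW]; exact D.coeFn_toL2 (D.continuousOn_grad hw)
  have hZ : (Z : D.H1).fst =ᵐ[D.μ] D.fld Z := EventuallyEq.rfl
  have hZ' : (Z : D.H1).snd =ᵐ[D.μ] D.dfld Z := EventuallyEq.rfl
  have c1 := D.continuousOn_conv hw.continuousOn hpd
  have c2 := D.continuousOn_conv hξc hpd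
  have c3 := D.continuousOn_conv hw.continuousOn hpdξ
  have e1 : D.a (D.dfld W) (D.dfld Z) = inner ℝ (D.toL2 (D.grad w)) (Z : D.H1).snd :=
    (D.a_congr h2 EventuallyEq.rfl).trans
      (D.a_eq_inner (D.coeFn_toL2 (D.continuousOn_grad hw)) hZ')
  have e2 : D.a (D.grad D.ξ) (D.dfld Z) = inner ℝ (D.toL2 (D.grad D.ξ)) (Z : D.H1).snd :=
    D.a_eq_inner (D.coeFn_toL2 (D.continuousOn_grad hξ)) hZ'
  have eb : ∀ {u v : Plane → Plane}, ContinuousOn (D.conv u v) D.K →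
      D.b u (D.grad v) (D.fld Z) = inner ℝ (D.toL2 (D.conv u v)) (Z : D.H1).fst := fun hc =>
    D.b_eq_inner ((D.coeFn_toL2 hc).trans (Eventually.of_forall fun x => D.conv_eq _ _ x)) hZ
  rw [ℒ, e1, e2, D.b_congr h1 h2 EventuallyEq.rfl, D.b_congr EventuallyEq.rfl h2 EventuallyEq.rfl,
    D.b_congr h1 EventuallyEq.rfl EventuallyEq.rfl, eb c1, eb c2, eb c3, H1_inner, toH1_fst, toH1_snd]
  have r1 : D.toL2 (D.resid f w) = D.toL2 f + (D.toL2 (D.conv w w) + (D.toL2 (D.conv D.ξ w)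
      + D.toL2 (D.conv w D.ξ))) := by
    rw [← D.toL2_add c2 c3]
    have h3 := D.toL2_add c1 (c2.add c3)
    simp only [Pi.add_apply] at h3
    refine (D.toL2_add hf (c1.add (c2.add c3))).trans ?_
    exact congrArg _ h3
  have r2 : D.toL2 (D.visc w) = D.ν • D.toL2 (D.grad w) + D.ν • D.toL2 (D.grad D.ξ) := by
    rw [← D.toL2_smul _ (D.continuousOn_grad hw), ← D.toL2_smul _ (D.continuousOn_grad hξ),
      ← D.toL2_add (u := fun x => D.ν • D.grad w x) (v := fun x => D.ν • D.grad D.ξ x)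
        ((continuous_const_smul D.ν).comp_continuousOn (D.continuousOn_grad hw))
        ((continuous_const_smul D.ν).comp_continuousOn (D.continuousOn_grad hξ))]
    rfl
  rw [r1, r2]
  simp only [inner_add_left, real_inner_smul_left]
  ring

lemma inner_bot {u v : Plane → Plane} (hu : ContinuousOn u D.K) (hv : ContinuousOn v D.K) :
    inner ℝ (D.bot u) (D.bot v) = ∫ s in 0..D.L, inner ℝ (u (pt s 0)) (v (pt s 0)) := by
  rw [L2_inner_eq (D.coeFn_bot hu) (D.coeFn_bot hv), D.integral_Γ]

/-- The weak form in terms of the strong momentum balance and the tangential stress. -/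
lemma inner_resid_visc (hf : ContinuousOn f D.K) (hw : ContDiffOn ℝ 2 w D.K)
    (hp : ∀ x ∈ D.K, w (x + D.L • e 0) = w x) (Z : D.V) :
    inner ℝ (D.toH1 (D.resid f w) (D.visc w)) (Z : D.H1)
      = inner ℝ (D.toL2 (D.mom f w)) (Z : D.H1).fst + inner ℝ (D.bot (D.shear w)) (D.tr Z) := by
  have hw1 : ContDiffOn ℝ 1 w D.K := hw.of_le (by norm_num)
  have hξ := D.contDiffOn_ξ_one
  have hc : Continuous fun Z : D.V => (Z : D.H1).fst :=
    (WithLp.prod_continuous_ofLp 2 _ _).fst.comp continuous_subtype_val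
  revert Z
  -- Both sides are continuous in Z, so Z may be taken in Ṽ, where the trace is the restriction.
  refine fun Z => D.V_induction' (p := fun Z : D.V => inner ℝ (D.toH1 (D.resid f w) (D.visc w)) (Z : D.H1)
      = inner ℝ (D.toL2 (D.mom f w)) (Z : D.H1).fst + inner ℝ (D.bot (D.shear w)) (D.tr Z)) ?_ ?_ Z
  · refine isClosed_eq (continuous_const.inner continuous_subtype_val) ?_
    exact (continuous_const.inner hc).add (continuous_const.inner D.tr.continuous)
  intro φ hφ
  have hφ1 := D.Vtilde_contDiffOn hφ
  have hφc := hφ.1.continuousOn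
  have htop := D.top_eq_zero_of_Γ₁ hφc hφ.2.1 hφ.2.2.2.1
  have hbot := D.bottom_eq_zero_of_Γ₀ hφc hφ.2.1 hφ.2.2.2.2
  have g1 := D.integral_inner_grad hw hp hφ1 hφ.2.1 htop
  have g2 := D.integral_inner_grad D.contDiffOn_ξ (fun x _ => by simp [ξ, e]) hφ1 hφ.2.1 htop
  have cr := D.continuousOn_resid hf hw1
  have cl := D.continuousOn_lap hw
  have clξ := D.continuousOn_lap D.contDiffOn_ξ
  have i1 := D.integrable (cr.inner (𝕜 := ℝ) hφc)
  have i2 := D.integrable (cl.inner (𝕜 := ℝ) hφc)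
  have i3 := D.integrable (clξ.inner (𝕜 := ℝ) hφc)
  have i4 := D.integrable ((D.continuousOn_grad hw1).inner (𝕜 := ℝ) (D.continuousOn_grad hφ1))
  have i5 := D.integrable ((D.continuousOn_grad hξ).inner (𝕜 := ℝ) (D.continuousOn_grad hφ1))
  have t1 : D.tr (D.ofVtilde hφ) = D.bot φ := by rw [tr_apply, trace_ofVtilde]
  have t2 : ((D.ofVtilde hφ : D.V) : D.H1) = D.toH1 φ (D.grad φ) := rfl
  rw [t1, t2, H1_inner, toH1_fst, toH1_snd, toH1_fst, toH1_snd,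
    D.inner_bot (D.continuousOn_shear hw1) hφc,
    L2_inner_eq (D.coeFn_toL2 cr) (D.coeFn_toL2 hφc),
    L2_inner_eq (D.coeFn_toL2 (D.continuousOn_visc hw1)) (D.coeFn_toL2 (D.continuousOn_grad hφ1)),
    L2_inner_eq (D.coeFn_toL2 (D.continuousOn_mom hf hw)) (D.coeFn_toL2 hφc)]
  have s1 : ∫ x in (D.Ω : Set Plane), inner ℝ (D.visc w x) (D.grad φ x)
      = D.ν * (∫ x in (D.Ω : Set Plane), inner ℝ (D.grad w x) (D.grad φ x))
        + D.ν * ∫ x in (D.Ω : Set Plane), inner ℝ (D.grad D.ξ x) (D.grad φ x) := by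
    rw [← integral_const_mul, ← integral_const_mul, ← integral_add (i4.const_mul _) (i5.const_mul _)]
    simp only [visc, inner_add_left, real_inner_smul_left]
  have s2 : ∫ x in (D.Ω : Set Plane), inner ℝ (D.mom f w x) (φ x)
      = (∫ x in (D.Ω : Set Plane), inner ℝ (D.resid f w x) (φ x))
        - D.ν * (∫ x in (D.Ω : Set Plane), inner ℝ (D.lap w x) (φ x))
        - D.ν * ∫ x in (D.Ω : Set Plane), inner ℝ (D.lap D.ξ x) (φ x) := by
    have h3 := integral_sub i1 (i2.const_mul D.ν)
    have h4 := integral_sub (i1.sub (i2.const_mul D.ν)) (i3.const_mul D.ν)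
    simp only [Pi.sub_apply] at h4
    rw [h3, integral_const_mul, integral_const_mul] at h4
    rw [← h4]
    refine setIntegral_congr_fun D.measurableSet_Ω fun x hx => ?_
    simp only [D.mom_eq (D.Ω_subset_K hx), inner_sub_left, real_inner_smul_left]
  -- φ₂ = 0 on the bottom, so only the tangential component of ∂₂w is seen.
  have s3 : ∫ s in 0..D.L, inner ℝ (D.shear w (pt s 0)) (φ (pt s 0))
      = -(D.ν * ∫ s in 0..D.L, inner ℝ (D.pd 1 w (pt s 0)) (φ (pt s 0))) := by
    rw [← intervalIntegral.integral_const_mul, ← intervalIntegral.integral_neg]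
    refine intervalIntegral.integral_congr fun s _ => ?_
    simp only [inner_plane, hbot, shear]
    simp [e]
    ring
  -- The background flow exerts no shear on Γ₀ because U'(0) = 0.
  have s4 : ∫ s in 0..D.L, inner ℝ (D.pd 1 D.ξ (pt s 0)) (φ (pt s 0)) = 0 := by
    refine (intervalIntegral.integral_congr fun s _ => ?_).trans intervalIntegral.integral_zero
    simp [D.pd_ξ 1 (D.pt_bot_mem_K s), D.U_deriv_bottom]
  rw [s1, s2, s3, g1, g2, s4]
  ring

end

end Data

/-! ### Du Bois-Reymond lemmas -/

lemma contDiff_primitive {γ : ℝ → ℝ} (hγ : ContDiff ℝ ∞ γ) (a : ℝ) :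
    ContDiff ℝ ∞ (fun x => ∫ s in a..x, γ s) ∧ deriv (fun x => ∫ s in a..x, γ s) = γ := by
  have h : ∀ x, HasDerivAt (fun x => ∫ s in a..x, γ s) (γ x) x := fun x =>
    intervalIntegral.integral_hasDerivAt_right (hγ.continuous.intervalIntegrable _ _)
      (hγ.continuous.stronglyMeasurableAtFilter _ _) hγ.continuous.continuousAt
  have h2 : deriv (fun x => ∫ s in a..x, γ s) = γ := funext fun x => (h x).deriv
  exact ⟨contDiff_infty_iff_deriv.2 ⟨fun x => (h x).differentiableAt, by rwa [h2]⟩, h2⟩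

/-- The fundamental lemma of the calculus of variations for a continuous function. -/
lemma eq_zero_of_integral_smooth_mul {g : ℝ → ℝ} (hg : Continuous g) {a b : ℝ} (hab : a < b)
    (h : ∀ ψ : ℝ → ℝ, ContDiff ℝ ∞ ψ → tsupport ψ ⊆ Ioo a b → ∫ y in a..b, ψ y * g y = 0) :
    ∀ y ∈ Icc a b, g y = 0 := by
  have h1 := isOpen_Ioo.ae_eq_zero_of_integral_contDiff_smul_eq_zero (U := Ioo a b)
    (μ := volume) (hg.locallyIntegrable.locallyIntegrableOn _) fun ψ hψ _ hs => by
      rw [← h ψ hψ hs, intervalIntegral.integral_of_le hab.le, setIntegral_eq_integral_of_forall_compl_eq_zero]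
      · rfl
      · intro y hy
        rw [image_eq_zero_of_notMem_tsupport fun hy' => hy (Ioo_subset_Ioc_self (hs hy')), zero_mul]
  have h2 : EqOn g (fun _ => 0) (Ioo a b) :=
    Measure.eqOn_open_of_ae_eq (μ := volume) ((ae_restrict_iff' measurableSet_Ioo).2 h1) isOpen_Ioo
      hg.continuousOn continuousOn_const
  have h3 := h2.closure hg continuous_const
  rwa [closure_Ioo hab.ne] at h3

/-- The du Bois-Reymond lemma on `[0, 1]`. -/
lemma eq_of_integral_deriv_mul {f g : ℝ → ℝ} (hf : Continuous f) (hg : Continuous g)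
    (h : ∀ β : ℝ → ℝ, ContDiff ℝ ∞ β → β 0 = 0 → β 1 = 0 → deriv β 0 = 0 → deriv β 1 = 0 →
      ∫ y in (0 : ℝ)..1, (deriv β y * f y - β y * g y) = 0) :
    ∀ y ∈ Icc (0 : ℝ) 1, f y + ∫ η in (0 : ℝ)..y, g η = f 0 := by
  set G : ℝ → ℝ := fun y => ∫ η in (0 : ℝ)..y, g η with hG
  have hGd : ∀ y, HasDerivAt G (g y) y := fun y =>
    intervalIntegral.integral_hasDerivAt_right (hg.intervalIntegrable _ _)
      (hg.stronglyMeasurableAtFilter _ _) hg.continuousAt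
  have hGc : Continuous G := continuous_iff_continuousAt.2 fun y => (hGd y).continuousAt
  -- A γ with zero mean and zero end values is the derivative of an admissible β. Integrating the
  -- term β g by parts makes f + G orthogonal to every such γ.
  have h1 : ∀ γ : ℝ → ℝ, ContDiff ℝ ∞ γ → γ 0 = 0 → γ 1 = 0 → ∫ y in (0 : ℝ)..1, γ y = 0 →
      ∫ y in (0 : ℝ)..1, γ y * (f y + G y) = 0 := by
    intro γ hγ h0 h1 hm
    obtain ⟨hβ, hβd⟩ := contDiff_primitive hγ 0
    have h2 := h _ hβ (by simp) hm (by rw [hβd, h0]) (by rw [hβd, h1])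
    simp only [hβd] at h2
    set β : ℝ → ℝ := fun x => ∫ s in (0 : ℝ)..x, γ s with hβdef
    have h3 := intervalIntegral.integral_mul_deriv_eq_deriv_mul (a := 0) (b := 1) (u := β) (u' := γ)
      (v := G) (v' := g) (fun x _ => by
        have := (hβ.differentiable (by simp) x).hasDerivAt
        rwa [hβd] at this) (fun x _ => hGd x)
      (hγ.continuous.intervalIntegrable _ _) (hg.intervalIntegrable _ _)
    have hβ0 : β 0 = 0 := by simp [hβdef]
    rw [show β 1 = 0 from hm, hβ0, zero_mul, zero_mul, sub_self, zero_sub] at h3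
    rw [intervalIntegral.integral_sub ((hγ.continuous.fun_mul hf).intervalIntegrable _ _)
      ((hβ.continuous.fun_mul hg).intervalIntegrable _ _), h3, sub_neg_eq_add] at h2
    rw [← intervalIntegral.integral_add ((hγ.continuous.fun_mul hf).intervalIntegrable _ _)
      ((hγ.continuous.fun_mul hGc).intervalIntegrable _ _)] at h2
    simpa only [mul_add] using h2
  -- ρ has integral 1 and vanishes at both ends. Subtracting a multiple of it gives any test
  -- function zero mean, which shows that f + G equals its ρ-weighted mean.
  set ρ : ℝ → ℝ := fun y => 6 * (y * (1 - y)) with hρ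
  have hρs : ContDiff ℝ ∞ ρ := by fun_prop
  have hρi : ∫ y in (0 : ℝ)..1, ρ y = 1 := by
    have : ∀ y ∈ uIcc (0 : ℝ) 1, HasDerivAt (fun y : ℝ => 3 * y ^ 2 - 2 * y ^ 3) (ρ y) y := fun y _ => by
      refine (((hasDerivAt_pow 2 y).const_mul 3).sub ((hasDerivAt_pow 3 y).const_mul 2)).congr_deriv ?_
      simp [hρ]
      ring
    rw [intervalIntegral.integral_eq_sub_of_hasDerivAt this (hρs.continuous.intervalIntegrable _ _)]
    norm_num
  set m := ∫ y in (0 : ℝ)..1, ρ y * (f y + G y) with hm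
  have hc : Continuous fun y => f y + G y := hf.fun_add hGc
  have h2 := eq_zero_of_integral_smooth_mul (g := fun y => f y + G y - m) (hc.sub continuous_const)
    zero_lt_one fun ψ hψ hs => by
      have hz : ∀ y, y ∉ Ioo (0 : ℝ) 1 → ψ y = 0 := fun y hy =>
        image_eq_zero_of_notMem_tsupport fun hy' => hy (hs hy')
      set M := ∫ y in (0 : ℝ)..1, ψ y with hM
      have h3 := h1 (fun y => ψ y - M * ρ y) (hψ.sub (contDiff_const.mul hρs))
        (by simp [hz 0, hρ]) (by simp [hz 1, hρ]) (by
          rw [intervalIntegral.integral_sub (hψ.continuous.intervalIntegrable _ _)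
            ((continuous_const.fun_mul hρs.continuous).intervalIntegrable _ _),
            intervalIntegral.integral_const_mul, hρi]
          simp [hM])
      simp only [sub_mul, mul_assoc] at h3
      rw [intervalIntegral.integral_sub ((hψ.continuous.fun_mul hc).intervalIntegrable _ _)
        ((continuous_const.fun_mul (hρs.continuous.fun_mul hc)).intervalIntegrable _ _),
        intervalIntegral.integral_const_mul, ← hm] at h3
      simp only [mul_sub]
      rw [intervalIntegral.integral_sub ((hψ.continuous.fun_mul hc).intervalIntegrable _ _)
        ((hψ.continuous.fun_mul continuous_const).intervalIntegrable _ _),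
        intervalIntegral.integral_mul_const]
      exact h3
  intro y hy
  have h4 := h2 y hy
  have h5 := h2 0 (by simp)
  simp only [hG, intervalIntegral.integral_same, add_zero] at h4 h5 ⊢
  linarith

namespace Data

variable (D : Data)

lemma contDiff_kern : ContDiff ℝ ∞ D.kern := by
  unfold kern
  exact ((contDiff_const.mul contDiff_id).div_const _).cos.pow _

/-- A continuous periodic function which integrates to zero against derivatives of smooth periodic
functions is constant. -/
lemma eq_of_integral_deriv_mul_periodic {g : ℝ → ℝ} (hg : Continuous g) (hp : ∀ s, g (s + D.L) = g s)
    (h : ∀ α : ℝ → ℝ, ContDiff ℝ ∞ α → (∀ s, α (s + D.L) = α s) →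
      ∫ x in 0..D.L, deriv α x * g x = 0) (x y : ℝ) : g x = g y := by
  set G : Plane → ℝ := fun z => g (z 0) with hG
  have hGc : ContinuousOn G S := (hg.comp (continuous_coord 0)).continuousOn
  have hGp : ∀ z ∈ S, G (z + D.L • e 0) = G z := fun z _ => by simp [hG, e, hp]
  have hS : ∀ x, pt x 0 ∈ S := fun x => by simp [S]
  have kint : ∀ n x, ∫ t in (0 : ℝ)..D.L, D.kern (x - t) ^ n
      = ∫ s in (-(D.L / 2))..(D.L / 2), D.kern s ^ n := fun n x => by
    have := D.integral_kern_translate (G := fun _ => 1) (fun _ _ => rfl) n (hS x)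
    simpa using this.symm
  have ks : ∀ n x, ContDiff ℝ ∞ fun t => D.kern (x - t) ^ n := fun n x =>
    (D.contDiff_kern.comp (contDiff_const.sub contDiff_id)).pow n
  -- The difference of two translates of the kernel has zero mean over a period, so its primitive is
  -- an admissible periodic α. Hence g has equal averages about x and about y, and n → ∞ compares
  -- the values.
  have key : ∀ n, D.avg n G (pt x 0) = D.avg n G (pt y 0) := by
    intro n
    rw [avg, avg, D.integral_kern_translate hGp n (hS x), D.integral_kern_translate hGp n (hS y)]
    simp only [hG, pt_apply_zero]
    congr 1
    obtain ⟨hα, hαd⟩ := contDiff_primitive ((ks n x).sub (ks n y)) 0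
    have hper : ∀ s, ∫ t in (0 : ℝ)..(s + D.L), (D.kern (x - t) ^ n - D.kern (y - t) ^ n)
        = ∫ t in (0 : ℝ)..s, (D.kern (x - t) ^ n - D.kern (y - t) ^ n) := by
      intro s
      have hc := ((ks n x).sub (ks n y)).continuous
      have hper : Function.Periodic (fun t => D.kern (x - t) ^ n - D.kern (y - t) ^ n) D.L := by
        intro t
        have : ∀ u, D.kern (u - (t + D.L)) = D.kern (u - t) := fun u => by
          rw [← D.kern_add (u - (t + D.L))]
          congr 1
          ring
        simp only [this]
      rw [← intervalIntegral.integral_add_adjacent_intervals (hc.intervalIntegrable 0 s)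
        (hc.intervalIntegrable s (s + D.L)), hper.intervalIntegral_add_eq s 0, zero_add,
        intervalIntegral.integral_sub ((ks n x).continuous.intervalIntegrable 0 D.L)
          ((ks n y).continuous.intervalIntegrable 0 D.L), kint, kint]
      simp
    have h2 := h _ hα hper
    simp only [hαd, sub_mul] at h2
    rw [intervalIntegral.integral_sub (((ks n x).continuous.fun_mul hg).intervalIntegrable _ _)
      (((ks n y).continuous.fun_mul hg).intervalIntegrable _ _)] at h2
    exact sub_eq_zero.1 h2
  have h1 := D.tendsto_avg hGc (hS x)
  have h2 := D.tendsto_avg hGc (hS y)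
  simp only [key] at h1
  simpa [hG] using tendsto_nhds_unique h1 h2

/-- The periodic du Bois-Reymond lemma. -/
lemma eq_integral_of_integral_deriv_mul {f g : ℝ → ℝ} (hf : Continuous f) (hg : Continuous g)
    (hfp : ∀ s, f (s + D.L) = f s) (hgp : ∀ s, g (s + D.L) = g s)
    (h : ∀ α : ℝ → ℝ, ContDiff ℝ ∞ α → (∀ s, α (s + D.L) = α s) →
      ∫ x in 0..D.L, (α x * f x + deriv α x * g x) = 0) (x : ℝ) :
    g x - g 0 = ∫ s in (0 : ℝ)..x, f s := by
  set F : ℝ → ℝ := fun x => ∫ s in (0 : ℝ)..x, f s with hF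
  have hFd : ∀ x, HasDerivAt F (f x) x := fun x =>
    intervalIntegral.integral_hasDerivAt_right (hf.intervalIntegrable _ _)
      (hf.stronglyMeasurableAtFilter _ _) hf.continuousAt
  have hFc : Continuous F := continuous_iff_continuousAt.2 fun x => (hFd x).continuousAt
  -- Testing with α = 1 gives f zero mean, so its primitive is periodic and g - F falls under the
  -- previous lemma.
  have hFL : F D.L = 0 := by
    have := h (fun _ => 1) contDiff_const fun _ => rfl
    simpa using this
  have hFp : ∀ s, F (s + D.L) = F s := fun s => by
    have hper : Function.Periodic f D.L := hfp
    have h2 := hper.intervalIntegral_add_eq s 0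
    rw [zero_add] at h2
    simp only [hF]
    rw [← intervalIntegral.integral_add_adjacent_intervals (hf.intervalIntegrable 0 s)
      (hf.intervalIntegrable s (s + D.L)), h2]
    simp only [hF] at hFL
    rw [hFL, add_zero]
  have h1 := D.eq_of_integral_deriv_mul_periodic (g := fun x => g x - F x) (hg.sub hFc)
    (fun s => by simp only [hgp, hFp]) (fun α hα hαp => by
      have hα' := (contDiff_infty_iff_deriv.1 hα).2
      have h2 := h α hα hαp
      have h3 := intervalIntegral.integral_mul_deriv_eq_deriv_mul (a := 0) (b := D.L) (u := α)
        (u' := deriv α) (v := F) (v' := f) (fun x _ => (hα.differentiable (by simp) x).hasDerivAt)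
        (fun x _ => hFd x) (hα'.continuous.intervalIntegrable _ _) (hf.intervalIntegrable _ _)
      have hF0 : F 0 = 0 := by simp [hF]
      rw [hFL, hF0] at h3
      rw [intervalIntegral.integral_add ((hα.continuous.fun_mul hf).intervalIntegrable _ _)
        ((hα'.continuous.fun_mul hg).intervalIntegrable _ _), h3] at h2
      simp only [mul_sub]
      rw [intervalIntegral.integral_sub ((hα'.continuous.fun_mul hg).intervalIntegrable _ _)
        ((hα'.continuous.fun_mul hFc).intervalIntegrable _ _)]
      linarith) x 0
  have hF0 : F 0 = 0 := by simp [hF]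
  simp only [hF0] at h1
  change g x - g 0 = F x
  linarith

end Data

/-! ### Fields orthogonal to solenoidal fields are gradients -/

namespace Data

variable (D : Data)

lemma intervalIntegral_swap {f : ℝ → ℝ → ℝ} (hf : Continuous fun p : ℝ × ℝ => f p.1 p.2)
    (a b c d : ℝ) : ∫ x in a..b, ∫ y in c..d, f x y = ∫ y in c..d, ∫ x in a..b, f x y := by
  refine intervalIntegral_intervalIntegral_swap ?_
  have h1 : IntegrableOn (Function.uncurry f) (uIcc a b ×ˢ uIcc c d) :=
    (Continuous.continuousOn hf).integrableOn_compact (isCompact_uIcc.prod isCompact_uIcc)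
  exact h1.mono_set (prod_mono uIoc_subset_uIcc uIoc_subset_uIcc)

/-- The line integral of a form with the two components `A, B`, whose integrals over rectangles
match, is a primitive of the form. -/
lemma hasFDerivWithinAt_primitive {A B : ℝ → ℝ → ℝ} (hA : Continuous fun p : ℝ × ℝ => A p.1 p.2)
    (hB : Continuous fun p : ℝ × ℝ => B p.1 p.2)
    (hAB : ∀ y ∈ Icc (0 : ℝ) 1, ∀ x, (∫ η in (0 : ℝ)..y, B x η) - ∫ η in (0 : ℝ)..y, B 0 η
      = ∫ s in (0 : ℝ)..x, (A s y - A s 0)) :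
    (∀ y ∈ Icc (0 : ℝ) 1, ∀ x x', (∫ s in (0 : ℝ)..x', A s 0) + (∫ η in (0 : ℝ)..y, B x' η)
        - ((∫ s in (0 : ℝ)..x, A s 0) + ∫ η in (0 : ℝ)..y, B x η) = ∫ s in x..x', A s y) ∧
    ∀ z ∈ S, HasFDerivWithinAt
      (fun z : Plane => (∫ s in (0 : ℝ)..(z 0), A s 0) + ∫ η in (0 : ℝ)..(z 1), B (z 0) η)
      (A (z 0) (z 1) • coord 0 + B (z 0) (z 1) • coord 1) S z := by
  have cA : ∀ y, Continuous fun x => A x y := fun y => hA.comp (by fun_prop : Continuous fun x => (x, y))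
  have cB : ∀ x, Continuous fun y => B x y := fun x => hB.comp (by fun_prop : Continuous fun y => (x, y))
  have iA : ∀ y a b, IntervalIntegrable (fun x => A x y) volume a b := fun y a b =>
    (cA y).intervalIntegrable a b
  have iB : ∀ x a b, IntervalIntegrable (fun y => B x y) volume a b := fun x a b =>
    (cB x).intervalIntegrable a b
  -- The rectangle condition lets horizontal increments be computed at any height y, although the
  -- primitive is defined by integrating along height 0.
  have hx : ∀ y ∈ Icc (0 : ℝ) 1, ∀ x x', (∫ s in (0 : ℝ)..x', A s 0) + (∫ η in (0 : ℝ)..y, B x' η)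
      - ((∫ s in (0 : ℝ)..x, A s 0) + ∫ η in (0 : ℝ)..y, B x η) = ∫ s in x..x', A s y := by
    intro y hy x x'
    have h1 := hAB y hy x
    have h2 := hAB y hy x'
    rw [intervalIntegral.integral_sub (iA y _ _) (iA 0 _ _)] at h1 h2
    rw [← intervalIntegral.integral_interval_sub_left (iA y 0 x') (iA y 0 x)]
    linarith
  refine ⟨hx, fun z hz => ?_⟩
  refine HasFDerivWithinAt.of_isLittleO ?_
  rw [Asymptotics.isLittleO_iff]
  intro ε hε
  have hδA := Metric.continuousAt_iff.1 (hA.continuousAt (x := (z 0, z 1))) (ε / 2) (by positivity)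
  have hδB := Metric.continuousAt_iff.1 (hB.continuousAt (x := (z 0, z 1))) (ε / 2) (by positivity)
  obtain ⟨δ₁, hδ₁, h1⟩ := hδA
  obtain ⟨δ₂, hδ₂, h2⟩ := hδB
  have hball : ∀ᶠ x' in 𝓝[S] z, dist x' z < min δ₁ δ₂ :=
    nhdsWithin_le_nhds (Metric.ball_mem_nhds z (lt_min hδ₁ hδ₂))
  filter_upwards [hball, self_mem_nhdsWithin] with x' hd hx'
  have hc : ∀ i, |x' i - z i| ≤ ‖x' - z‖ := fun i => by
    have := PiLp.norm_apply_le (x' - z) i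
    simpa using this
  rw [dist_eq_norm] at hd
  have hd0 : |x' 0 - z 0| < min δ₁ δ₂ := (hc 0).trans_lt hd
  have hd1 : |x' 1 - z 1| < min δ₁ δ₂ := (hc 1).trans_lt hd
  -- The path goes from z horizontally at height `z 1`, then vertically to x'. On each piece the
  -- integrand is within ε/2 of its value at z.
  have e1 := hx (z 1) hz (z 0) (x' 0)
  have e2 := intervalIntegral.integral_interval_sub_left (iB (x' 0) 0 (x' 1)) (iB (x' 0) 0 (z 1))
  have close : ∀ {p q s : ℝ}, s ∈ uIoc p q → |s - p| ≤ |q - p| := fun hs => by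
    have := abs_sub_left_of_mem_uIcc (uIoc_subset_uIcc hs)
    exact this
  have b1 : ‖∫ s in (z 0)..(x' 0), (A s (z 1) - A (z 0) (z 1))‖ ≤ ε / 2 * |x' 0 - z 0| := by
    refine intervalIntegral.norm_integral_le_of_norm_le_const fun s hs => ?_
    refine (h1 (x := (s, z 1)) ?_).le
    rw [Prod.dist_eq, dist_self, max_eq_left dist_nonneg, Real.dist_eq]
    exact (close hs).trans_lt (hd0.trans_le (min_le_left _ _))
  have b2 : ‖∫ η in (z 1)..(x' 1), (B (x' 0) η - B (z 0) (z 1))‖ ≤ ε / 2 * |x' 1 - z 1| := by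
    refine intervalIntegral.norm_integral_le_of_norm_le_const fun s hs => ?_
    refine (h2 (x := (x' 0, s)) ?_).le
    rw [Prod.dist_eq, Real.dist_eq, Real.dist_eq, max_lt_iff]
    exact ⟨hd0.trans_le (min_le_right _ _), (close hs).trans_lt (hd1.trans_le (min_le_right _ _))⟩
  rw [intervalIntegral.integral_sub (iA _ _ _) (by simp), intervalIntegral.integral_const] at b1
  rw [intervalIntegral.integral_sub (iB _ _ _) (by simp), intervalIntegral.integral_const] at b2
  have e3 : (∫ s in (0 : ℝ)..(x' 0), A s 0) + (∫ η in (0 : ℝ)..(x' 1), B (x' 0) η)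
      - ((∫ s in (0 : ℝ)..(z 0), A s 0) + ∫ η in (0 : ℝ)..(z 1), B (z 0) η)
      - (A (z 0) (z 1) • coord 0 + B (z 0) (z 1) • coord 1) (x' - z)
      = ((∫ s in (z 0)..(x' 0), A s (z 1)) - (x' 0 - z 0) • A (z 0) (z 1))
        + ((∫ η in (z 1)..(x' 1), B (x' 0) η) - (x' 1 - z 1) • B (z 0) (z 1)) := by
    rw [← e1, ← e2]
    simp
    ring
  rw [e3]
  refine (norm_add_le _ _).trans ((add_le_add b1 b2).trans ?_)
  have := hc 0
  have := hc 1
  nlinarith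

/-- The first component of the pull-back of the form `F₁ dx₁ + F₂ dx₂` to the straight strip (constant
in `y` outside `[0, 1]`). -/
def pullA (F : Plane → Plane) (x y : ℝ) : ℝ :=
  F (pt x (max 0 (min 1 y) * D.h x)) 0
    + max 0 (min 1 y) * deriv D.h x * F (pt x (max 0 (min 1 y) * D.h x)) 1

/-- The second component of the pull-back of `F₁ dx₁ + F₂ dx₂`. -/
def pullB (F : Plane → Plane) (x y : ℝ) : ℝ := D.h x * F (pt x (max 0 (min 1 y) * D.h x)) 1

variable {F : Plane → Plane}

lemma continuous_pull (hF : ContinuousOn F D.K) :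
    (Continuous fun p : ℝ × ℝ => D.pullA F p.1 p.2) ∧ Continuous fun p : ℝ × ℝ => D.pullB F p.1 p.2 := by
  have h1 := D.h_continuous
  have h2 := D.h_deriv_continuous
  have h3 : Continuous fun p : ℝ × ℝ => F (pt p.1 (max 0 (min 1 p.2) * D.h p.1)) :=
    hF.comp_continuous (by fun_prop) fun p => D.pt_mem_K (by simp)
  have h4 : ∀ i, Continuous fun p : ℝ × ℝ => F (pt p.1 (max 0 (min 1 p.2) * D.h p.1)) i := fun i =>
    (continuous_coord i).comp h3
  have h5 : Continuous fun p : ℝ × ℝ => D.h p.1 := h1.comp continuous_fst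
  have h6 : Continuous fun p : ℝ × ℝ => deriv D.h p.1 := h2.comp continuous_fst
  have h7 : Continuous fun p : ℝ × ℝ => max 0 (min 1 p.2) := by fun_prop
  exact ⟨(h4 0).add ((h7.mul h6).mul (h4 1)), h5.mul (h4 1)⟩

lemma deriv_h_periodic (s : ℝ) : deriv D.h (s + D.L) = deriv D.h s := by
  rw [← deriv_comp_add_const]
  simp only [D.h_periodic]

lemma pull_periodic (hp : ∀ x ∈ D.K, F (x + D.L • e 0) = F x) (x y : ℝ) :
    D.pullA F (x + D.L) y = D.pullA F x y ∧ D.pullB F (x + D.L) y = D.pullB F x y := by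
  have h1 : F (pt (x + D.L) (max 0 (min 1 y) * D.h x)) = F (pt x (max 0 (min 1 y) * D.h x)) := by
    rw [← pt_add_smul, hp _ (D.pt_mem_K (by simp))]
  simp only [pullA, pullB, D.h_periodic, D.deriv_h_periodic, h1, and_self]

/-- Testing with the curl of a product in straightened coordinates. -/
lemma integral_inner_curl_tens (hF : ContinuousOn F D.K) {α β : ℝ → ℝ} (hα : ContDiff ℝ ∞ α)
    (hβ : ContDiff ℝ ∞ β) :
    ∫ x in (D.Ω : Set Plane), inner ℝ (F x) (curl (D.tens α β) x)
      = ∫ y in (0 : ℝ)..1, (deriv β y * (∫ x in 0..D.L, α x * D.pullA F x y)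
        - β y * ∫ x in 0..D.L, deriv α x * D.pullB F x y) := by
  obtain ⟨hA, hB⟩ := D.continuous_pull hF
  have hα' := (contDiff_infty_iff_deriv.1 hα).2.continuous
  have hβ' := (contDiff_infty_iff_deriv.1 hβ).2.continuous
  have hαc := hα.continuous
  have hβc := hβ.continuous
  rw [D.integral_Ω (D.integrable (hF.inner (contDiff_curl (D.contDiff_tens hα hβ)).continuous.continuousOn))]
  have h1 : ∫ a in 0..D.L, ∫ y in (0 : ℝ)..1, D.h a •
      inner ℝ (F (pt a (y * D.h a))) (curl (D.tens α β) (pt a (y * D.h a)))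
      = ∫ a in 0..D.L, ∫ y in (0 : ℝ)..1,
        (deriv β y * (α a * D.pullA F a y) - β y * (deriv α a * D.pullB F a y)) := by
    refine intervalIntegral.integral_congr fun a _ => intervalIntegral.integral_congr fun y hy => ?_
    rw [uIcc_of_le zero_le_one] at hy
    have := D.h_ne a
    simp only [pullA, pullB, min_eq_right hy.2, max_eq_right hy.1, inner_plane,
      D.curl_tens_apply_zero hα hβ, D.curl_tens_apply_one hα hβ, smul_eq_mul]
    field_simp
    ring
  rw [h1, intervalIntegral_swap (by fun_prop)]
  refine intervalIntegral.integral_congr fun y _ => ?_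
  have c1 : Continuous fun x => D.pullA F x y := hA.comp (by fun_prop : Continuous fun x => (x, y))
  have c2 : Continuous fun x => D.pullB F x y := hB.comp (by fun_prop : Continuous fun x => (x, y))
  rw [intervalIntegral.integral_sub, intervalIntegral.integral_const_mul,
    intervalIntegral.integral_const_mul]
  · exact Continuous.intervalIntegrable (by fun_prop) _ _
  · exact Continuous.intervalIntegrable (by fun_prop) _ _

/-- A continuous periodic field orthogonal to the divergence-free fields vanishing on the boundary is
the gradient of a periodic function of class `C¹`. -/
theorem exists_potential (hF : ContinuousOn F D.K) (hp : ∀ x ∈ D.K, F (x + D.L • e 0) = F x)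
    (h : ∀ φ ∈ D.Vtilde, (∀ s, φ (pt s 0) = 0) → ∫ x in (D.Ω : Set Plane), inner ℝ (F x) (φ x) = 0) :
    ∃ p : Plane → ℝ, ContDiffOn ℝ 1 p D.K ∧ (∀ x ∈ D.K, p (x + D.L • e 0) = p x) ∧
      ∀ x ∈ D.K, D.sgrad p x = F x := by
  obtain ⟨hA, hB⟩ := D.continuous_pull hF
  set A := D.pullA F with hAdef
  set B := D.pullB F with hBdef
  have cA : ∀ y, Continuous fun x => A x y := fun y => hA.comp (by fun_prop : Continuous fun x => (x, y))
  have bot0 : ∀ {α β : ℝ → ℝ}, ContDiff ℝ ∞ α → ContDiff ℝ ∞ β → β 0 = 0 → deriv β 0 = 0 →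
      ∀ s, curl (D.tens α β) (pt s 0) = 0 := by
    intro α β hα hβ h0 h0' s
    have e0 := D.curl_tens_apply_zero hα hβ s 0
    have e1 := D.curl_tens_apply_one hα hβ s 0
    rw [zero_mul] at e0 e1
    exact plane_ext (by simp [e0, h0']) (by simp [e1, h0])
  -- For fixed α, curls of α(x₁)β(y) with β and β' zero at both ends are tests that vanish on Γ₀.
  -- The du Bois-Reymond lemma in y removes β; its periodic version in x₁ then removes α and yields
  -- `rect`.
  have step : ∀ α : ℝ → ℝ, ContDiff ℝ ∞ α → (∀ s, α (s + D.L) = α s) → ∀ y ∈ Icc (0 : ℝ) 1,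
      ∫ x in 0..D.L, (α x * (A x y - A x 0) + deriv α x * ∫ η in (0 : ℝ)..y, B x η) = 0 := by
    intro α hα hαp y hy
    have hα' := (contDiff_infty_iff_deriv.1 hα).2.continuous
    have hαc := hα.continuous
    have c1 : Continuous fun y => ∫ x in 0..D.L, α x * A x y :=
      intervalIntegral.continuous_parametric_intervalIntegral_of_continuous' (by
        change Continuous fun p : ℝ × ℝ => α p.2 * A p.2 p.1
        have : Continuous fun p : ℝ × ℝ => A p.2 p.1 := hA.comp continuous_swap
        fun_prop) _ _
    have c2 : Continuous fun y => ∫ x in 0..D.L, deriv α x * B x y :=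
      intervalIntegral.continuous_parametric_intervalIntegral_of_continuous' (by
        change Continuous fun p : ℝ × ℝ => deriv α p.2 * B p.2 p.1
        have : Continuous fun p : ℝ × ℝ => B p.2 p.1 := hB.comp continuous_swap
        fun_prop) _ _
    have h1 := eq_of_integral_deriv_mul c1 c2 (fun β hβ h0 h1 h0' h1' => by
      rw [← D.integral_inner_curl_tens hF hα hβ]
      exact h _ (D.curl_tens_mem_Vtilde hα hβ hαp (by simp [h0]) (by simp [h1]) h1')
        (bot0 hα hβ h0 h0')) y hy
    have c3 : Continuous fun x => ∫ η in (0 : ℝ)..y, B x η :=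
      intervalIntegral.continuous_parametric_intervalIntegral_of_continuous' hB _ _
    rw [← intervalIntegral_swap (f := fun x η => deriv α x * B x η) (by fun_prop)] at h1
    simp only [intervalIntegral.integral_const_mul] at h1
    have c4 := cA y
    have c5 := cA 0
    rw [intervalIntegral.integral_add (Continuous.intervalIntegrable (by fun_prop) _ _)
      (Continuous.intervalIntegrable (by fun_prop) _ _)]
    simp only [mul_sub]
    rw [intervalIntegral.integral_sub (Continuous.intervalIntegrable (by fun_prop) _ _)
      (Continuous.intervalIntegrable (by fun_prop) _ _)]
    linarith
  have rect : ∀ y ∈ Icc (0 : ℝ) 1, ∀ x, (∫ η in (0 : ℝ)..y, B x η) - ∫ η in (0 : ℝ)..y, B 0 η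
      = ∫ s in (0 : ℝ)..x, (A s y - A s 0) := fun y hy x =>
    D.eq_integral_of_integral_deriv_mul (f := fun x => A x y - A x 0)
      (g := fun x => ∫ η in (0 : ℝ)..y, B x η) ((cA y).sub (cA 0))
      (intervalIntegral.continuous_parametric_intervalIntegral_of_continuous' hB _ _)
      (fun s => by simp only [hAdef, (D.pull_periodic hp _ _).1])
      (fun s => by simp only [hBdef, (D.pull_periodic hp _ _).2])
      (fun α hα hαp => step α hα hαp y hy) x
  -- The tests with α = 1 and β' = ψ carry a flux, since β(1) is free. They give A zero mean over a
  -- period at each height; otherwise the potential would be periodic only up to a linear term.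
  have mean : ∀ y ∈ Icc (0 : ℝ) 1, ∫ x in 0..D.L, A x y = 0 := by
    have c1 : Continuous fun y => ∫ x in 0..D.L, A x y :=
      intervalIntegral.continuous_parametric_intervalIntegral_of_continuous' (f := fun y x => A x y)
        (hA.comp continuous_swap) _ _
    refine eq_zero_of_integral_smooth_mul c1 zero_lt_one fun ψ hψ hs => ?_
    have hz : ∀ y, y ∉ Ioo (0 : ℝ) 1 → ψ y = 0 := fun y hy =>
      image_eq_zero_of_notMem_tsupport fun hy' => hy (hs hy')
    obtain ⟨hβ, hβd⟩ := contDiff_primitive hψ 0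
    have h1 := D.integral_inner_curl_tens hF (α := fun _ => 1) contDiff_const hβ
    rw [h _ (D.curl_tens_mem_Vtilde contDiff_const hβ (fun _ => rfl) (by simp) (by simp)
      (by rw [hβd, hz 1 (by simp)])) (bot0 contDiff_const hβ (by simp) (by rw [hβd, hz 0 (by simp)]))] at h1
    simpa [hβd] using h1.symm
  obtain ⟨hdiff, hder⟩ := hasFDerivWithinAt_primitive hA hB rect
  set q : Plane → ℝ := fun z => (∫ s in (0 : ℝ)..(z 0), A s 0) + ∫ η in (0 : ℝ)..(z 1), B (z 0) η
    with hq
  have hd : ∀ x ∈ D.K, HasFDerivWithinAt (fun x => q (D.Φ x)) (F x 0 • coord 0 + F x 1 • coord 1) D.K x := by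
    intro x hx
    have h1 := (hder _ (D.Φ_mem_S hx)).comp x (D.hasFDerivAt_Φ x).hasFDerivWithinAt
      fun y hy => D.Φ_mem_S hy
    refine h1.congr_fderiv ?_
    have hS : 0 ≤ x 1 / D.h (x 0) ∧ x 1 / D.h (x 0) ≤ 1 := by
      have : (D.Φ x) 1 ∈ Icc (0 : ℝ) 1 := D.Φ_mem_S hx
      simpa [Φ] using this
    have hne := D.h_ne (x 0)
    have hpt : pt (x 0) (x 1 / D.h (x 0) * D.h (x 0)) = x := by
      rw [div_mul_cancel₀ _ hne, pt_eta]
    have hcoord : ∀ i v, coord i v = v i := fun _ _ => rfl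
    ext v
    simp only [add_apply, ContinuousLinearMap.comp_apply, smul_apply, hcoord,
      D.fderiv_Φ, pt_apply_zero, pt_apply_one, hAdef, hBdef, pullA, pullB, Φ, min_eq_right hS.2,
      max_eq_right hS.1, hpt, smul_eq_mul]
    field_simp
    ring
  refine ⟨fun x => q (D.Φ x), ?_, fun x hx => ?_, fun x hx => ?_⟩
  · have := (contDiffOn_succ_iff_hasFDerivWithinAt_of_uniqueDiffOn (n := 0) (𝕜 := ℝ)
      (f := fun x => q (D.Φ x)) D.uniqueDiffOn_K).2 ⟨by simp, _, contDiffOn_zero.2 ?_, hd⟩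
    · simpa using this
    · exact (((continuous_coord 0).comp_continuousOn hF).smul continuousOn_const).add
        (((continuous_coord 1).comp_continuousOn hF).smul continuousOn_const)
  · have hy : (D.Φ x) 1 ∈ Icc (0 : ℝ) 1 := D.Φ_mem_S hx
    have h1 := hdiff _ hy (D.Φ x 0) (D.Φ x 0 + D.L)
    have hper : Function.Periodic (fun s => A s (D.Φ x 1)) D.L := fun s => by
      simp only [hAdef, (D.pull_periodic hp _ _).1]
    rw [hper.intervalIntegral_add_eq _ 0, zero_add, mean _ hy] at h1
    change q (D.Φ (x + D.L • e 0)) = q (D.Φ x)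
    rw [D.Φ_periodic]
    simp only [hq]
    simp [e]
    linarith
  · ext j
    simp only [sgrad, pd, (hd x hx).fderivWithin (D.uniqueDiffOn_K x hx)]
    fin_cases j <;> simp [e]

end Data

/-! ### Pressure, the friction functional and Tresca's law -/

namespace Data

variable (D : Data)

lemma continuousOn_sgrad {p : Plane → ℝ} (hp : ContDiffOn ℝ 1 p D.K) :
    ContinuousOn (D.sgrad p) D.K :=
  (PiLp.continuous_toLp 2 _).comp_continuousOn (continuousOn_pi.2 fun j => D.continuousOn_pd hp j)

/-- ∇p·φ = div (pφ), and pφ has no net flux: φ = 0 on the top, φ₂ = 0 on the bottom, and the sides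
cancel. -/
lemma integral_inner_sgrad {p : Plane → ℝ} (hp : ContDiffOn ℝ 1 p D.K)
    (hpp : ∀ x ∈ D.K, p (x + D.L • e 0) = p x) {φ : Plane → Plane} (hφ : φ ∈ D.Vtilde) :
    ∫ x in (D.Ω : Set Plane), inner ℝ (D.sgrad p x) (φ x) = 0 := by
  have hφ1 := D.Vtilde_contDiffOn hφ
  have htop := D.top_eq_zero_of_Γ₁ hφ.1.continuousOn hφ.2.1 hφ.2.2.2.1
  have hbot := D.bottom_eq_zero_of_Γ₀ hφ.1.continuousOn hφ.2.1 hφ.2.2.2.2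
  have hQ : ContDiffOn ℝ 1 (fun x => p x • φ x) D.K := hp.smul hφ1
  rw [D.integral_div (F := fun x => p x • φ x) hQ.continuousOn
    (fun x hx => D.differentiableAt' hQ (D.Ω_subset_Ki hx))
    ((D.continuousOn_sgrad hp).inner hφ.1.continuousOn) ?_ ?_]
  · simp [htop, hbot]
  · intro x hx
    have hx' := D.Ω_subset_Ki hx
    have h1 : ∀ j, D.pd j (fun x => p x • φ x) x = p x • D.pd j φ x + D.pd j p x • φ x := fun j => by
      rw [D.pd_eq _ _ hx', D.pd_eq _ _ hx', D.pd_eq _ _ hx',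
        fderiv_fun_smul (D.differentiableAt' hp hx') (D.differentiableAt' hφ1 hx')]
      simp
    have h2 := hφ.2.2.1 x hx
    simp only [div, Fin.sum_univ_two] at h2
    simp only [div, h1, Fin.sum_univ_two, inner_plane, sgrad]
    simp
    linear_combination -p x * h2
  · intro y hy
    have hK : pt 0 (y * D.h 0) ∈ D.K := D.pt_mem_K hy
    have h1 : pt D.L (y * D.h D.L) = pt 0 (y * D.h 0) + D.L • e 0 := by
      rw [pt_add_smul, zero_add, ← D.h_periodic 0, zero_add]
    simp only [h1, hpp _ hK, hφ.2.1 _ hK]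

/-- By density of Ṽ in V. This is why the pressure disappears from the weak problem. -/
lemma inner_sgrad {p : Plane → ℝ} (hp : ContDiffOn ℝ 1 p D.K)
    (hpp : ∀ x ∈ D.K, p (x + D.L • e 0) = p x) (Z : D.V) :
    inner ℝ (D.toL2 (D.sgrad p)) (Z : D.H1).fst = 0 := by
  have hc : Continuous fun Z : D.V => (Z : D.H1).fst :=
    (WithLp.prod_continuous_ofLp 2 _ _).fst.comp continuous_subtype_val
  refine D.V_induction' (p := fun Z : D.V => inner ℝ (D.toL2 (D.sgrad p)) (Z : D.H1).fst = 0)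
    (isClosed_eq (continuous_const.inner hc) continuous_const) (fun φ hφ => ?_) Z
  exact (L2_inner_eq (D.coeFn_toL2 (D.continuousOn_sgrad hp)) (D.coeFn_toL2 hφ.1.continuousOn)).trans
    (D.integral_inner_sgrad hp hpp hφ)

lemma integrable_norm_Γ (g : D.L2Γ₀) : Integrable (fun s => D.k * ‖g s‖) D.μΓ :=
  (((Lp.memLp g).integrable (by norm_num)).norm).const_mul _

lemma j_add_le (W Z : D.V) : D.j (W + Z) ≤ D.j W + D.j Z := by
  have h : D.trace (W + Z) = D.trace W + D.trace Z := by
    simp only [← tr_apply, map_add]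
  unfold j
  rw [← integral_add (D.integrable_norm_Γ _) (D.integrable_norm_Γ _), h]
  refine integral_mono_ae (D.integrable_norm_Γ _)
    ((D.integrable_norm_Γ _).add (D.integrable_norm_Γ _)) ?_
  filter_upwards [Lp.coeFn_add (D.trace W) (D.trace Z)] with s hs
  simp only [hs, Pi.add_apply, ← mul_add]
  exact mul_le_mul_of_nonneg_left (norm_add_le _ _) D.k_pos.le

lemma j_eq {W : D.V} {u : Plane → Plane} (hu : ContinuousOn u D.K) (hW : D.tr W = D.bot u) :
    D.j W = ∫ s in 0..D.L, D.k * ‖u (pt s 0)‖ := by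
  rw [j, ← tr_apply, hW, D.integral_Γ]
  refine integral_congr_ae ?_
  filter_upwards [D.coeFn_bot hu] with s hs
  rw [hs]

lemma j_zero : D.j 0 = 0 := by
  have h : D.trace 0 = 0 := by rw [← tr_apply, map_zero]
  rw [j, h]
  have : (fun s => D.k * ‖(0 : D.L2Γ₀) s‖) =ᵐ[D.μΓ] fun _ => 0 := by
    filter_upwards [Lp.coeFn_zero Plane 2 D.μΓ] with s hs
    rw [hs, Pi.zero_apply, norm_zero, mul_zero]
  rw [integral_congr_ae this]
  simp

section

variable {D} {f w : Plane → Plane} (hw : D.IsAdmissible w)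
include hw

lemma IsAdmissible.fst_ae : (hw.toV : D.H1).fst =ᵐ[D.μ] w := D.coeFn_toL2 hw.contDiff.continuousOn

lemma IsAdmissible.snd_ae : (hw.toV : D.H1).snd =ᵐ[D.μ] D.grad w :=
  D.coeFn_toL2 (D.continuousOn_grad hw.contDiff_one)

lemma IsAdmissible.tr_eq : D.tr hw.toV = D.bot w := by
  rw [tr_apply]
  exact D.trace_eq hw.contDiff_one hw.fst_ae hw.snd_ae

lemma IsAdmissible.bottom_zero (s : ℝ) : w (pt s 0) 1 = 0 :=
  D.bottom_eq_zero_of_Γ₀ hw.contDiff.continuousOn hw.periodic hw.bottom s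

/-- w₂ vanishes along the whole bottom line, which lies in `K`, so its tangential derivative is zero
there. -/
lemma IsAdmissible.pd_bottom (s : ℝ) : D.pd 0 w (pt s 0) 1 = 0 := by
  have h1 : HasDerivWithinAt (fun s : ℝ => pt s 0) (e 0) univ s := by
    have := (((hasDerivAt_id s).smul_const (e 0)).add_const ((0 : ℝ) • e 1)).hasDerivWithinAt (s := univ)
    simpa [pt] using this
  have h2 := ((coord 1).hasFDerivAt.comp_hasFDerivWithinAt (pt s 0)
    ((hw.contDiff_one.differentiableOn (by simp)) _ (D.pt_bot_mem_K s)).hasFDerivWithinAt).comp_hasDerivWithinAt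
    s h1 fun t _ => D.pt_bot_mem_K t
  have h3 : ((fun x => coord 1 (w x)) ∘ fun s : ℝ => pt s 0) = fun _ => 0 := by
    funext t
    exact hw.bottom_zero t
  have h4 := h2.derivWithin uniqueDiffWithinAt_univ
  change derivWithin ((fun x => coord 1 (w x)) ∘ fun s : ℝ => pt s 0) univ s = _ at h4
  rw [h3] at h4
  rw [pd]
  simpa using h4.symm

/-- With n = -e₂ the tangential stress is -ν(∂₂w₁ + ∂₁w₂)e₁; the pressure acts normally, and ∂₁w₂ =
0 on the bottom. -/
lemma IsAdmissible.ση_eq (p : Plane → ℝ) (s : ℝ) : D.ση w p (pt s 0) = D.shear w (pt s 0) := by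
  have h := hw.pd_bottom s
  rw [ση, tangential, inner_n]
  apply plane_ext <;>
    simp [stress, shear, Matrix.mulVec, dotProduct, n, e, h]

lemma IsAdmissible.tangential_eq (s : ℝ) : tangential (w (pt s 0)) = w (pt s 0) := by
  simp [tangential, inner_n, hw.bottom_zero s]

/-- Tresca's law in variational form. -/
lemma IsAdmissible.tresca_iff (p : Plane → ℝ) (s : ℝ) : D.Tresca w p (pt s 0) ↔
    ‖D.shear w (pt s 0)‖ ≤ D.k ∧
      inner ℝ (D.shear w (pt s 0)) (w (pt s 0)) + D.k * ‖w (pt s 0)‖ = 0 := by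
  have hk := D.k_pos
  rw [Tresca, hw.ση_eq, hw.tangential_eq]
  -- On the bottom σ and w are both multiples of `e 0`, so the claim concerns two real numbers.
  have hwx : w (pt s 0) = w (pt s 0) 0 • e 0 := plane_ext (by simp [e]) (by simp [e, hw.bottom_zero s])
  set σ := D.shear w (pt s 0) with hσ
  have hσx : σ = σ 0 • e 0 := by
    rw [hσ, shear]
    simp [e]
  have hn : ∀ c : ℝ, ‖c • e 0‖ = |c| := fun c => by simp [norm_smul, e]
  have hs : ‖σ‖ = |σ 0| := by
    conv_lhs => rw [hσx]
    exact hn _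
  have hww : ‖w (pt s 0)‖ = |w (pt s 0) 0| := by
    conv_lhs => rw [hwx]
    exact hn _
  have hin : inner ℝ σ (w (pt s 0)) = σ 0 * w (pt s 0) 0 := by
    rw [inner_plane, hw.bottom_zero s, mul_zero, add_zero]
  rw [hin, hs, hww]
  have hz : w (pt s 0) = 0 ↔ w (pt s 0) 0 = 0 := ⟨fun h => by simp [h], fun h => by rw [hwx, h, zero_smul]⟩
  have hl : ∀ l : ℝ, w (pt s 0) = -(l • σ) ↔ w (pt s 0) 0 = -(l * σ 0) := fun l =>
    ⟨fun h => by rw [h]; simp, fun h => by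
      rw [hwx, h, hσx]
      simp [e]
      module⟩
  simp only [hz, hl]
  generalize w (pt s 0) 0 = a
  generalize σ 0 = t
  constructor
  · rintro ⟨h1, h2, h3⟩
    refine ⟨h1, ?_⟩
    rcases h1.lt_or_eq with h | h
    · simp [h2 h]
    · obtain ⟨l, hl0, rfl⟩ := h3 h
      rw [abs_neg, abs_mul, h, abs_of_nonneg hl0]
      have : t * t = D.k * D.k := by rw [← h, abs_mul_abs_self]
      linear_combination -l * this
  · rintro ⟨h1, h2⟩
    -- If t² = k² and ta + k|a| = 0, then a = -(|a|/k) t; this is the multiplier λ.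
    refine ⟨h1, fun h => ?_, fun h => ⟨|a| / D.k, by positivity, ?_⟩⟩
    · have h3 : -(|t| * |a|) ≤ t * a := by
        rw [← abs_mul]
        exact neg_abs_le _
      have h4 : |a| ≤ 0 := by
        by_contra! h5
        nlinarith
      exact abs_eq_zero.1 (le_antisymm h4 (abs_nonneg a))
    · have h3 : t * t = D.k * D.k := by rw [← h, abs_mul_abs_self]
      field_simp
      have h5 : D.k * (a * D.k) = D.k * -(|a| * t) := by
        linear_combination -a * h3 + t * h2
      linarith [mul_left_cancel₀ hk.ne' h5]

lemma IsAdmissible.inner_sub (hf : ContinuousOn f D.K) (Θ : D.V) :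
    inner ℝ (D.toH1 (D.resid f w) (D.visc w)) ((Θ - hw.toV : D.V) : D.H1)
      = inner ℝ (D.toL2 (D.mom f w)) ((Θ - hw.toV : D.V) : D.H1).fst
        + (inner ℝ (D.bot (D.shear w)) (D.tr Θ) - inner ℝ (D.bot (D.shear w)) (D.bot w)) := by
  rw [D.inner_resid_visc hf hw.contDiff hw.periodic, map_sub, hw.tr_eq, inner_sub_right]

lemma IsAdmissible.j_toV : D.j hw.toV = ∫ s in 0..D.L, D.k * ‖w (pt s 0)‖ :=
  D.j_eq hw.contDiff.continuousOn hw.tr_eq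

lemma IsAdmissible.inner_shear_self_add_j :
    inner ℝ (D.bot (D.shear w)) (D.bot w) + D.j hw.toV
      = ∫ s in 0..D.L, (inner ℝ (D.shear w (pt s 0)) (w (pt s 0)) + D.k * ‖w (pt s 0)‖) := by
  have hsc := D.continuousOn_shear hw.contDiff_one
  have hwc := hw.contDiff.continuousOn
  rw [D.inner_bot hsc hwc, hw.j_toV, intervalIntegral.integral_add]
  · exact ((D.continuousOn_bottom hsc).inner (D.continuousOn_bottom hwc)).intervalIntegrable _ _
  · exact (continuous_const.mul (D.continuousOn_bottom hwc).norm).intervalIntegrable _ _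

/-- The momentum equation and Tresca's law imply the variational inequality. -/
theorem IsAdmissible.variational (hf : ContinuousOn f D.K) {p : Plane → ℝ}
    (hp : ContDiffOn ℝ 1 p D.K) (hpp : ∀ x ∈ D.K, p (x + D.L • e 0) = p x)
    (hm : ∀ x ∈ D.Ω, D.mom f w x = -D.sgrad p x) (ht : ∀ x ∈ D.Γ₀, D.Tresca w p x) (Θ : D.V) :
    0 ≤ inner ℝ (D.toH1 (D.resid f w) (D.visc w)) ((Θ - hw.toV : D.V) : D.H1)
      + D.j Θ - D.j hw.toV := by
  have hsc := D.continuousOn_shear hw.contDiff_one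
  have h1 : D.toL2 (D.mom f w) = (-1 : ℝ) • D.toL2 (D.sgrad p) := by
    rw [← D.toL2_smul _ (D.continuousOn_sgrad hp)]
    refine D.toL2_congr (D.continuousOn_mom hf hw.contDiff)
      ((continuous_const_smul (-1 : ℝ)).comp_continuousOn (D.continuousOn_sgrad hp)) fun x hx => ?_
    simp [hm x hx]
  have ht' : ∀ s ∈ Ioo 0 D.L, ‖D.shear w (pt s 0)‖ ≤ D.k ∧
      inner ℝ (D.shear w (pt s 0)) (w (pt s 0)) + D.k * ‖w (pt s 0)‖ = 0 := fun s hs =>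
    (hw.tresca_iff p s).1 (ht _ ⟨by simpa using hs, by simp⟩)
  -- Friction balances exactly for w itself, while for an arbitrary Θ the bound |σ| ≤ k leaves a
  -- nonnegative remainder (`h3`).
  have h2 : inner ℝ (D.bot (D.shear w)) (D.bot w) + D.j hw.toV = 0 := by
    rw [hw.inner_shear_self_add_j, D.integral_Γ, setIntegral_congr_fun measurableSet_Ioo
      (fun s hs => (ht' s hs).2)]
    simp
  have h3 : 0 ≤ inner ℝ (D.bot (D.shear w)) (D.tr Θ) + D.j Θ := by
    have hae : D.tr Θ =ᵐ[D.μΓ] D.trace Θ := by rw [tr_apply]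
    rw [L2_inner_eq (D.coeFn_bot hsc) hae, j, ← integral_add _ (D.integrable_norm_Γ _)]
    · refine integral_nonneg_of_ae ?_
      filter_upwards [ae_restrict_mem measurableSet_Ioo] with s hs
      have h4 := abs_real_inner_le_norm (D.shear w (pt s 0)) (D.trace Θ s)
      have h5 : ‖D.shear w (pt s 0)‖ * ‖D.trace Θ s‖ ≤ D.k * ‖D.trace Θ s‖ :=
        mul_le_mul_of_nonneg_right (ht' s hs).1 (norm_nonneg _)
      have := neg_abs_le (inner ℝ (D.shear w (pt s 0)) (D.trace Θ s))
      simp only [Pi.zero_apply]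
      linarith
    · refine (L2.integrable_inner (𝕜 := ℝ) (D.bot (D.shear w)) (D.trace Θ)).congr ?_
      filter_upwards [D.coeFn_bot hsc] with s hs
      rw [hs]
  rw [hw.inner_sub hf, h1, real_inner_smul_left, D.inner_sgrad hp hpp]
  linarith

/-- The variational inequality implies the momentum equation and Tresca's law. -/
theorem IsAdmissible.exists_pressure (hf : ContinuousOn f D.K)
    (hfp : ∀ x ∈ D.K, f (x + D.L • e 0) = f x)
    (hv : ∀ Θ : D.V, 0 ≤ inner ℝ (D.toH1 (D.resid f w) (D.visc w)) ((Θ - hw.toV : D.V) : D.H1)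
      + D.j Θ - D.j hw.toV) :
    ∃ p : Plane → ℝ, ContDiffOn ℝ 1 p D.K ∧ (∀ x ∈ D.K, p (x + D.L • e 0) = p x) ∧
      (∀ x ∈ D.Ω, D.mom f w x = -D.sgrad p x) ∧ ∀ x ∈ D.Γ₀, D.Tresca w p x := by
  have hwc := hw.contDiff.continuousOn
  have hsc := D.continuousOn_shear hw.contDiff_one
  have hmc := D.continuousOn_mom hf hw.contDiff
  have hmp : ∀ x ∈ D.K, D.mom f w (x + D.L • e 0) = D.mom f w x := by
    intro x hx
    have h1 : ∀ j, ∀ x ∈ D.K, D.pd j w (x + D.L • e 0) = D.pd j w x := fun j x hx =>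
      D.pd_periodic j hw.periodic hx
    simp only [mom, lap, conv, G, hfp x hx, hw.periodic x hx, h1 _ x hx, D.pd_periodic _ (h1 _) hx]
    simp [e]
  have hsub : ∀ φ, ∀ hφ : φ ∈ D.Vtilde, ((hw.toV + D.ofVtilde hφ) - hw.toV : D.V) = D.ofVtilde hφ :=
    fun φ hφ => add_sub_cancel_left _ _
  have htr : ∀ φ, ∀ hφ : φ ∈ D.Vtilde, D.tr (D.ofVtilde hφ) = D.bot φ := fun φ hφ => by
    rw [tr_apply, trace_ofVtilde]
  -- Test with Θ = w + φ; subadditivity of j removes w from the friction terms.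
  have key : ∀ φ, ∀ hφ : φ ∈ D.Vtilde, 0 ≤ (∫ x in (D.Ω : Set Plane), inner ℝ (D.mom f w x) (φ x))
      + (∫ s in 0..D.L, inner ℝ (D.shear w (pt s 0)) (φ (pt s 0)))
      + ∫ s in 0..D.L, D.k * ‖φ (pt s 0)‖ := by
    intro φ hφ
    have h1 := hv (hw.toV + D.ofVtilde hφ)
    have h2 := D.j_add_le hw.toV (D.ofVtilde hφ)
    rw [hsub, D.inner_resid_visc hf hw.contDiff hw.periodic, htr,
      D.inner_bot hsc hφ.1.continuousOn] at h1
    rw [D.j_eq hφ.1.continuousOn (htr φ hφ)] at h2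
    have h3 : inner ℝ (D.toL2 (D.mom f w)) ((D.ofVtilde hφ : D.V) : D.H1).fst
        = ∫ x in (D.Ω : Set Plane), inner ℝ (D.mom f w x) (φ x) :=
      L2_inner_eq (D.coeFn_toL2 hmc) (D.coeFn_toL2 hφ.1.continuousOn)
    rw [h3] at h1
    linarith
  -- For φ vanishing on the bottom the inequality is linear in φ, so φ and -φ turn it into an
  -- equality.
  have orth : ∀ φ ∈ D.Vtilde, (∀ s, φ (pt s 0) = 0) →
      ∫ x in (D.Ω : Set Plane), inner ℝ (D.mom f w x) (φ x) = 0 := by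
    intro φ hφ h0
    have h1 := key φ hφ
    have h2 := key (-φ) (D.Vtilde.neg_mem hφ)
    simp only [h0, Pi.neg_apply, neg_zero, inner_neg_right, inner_zero_right, norm_zero, mul_zero,
      intervalIntegral.integral_zero, add_zero, integral_neg] at h1 h2
    linarith
  obtain ⟨q, hq, hqp, hqg⟩ := D.exists_potential hmc hmp orth
  have hz : ∀ Z : D.V, inner ℝ (D.toL2 (D.mom f w)) (Z : D.H1).fst = 0 := fun Z => by
    rw [← D.toL2_congr (D.continuousOn_sgrad hq) hmc fun x hx => hqg x (D.Ω_subset_K hx)]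
    exact D.inner_sgrad hq hqp Z
  have key' : ∀ φ ∈ D.Vtilde, 0 ≤ (∫ s in 0..D.L, inner ℝ (D.shear w (pt s 0)) (φ (pt s 0)))
      + ∫ s in 0..D.L, D.k * ‖φ (pt s 0)‖ := by
    intro φ hφ
    have h1 := key φ hφ
    have h2 := hz (D.ofVtilde hφ)
    have h3 : inner ℝ (D.toL2 (D.mom f w)) ((D.ofVtilde hφ : D.V) : D.H1).fst
        = ∫ x in (D.Ω : Set Plane), inner ℝ (D.mom f w x) (φ x) :=
      L2_inner_eq (D.coeFn_toL2 hmc) (D.coeFn_toL2 hφ.1.continuousOn)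
    rw [h3] at h2
    linarith
  -- For a sign ε, take a test field with bottom value εκ e₁, where κ ≥ 0 is the n-th power of the
  -- kernel centred at x₀. Then `key'` says that the average of εg + k about x₀ is nonnegative, and
  -- n → ∞ gives it at x₀.
  have bound : ∀ s, ‖D.shear w (pt s 0)‖ ≤ D.k := by
    intro x₀
    set g : ℝ → ℝ := fun s => D.shear w (pt s 0) 0 with hg
    have hgc : Continuous g := (continuous_coord 0).comp (D.continuousOn_bottom hsc)
    have hgp : ∀ s, g (s + D.L) = g s := fun s => by
      simp only [hg, shear, ← pt_add_smul s, D.pd_periodic 1 hw.periodic (D.pt_bot_mem_K s)]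
    have main : ∀ ε : ℝ, |ε| = 1 → 0 ≤ ε * g x₀ + D.k := by
      intro ε hε
      set Q : Plane → ℝ := fun z => ε * g (z 0) + D.k with hQ
      have hQc : ContinuousOn Q S :=
        ((continuous_const.mul (hgc.comp (continuous_coord 0))).add continuous_const).continuousOn
      have hS : pt x₀ 0 ∈ S := by simp [S]
      have hlim := D.tendsto_avg hQc hS
      have h0 : ∀ n, 0 ≤ D.avg n Q (pt x₀ 0) := by
        intro n
        have hL := D.L_pos
        refine mul_nonneg (inv_nonneg.2 (intervalIntegral.integral_nonneg (by linarith)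
          fun s _ => pow_nonneg (D.kern_nonneg s) n)) ?_
        rw [D.integral_kern_translate (fun z _ => by simp [hQ, e, hgp]) n hS]
        set κ : ℝ → ℝ := fun t => D.kern (x₀ - t) ^ n with hκ
        have hκs : ContDiff ℝ ∞ κ := (D.contDiff_kern.comp (contDiff_const.sub contDiff_id)).pow n
        have hκp : ∀ s, κ (s + D.L) = κ s := fun s => by
          simp only [hκ]
          rw [← D.kern_add (x₀ - (s + D.L))]
          congr 2
          ring
        -- The factor h cancels the 1/h in the bottom value αβ'(0)/h of the curl. The profile β =
        -- y(1 - y)² has β(0) = 0, β'(0) = 1 and a double zero at 1.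
        set α : ℝ → ℝ := fun t => ε * (D.h t * κ t) with hα
        have hαs : ContDiff ℝ ∞ α := contDiff_const.mul (D.h_smooth.mul hκs)
        set β : ℝ → ℝ := fun y => y * (1 - y) ^ 2 with hβ
        have hβs : ContDiff ℝ ∞ β := by fun_prop
        have hβd : ∀ y, deriv β y = (1 - y) ^ 2 - 2 * y * (1 - y) := fun y => by
          have := (hasDerivAt_id y).mul (((hasDerivAt_id y).const_sub 1).pow 2)
          refine this.deriv.trans ?_
          simp
          ring
        have hmem : curl (D.tens α β) ∈ D.Vtilde := D.curl_tens_mem_Vtilde hαs hβs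
          (fun s => by simp only [hα, D.h_periodic, hκp]) (by simp [hβ]) (by simp [hβ]) (by simp [hβd])
        have hval : ∀ s, curl (D.tens α β) (pt s 0) = (ε * κ s) • e 0 := fun s => by
          have e0 := D.curl_tens_apply_zero hαs hβs s 0
          have e1 := D.curl_tens_apply_one hαs hβs s 0
          have hne := D.h_ne s
          rw [zero_mul] at e0 e1
          refine plane_ext ?_ ?_
          · rw [e0, hβd]
            simp [hα, e]
            field_simp
          · have hβ0 : β 0 = 0 := by simp [hβ]
            rw [e1, hβ0]
            simp [e]
        have h1 := key' _ hmem
        simp only [hval] at h1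
        have hgc' := D.continuousOn_bottom hsc
        have hκc := hκs.continuous
        rw [← intervalIntegral.integral_add] at h1
        · refine h1.trans_eq (intervalIntegral.integral_congr fun s _ => ?_)
          have hk0 : 0 ≤ κ s := pow_nonneg (D.kern_nonneg _) n
          simp only [hQ, pt_apply_zero, inner_plane, norm_smul, Real.norm_eq_abs, abs_mul, hε,
            abs_of_nonneg hk0]
          simp [e, hg, hκ]
          ring
        · exact ((D.continuousOn_bottom hsc).inner
            ((continuous_const.mul hκc).smul continuous_const)).intervalIntegrable _ _
        · exact (continuous_const.mul
            ((continuous_const.mul hκc).smul continuous_const).norm).intervalIntegrable _ _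
      simpa [hQ] using ge_of_tendsto' hlim h0
    have h1 := main 1 (by simp)
    have h2 := main (-1) (by simp)
    have h3 : ‖D.shear w (pt x₀ 0)‖ = |g x₀| := by
      have : D.shear w (pt x₀ 0) = g x₀ • e 0 := by
        simp only [hg, shear]
        simp [e]
      rw [this]
      simp [norm_smul, e]
    rw [h3, abs_le]
    constructor <;> linarith
  have hzero : ∀ s ∈ Icc 0 D.L,
      inner ℝ (D.shear w (pt s 0)) (w (pt s 0)) + D.k * ‖w (pt s 0)‖ = 0 := by
    refine D.eq_zero_of_integral_le (f := fun s => inner ℝ (D.shear w (pt s 0)) (w (pt s 0))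
      + D.k * ‖w (pt s 0)‖) (((D.continuousOn_bottom hsc).inner (D.continuousOn_bottom hwc)).add
        (continuous_const.mul (D.continuousOn_bottom hwc).norm)) (fun s => ?_) ?_
    · have h4 := abs_real_inner_le_norm (D.shear w (pt s 0)) (w (pt s 0))
      have h5 : ‖D.shear w (pt s 0)‖ * ‖w (pt s 0)‖ ≤ D.k * ‖w (pt s 0)‖ :=
        mul_le_mul_of_nonneg_right (bound s) (norm_nonneg _)
      have := neg_abs_le (inner ℝ (D.shear w (pt s 0)) (w (pt s 0)))
      linarith
    -- Θ = 0 shows that the integral of the nonnegative function σ·w + k|w| is at most zero.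
    · have h1 := hv 0
      rw [hw.inner_sub hf, hz, map_zero, inner_zero_right, D.j_zero] at h1
      rw [← hw.inner_shear_self_add_j]
      linarith
  -- The potential satisfies ∇q = M while the pressure must satisfy M = -∇p.
  refine ⟨fun x => -q x, hq.neg, fun x hx => by simp only [hqp x hx], fun x hx => ?_, fun x hx => ?_⟩
  · rw [← hqg x (D.Ω_subset_K hx)]
    ext j
    have : D.pd j (fun x => -q x) x = -D.pd j q x := by
      rw [D.pd_eq _ _ (D.Ω_subset_Ki hx), D.pd_eq _ _ (D.Ω_subset_Ki hx), fderiv_fun_neg]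
      simp
    simp [sgrad, this]
  · have hx' : x = pt (x 0) 0 := plane_ext (by simp) (by simpa using hx.2)
    rw [hx']
    exact (hw.tresca_iff _ _).2 ⟨bound _, hzero _ ⟨hx.1.1.le, hx.1.2.le⟩⟩

end

end Data

/-! ### Time derivatives of regular fields -/

lemma continuous_mul_of_tsupport_subset {χ φ : ℝ → ℝ} {U : Set ℝ} (hU : IsOpen U)
    (hχ : Continuous χ) (hs : tsupport χ ⊆ U) (hφ : ContinuousOn φ U) :
    Continuous fun t => χ t * φ t :=
  continuous_of_tsupport fun _ ht =>
    hχ.continuousAt.fun_mul (hφ.continuousAt (hU.mem_nhds (hs (tsupport_mul_subset_left ht))))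

lemma integrable_mul_of_tsupport_subset {χ φ : ℝ → ℝ} {U : Set ℝ} (hU : IsOpen U)
    (hχ : Continuous χ) (hc : HasCompactSupport χ) (hs : tsupport χ ⊆ U) (hφ : ContinuousOn φ U) :
    Integrable fun t => χ t * φ t :=
  (continuous_mul_of_tsupport_subset hU hχ hs hφ).integrable_of_hasCompactSupport hc.mul_right

lemma integral_deriv_mul_of_tsupport_subset {ψ φ φ' : ℝ → ℝ} {U : Set ℝ} (hU : IsOpen U)
    (hψ : ContDiff ℝ ∞ ψ) (hc : HasCompactSupport ψ) (hs : tsupport ψ ⊆ U)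
    (hφ : ∀ t ∈ U, HasDerivAt φ (φ' t) t) (hφ' : ContinuousOn φ' U) :
    ∫ t, deriv ψ t * φ t = -∫ t, ψ t * φ' t := by
  have hψ' : Continuous (deriv ψ) := (contDiff_infty_iff_deriv.1 hψ).2.continuous
  have hs' : tsupport (deriv ψ) ⊆ U := fun t ht => hs (tsupport_deriv_subset ht)
  have hφc : ContinuousOn φ U := fun t ht => (hφ t ht).continuousAt.continuousWithinAt
  have i1 := integrable_mul_of_tsupport_subset hU hψ' hc.deriv hs' hφc
  have i2 := integrable_mul_of_tsupport_subset hU hψ.continuous hc hs hφ'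
  have i3 := integrable_mul_of_tsupport_subset hU hψ.continuous hc hs hφc
  have h := integral_eq_zero_of_hasDerivAt_of_integrable (f := fun t => ψ t * φ t)
    (f' := fun t => deriv ψ t * φ t + ψ t * φ' t) (fun t => ?_) (i1.add i2) i3
  · rw [integral_add i1 i2] at h
    linarith
  · by_cases ht : t ∈ tsupport ψ
    · exact ((hψ.differentiable (by simp) t).hasDerivAt).mul (hφ t (hs ht))
    · have h0 : ψ =ᶠ[𝓝 t] 0 := notMem_tsupport_iff_eventuallyEq.1 ht
      have h1 : deriv ψ t = 0 := by rw [h0.deriv_eq]; simp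
      rw [h1, h0.self_of_nhds]
      simp only [Pi.zero_apply, zero_mul, add_zero]
      refine (hasDerivAt_const t (0 : ℝ)).congr_of_eventuallyEq ?_
      filter_upwards [h0] with s hs
      simp [hs]

namespace Data

variable (D : Data)

/-- The time derivative of a field. -/
def rate (w : ℝ → Plane → Plane) (t : ℝ) (x : Plane) : Plane := deriv (fun s => w s x) t

section

variable {D} {w : ℝ → Plane → Plane} (hr : D.IsRegular w)
include hr

lemma IsRegular.continuousOn {t : ℝ} (ht : 0 ≤ t) : ContinuousOn (w t) D.K :=
  hr.cont.comp (f := fun x => (t, x)) (by fun_prop) fun _ hx => ⟨ht, hx⟩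

lemma IsRegular.continuousOn_rate {t : ℝ} (ht : 0 < t) : ContinuousOn (rate w t) D.K :=
  hr.cont_time.comp (f := fun x => (t, x)) (by fun_prop) fun _ hx => ⟨ht, hx⟩

lemma IsRegular.rate_periodic {t : ℝ} (ht : 0 < t) : ∀ x ∈ D.K, rate w t (x + D.L • e 0) = rate w t x := by
  intro x hx
  refine EventuallyEq.deriv_eq ?_
  filter_upwards [Ioi_mem_nhds ht] with s hs using hr.periodic s (le_of_lt hs) x hx

lemma IsRegular.contDiff_one {t : ℝ} (ht : 0 < t) : ContDiffOn ℝ 1 (w t) D.K :=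
  (hr.contDiff t ht).of_le (by norm_num)

lemma IsRegular.continuousOn_toL2 : ContinuousOn (fun t => D.toL2 (w t)) (Ici 0) :=
  D.continuousOn_toL2 hr.cont

lemma IsRegular.continuousOn_toL2_rate : ContinuousOn (fun t => D.toL2 (rate w t)) (Ioi 0) :=
  D.continuousOn_toL2 hr.cont_time

lemma IsRegular.cont_grad :
    ContinuousOn (fun q : ℝ × Plane => D.grad (w q.1) q.2) (Ioi 0 ×ˢ D.K) := by
  refine (PiLp.continuous_toLp 2 _).comp_continuousOn (continuousOn_pi.2 fun ij => ?_)
  exact (continuous_coord ij.1).comp_continuousOn (hr.cont_pd ij.2)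

lemma IsRegular.continuousOn_toH1 :
    ContinuousOn (fun t => D.toH1 (w t) (D.grad (w t))) (Ioi 0) :=
  D.continuousOn_toH1 (hr.cont.mono (prod_mono_left Ioi_subset_Ici_self)) hr.cont_grad

/-- For fixed x this is the mean value inequality in time. The error is uniform over the compact
period cell, hence small in L². -/
lemma IsRegular.hasDerivAt_toL2 {t : ℝ} (ht : 0 < t) :
    HasDerivAt (fun s => D.toL2 (w s)) (D.toL2 (rate w t)) t := by
  rw [hasDerivAt_iff_isLittleO, Asymptotics.isLittleO_iff]
  intro ε hε
  set M : ℝ := (measureUnivNNReal D.μ : ℝ) ^ ((2 : ENNReal).toReal⁻¹) with hM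
  have hM0 : 0 ≤ M := by positivity
  have hδ : 0 < ε / (M + 1) := by positivity
  obtain ⟨v, hv, hv2⟩ := D.isCompact_K₀.mem_uniformity_of_prod
    (f := rate w) (hr.cont_time.mono (prod_mono_right D.K₀_subset_K)) ht (Metric.dist_mem_uniformity hδ)
  rw [isOpen_Ioi.nhdsWithin_eq ht] at hv
  obtain ⟨r, hr0, hrb⟩ := Metric.mem_nhds_iff.1 (inter_mem hv (Ioi_mem_nhds ht))
  filter_upwards [Metric.ball_mem_nhds t hr0] with s hs
  have hs0 : 0 < s := (hrb hs).2
  have hpt : ∀ x ∈ D.K₀, ‖w s x - w t x - (s - t) • rate w t x‖ ≤ ε / (M + 1) * ‖s - t‖ := by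
    intro x hx
    have := (convex_ball t r).norm_image_sub_le_of_norm_hasDerivWithin_le
      (f := fun s => w s x - s • rate w t x) (f' := fun s => rate w s x - rate w t x)
      (C := ε / (M + 1)) (fun s hs => ?_) (fun s hs => ?_) (Metric.mem_ball_self hr0) hs
    · refine le_of_eq_of_le ?_ this
      congr 1
      module
    · have h1 := ((hr.diff_time s (hrb hs).2 x hx.1).hasDerivAt).sub
        ((hasDerivAt_id s).smul_const (rate w t x))
      rw [one_smul] at h1
      exact h1.hasDerivWithinAt
    · rw [← dist_eq_norm]
      exact (hv2 s (hrb hs).1 x hx).le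
  have : ‖D.toL2 (w s) - D.toL2 (w t) - (s - t) • D.toL2 (rate w t)‖ ≤ M * (ε / (M + 1) * ‖s - t‖) := by
    rw [hM]
    refine Lp.norm_le_of_ae_bound (by positivity) ?_
    filter_upwards [Lp.coeFn_sub (D.toL2 (w s) - D.toL2 (w t)) ((s - t) • D.toL2 (rate w t)),
      Lp.coeFn_sub (D.toL2 (w s)) (D.toL2 (w t)), Lp.coeFn_smul (s - t) (D.toL2 (rate w t)),
      D.coeFn_toL2 (hr.continuousOn hs0.le), D.coeFn_toL2 (hr.continuousOn ht.le),
      D.coeFn_toL2 (hr.continuousOn_rate ht), ae_restrict_mem D.measurableSet_Ω]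
      with x h1 h2 h3 h4 h5 h6 h7
    rw [h1, Pi.sub_apply, h2, h3, Pi.sub_apply, Pi.smul_apply, h4, h5, h6]
    exact hpt x (D.Ω_subset_K₀ h7)
  refine this.trans ?_
  have h8 : M * (ε / (M + 1)) ≤ ε := by
    rw [mul_div_assoc', div_le_iff₀ (by positivity)]
    nlinarith
  calc M * (ε / (M + 1) * ‖s - t‖) = M * (ε / (M + 1)) * ‖s - t‖ := by ring
    _ ≤ ε * ‖s - t‖ := mul_le_mul_of_nonneg_right h8 (norm_nonneg _)

lemma IsRegular.integral_deriv_mul_inner {ψ : ℝ → ℝ} (hψ : ContDiff ℝ ∞ ψ) (hc : HasCompactSupport ψ)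
    (hs : tsupport ψ ⊆ Ioi 0) (u : D.L2) :
    ∫ t, deriv ψ t * inner ℝ (D.toL2 (w t)) u = -∫ t, ψ t * inner ℝ (D.toL2 (rate w t)) u := by
  refine integral_deriv_mul_of_tsupport_subset isOpen_Ioi hψ hc hs (fun t ht => ?_)
    (hr.continuousOn_toL2_rate.inner continuousOn_const)
  have := (hr.hasDerivAt_toL2 ht).inner ℝ (hasDerivAt_const t u)
  simpa using this

end

/-- The functional `Θ ↦ (u, Θ)` on `V`. -/
def pair (u : D.L2) : StrongDual ℝ D.V :=
  (innerSL ℝ u).comp ((WithLp.fstL 2 ℝ D.L2 (Lp Mat 2 D.μ)).comp D.V.subtypeL)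

@[simp] lemma pair_apply (u : D.L2) (Θ : D.V) : D.pair u Θ = inner ℝ u (Θ : D.H1).fst := rfl

lemma continuous_pair : Continuous D.pair :=
  (innerSL ℝ).continuous.clm_comp continuous_const

end Data

/-! ### Energy inequality and the bound for the time derivative in V' -/

namespace Data

lemma norm_mulVec_le (u : Plane) (A : Mat) : ‖mulVec u A‖ ≤ ‖u‖ * ‖A‖ := by
  refine abs_le_of_sq_le_sq' ?_ (by positivity) |>.2
  rw [mul_pow, ← real_inner_self_eq_norm_sq, ← real_inner_self_eq_norm_sq, ← real_inner_self_eq_norm_sq,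
    inner_plane, inner_plane, inner_mat]
  simp only [mulVec, Fin.sum_univ_two]
  nlinarith [sq_nonneg (u 0 * A (0, 1) - u 1 * A (0, 0)), sq_nonneg (u 0 * A (1, 1) - u 1 * A (1, 0))]

variable (D : Data)

lemma norm_toL2_sq_le {E F : Type*} [NormedAddCommGroup E] [InnerProductSpace ℝ E]
    [SecondCountableTopology E] [NormedAddCommGroup F] [InnerProductSpace ℝ F] [SecondCountableTopology F]
    {u : Plane → E} {v : Plane → F} {a b : ℝ} (hu : ContinuousOn u D.K) (hv : ContinuousOn v D.K)
    (h : ∀ x ∈ D.Ω, ‖u x‖ ≤ a * ‖v x‖ + b) :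
    ‖D.toL2 u‖ ^ 2 ≤ 2 * a ^ 2 * ‖D.toL2 v‖ ^ 2 + 2 * b ^ 2 * volume.real (D.Ω : Set Plane) := by
  rw [L2_norm_sq_eq (D.coeFn_toL2 hu), L2_norm_sq_eq (D.coeFn_toL2 hv), ← integral_const_mul]
  have hc : 2 * b ^ 2 * volume.real (D.Ω : Set Plane) = ∫ _ in (D.Ω : Set Plane), 2 * b ^ 2 := by
    rw [setIntegral_const, smul_eq_mul, mul_comm]
  rw [hc]
  have i0 : Integrable (fun x => ‖u x‖ ^ 2) D.μ := D.integrable (hu.norm.pow 2)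
  have i1 : Integrable (fun x => 2 * a ^ 2 * ‖v x‖ ^ 2) D.μ :=
    (D.integrable (f := fun x => ‖v x‖ ^ 2) (hv.norm.pow 2)).const_mul (2 * a ^ 2)
  have i2 : Integrable (fun _ => 2 * b ^ 2) D.μ := D.integrable continuousOn_const
  rw [← integral_add i1 i2]
  refine setIntegral_mono_on i0 (i1.add i2) D.measurableSet_Ω fun x hx => ?_
  have h1 := pow_le_pow_left₀ (norm_nonneg _) (h x hx) 2
  nlinarith [sq_nonneg (a * ‖v x‖ - b)]

/-- The convective terms of the homogenized problem. -/
def convect (w : Plane → Plane) (x : Plane) : Plane :=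
  D.conv w w x + (D.conv D.ξ w x + D.conv w D.ξ x)

lemma continuousOn_convect {w : Plane → Plane} (hw : ContDiffOn ℝ 1 w D.K) :
    ContinuousOn (D.convect w) D.K :=
  (D.continuousOn_conv hw.continuousOn (D.continuousOn_pd hw)).add
    ((D.continuousOn_conv D.contDiff_ξ.continuous.continuousOn (D.continuousOn_pd hw)).add
      (D.continuousOn_conv hw.continuousOn (D.continuousOn_pd D.contDiffOn_ξ_one)))

/-- `M` bounds the background flow, its gradient and the field `w`. -/
structure IsBound (M : ℝ) (w : Plane → Plane) : Prop where
  nonneg : 0 ≤ M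
  flow : ∀ x ∈ D.Ω, ‖D.ξ x‖ ≤ M
  grad_flow : ∀ x ∈ D.Ω, ‖D.grad D.ξ x‖ ≤ M
  field : ∀ x ∈ D.Ω, ‖w x‖ ≤ M

section

variable {D} {M : ℝ} {f w : Plane → Plane}

lemma IsBound.norm_convect_le (hM : D.IsBound M w) {x : Plane} (hx : x ∈ D.Ω) :
    ‖D.convect w x‖ ≤ 2 * M * ‖D.grad w x‖ + M ^ 2 := by
  have h1 := norm_mulVec_le (w x) (D.grad w x)
  have h2 := norm_mulVec_le (D.ξ x) (D.grad w x)
  have h3 := norm_mulVec_le (w x) (D.grad D.ξ x)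
  have h4 := mul_le_mul_of_nonneg_right (hM.field x hx) (norm_nonneg (D.grad w x))
  have h5 := mul_le_mul_of_nonneg_right (hM.flow x hx) (norm_nonneg (D.grad w x))
  have h6 := mul_le_mul (hM.field x hx) (hM.grad_flow x hx) (norm_nonneg _) hM.nonneg
  have h7 := norm_add₃_le (a := D.conv w w x) (b := D.conv D.ξ w x) (c := D.conv w D.ξ x)
  rw [convect, ← add_assoc]
  simp only [conv_eq] at h7 ⊢
  linarith

/-- The energy inequality. -/
lemma IsBound.energy_le (hM : D.IsBound M w) (hf : ContinuousOn f D.K) (hw : ContDiffOn ℝ 1 w D.K) :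
    inner ℝ (D.toL2 f) (D.toL2 w) + D.ν / 2 * ‖D.toL2 (D.grad w)‖ ^ 2
        - (M ^ 3 + (2 * M ^ 2 + D.ν * M) ^ 2 / (2 * D.ν)) * volume.real (D.Ω : Set Plane)
      ≤ inner ℝ (D.toH1 (D.resid f w) (D.visc w)) (D.toH1 w (D.grad w)) := by
  have hν := D.ν_pos
  set c := M ^ 3 + (2 * M ^ 2 + D.ν * M) ^ 2 / (2 * D.ν) with hc
  have hwc := hw.continuousOn
  have hg := D.continuousOn_grad hw
  have hr := D.continuousOn_resid hf hw
  have hv := D.continuousOn_visc hw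
  have i1 := D.integrable (hf.inner (𝕜 := ℝ) hwc)
  have i2 : Integrable (fun x => D.ν / 2 * ‖D.grad w x‖ ^ 2) D.μ :=
    (D.integrable (f := fun x => ‖D.grad w x‖ ^ 2) (hg.norm.pow 2)).const_mul (D.ν / 2)
  have i3 : Integrable (fun _ => c) D.μ := D.integrable continuousOn_const
  have i4 := D.integrable (hr.inner (𝕜 := ℝ) hwc)
  have i5 := D.integrable (hv.inner (𝕜 := ℝ) hg)
  have hcv : c * volume.real (D.Ω : Set Plane) = ∫ _ in (D.Ω : Set Plane), c := by
    rw [setIntegral_const, smul_eq_mul, mul_comm]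
  rw [H1_inner, toH1_fst, toH1_fst, toH1_snd, toH1_snd, L2_inner_eq (D.coeFn_toL2 hf) (D.coeFn_toL2 hwc),
    L2_inner_eq (D.coeFn_toL2 hr) (D.coeFn_toL2 hwc), L2_inner_eq (D.coeFn_toL2 hv) (D.coeFn_toL2 hg),
    L2_norm_sq_eq (D.coeFn_toL2 hg), hcv, ← integral_const_mul, ← integral_add i4 i5,
    ← integral_add i1 i2, ← integral_sub (f := fun x => inner ℝ (f x) (w x) + D.ν / 2 * ‖D.grad w x‖ ^ 2)
      (i1.add i2) i3]
  refine setIntegral_mono_on ((i1.add i2).sub i3) (i4.add i5) D.measurableSet_Ω fun x hx => ?_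
  have e1 : D.resid f w x = f x + D.convect w x := rfl
  rw [e1, visc, inner_add_left, inner_add_left, real_inner_smul_left, real_inner_smul_left,
    real_inner_self_eq_norm_sq]
  have h1 := neg_le_of_abs_le (abs_real_inner_le_norm (D.convect w x) (w x))
  have h2 := neg_le_of_abs_le (abs_real_inner_le_norm (D.grad D.ξ x) (D.grad w x))
  have h3 := hM.norm_convect_le hx
  have h4 : ‖D.convect w x‖ * ‖w x‖ ≤ (2 * M * ‖D.grad w x‖ + M ^ 2) * M :=
    mul_le_mul h3 (hM.field x hx) (norm_nonneg _) ((norm_nonneg _).trans h3)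
  have h5 := mul_le_mul_of_nonneg_right (hM.grad_flow x hx) (norm_nonneg (D.grad w x))
  have h6 : 0 ≤ D.ν * (inner ℝ (D.grad D.ξ x) (D.grad w x) + M * ‖D.grad w x‖) :=
    mul_nonneg hν.le (by linarith)
  -- Young's inequality: 2M² comes from convection and νM from ∇ξ, and half of the viscous term
  -- absorbs the linear gradient term.
  have h7 : (2 * M ^ 2 + D.ν * M) * ‖D.grad w x‖
      ≤ D.ν / 2 * ‖D.grad w x‖ ^ 2 + (2 * M ^ 2 + D.ν * M) ^ 2 / (2 * D.ν) := by
    have : D.ν / 2 * ‖D.grad w x‖ ^ 2 + (2 * M ^ 2 + D.ν * M) ^ 2 / (2 * D.ν)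
        - (2 * M ^ 2 + D.ν * M) * ‖D.grad w x‖
        = (D.ν * ‖D.grad w x‖ - (2 * M ^ 2 + D.ν * M)) ^ 2 / (2 * D.ν) := by
      field_simp
      ring
    have h8 : 0 ≤ (D.ν * ‖D.grad w x‖ - (2 * M ^ 2 + D.ν * M)) ^ 2 / (2 * D.ν) := by positivity
    linarith
  rw [hc]
  linarith

end

/-- The time derivative of a classical solution is controlled in `V'` by the gradient. -/
lemma exists_norm_pair_sq_le (M : ℝ) : ∃ A B : ℝ, ∀ (f w : Plane → Plane) (p : Plane → ℝ),
    D.IsAdmissible w → ContinuousOn f D.K → D.IsBound M w → ContDiffOn ℝ 1 p D.K →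
    (∀ x ∈ D.K, p (x + D.L • e 0) = p x) → (∀ x ∈ D.Ω, D.mom f w x = -D.sgrad p x) →
    (∀ x ∈ D.Γ₀, D.Tresca w p x) → ‖D.pair (D.toL2 f)‖ ^ 2 ≤ A + B * ‖D.toL2 (D.grad w)‖ ^ 2 := by
  set R : ℝ := (measureUnivNNReal D.μΓ : ℝ) ^ ((2 : ENNReal).toReal⁻¹) * D.k with hR
  set m : ℝ := volume.real (D.Ω : Set Plane)
  -- The factor 3 comes from squaring a sum of three norms: boundary stress, convection and
  -- viscosity.
  refine ⟨3 * (R ^ 2 * ‖D.tr‖ ^ 2 + 2 * (M ^ 2) ^ 2 * m + 2 * (D.ν * M) ^ 2 * m),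
    3 * (2 * (2 * M) ^ 2 + 2 * D.ν ^ 2), fun f w p hw hf hM hp hpp hm ht => ?_⟩
  have hν := D.ν_pos
  have hw1 := hw.contDiff_one
  have hsc := D.continuousOn_shear hw1
  have hcc := D.continuousOn_convect hw1
  have h1 : ‖D.bot (D.shear w)‖ ≤ R := by
    refine Lp.norm_le_of_ae_bound D.k_pos.le ?_
    filter_upwards [D.coeFn_bot hsc, ae_restrict_mem measurableSet_Ioo] with s hs hs'
    rw [hs]
    exact ((hw.tresca_iff p s).1 (ht _ ⟨by simpa using hs', by simp⟩)).1
  have h2 := D.norm_toL2_sq_le hcc (D.continuousOn_grad hw1) fun x hx => hM.norm_convect_le hx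
  have h3 := D.norm_toL2_sq_le (a := D.ν) (b := D.ν * M) (D.continuousOn_visc hw1)
    (D.continuousOn_grad hw1) fun x hx => by
      refine (norm_add_le _ _).trans ?_
      rw [norm_smul, norm_smul, Real.norm_of_nonneg hν.le]
      have := mul_le_mul_of_nonneg_left (hM.grad_flow x hx) hν.le
      linarith
  have h4 : D.toL2 (D.mom f w) = (-1 : ℝ) • D.toL2 (D.sgrad p) := by
    rw [← D.toL2_smul _ (D.continuousOn_sgrad hp)]
    refine D.toL2_congr (D.continuousOn_mom hf hw.contDiff)
      ((continuous_const_smul (-1 : ℝ)).comp_continuousOn (D.continuousOn_sgrad hp)) fun x hx => ?_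
    simp [hm x hx]
  -- The pressure gradient does not act on `V`, so f acts as the boundary stress minus the
  -- convective and viscous terms. Tresca's law bounds the stress by k independently of w.
  have h5 : ‖D.pair (D.toL2 f)‖
      ≤ R * ‖D.tr‖ + ‖D.toL2 (D.convect w)‖ + ‖D.toL2 (D.visc w)‖ := by
    refine ContinuousLinearMap.opNorm_le_bound _ ?_ fun Z => ?_
    · have := (norm_nonneg _).trans h1
      positivity
    have h6 := D.inner_resid_visc hf hw.contDiff hw.periodic Z
    rw [h4, real_inner_smul_left, D.inner_sgrad hp hpp, mul_zero, zero_add, H1_inner, toH1_fst, toH1_snd,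
      show D.toL2 (D.resid f w) = D.toL2 f + D.toL2 (D.convect w) from D.toL2_add hf hcc,
      inner_add_left] at h6
    have h7 : D.pair (D.toL2 f) Z = inner ℝ (D.bot (D.shear w)) (D.tr Z)
        - inner ℝ (D.toL2 (D.convect w)) (Z : D.H1).fst - inner ℝ (D.toL2 (D.visc w)) (Z : D.H1).snd := by
      rw [pair_apply]
      linarith
    have h8 := norm_inner_le_norm (𝕜 := ℝ) (D.bot (D.shear w)) (D.tr Z)
    have h9 := norm_inner_le_norm (𝕜 := ℝ) (D.toL2 (D.convect w)) (Z : D.H1).fst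
    have h10 := norm_inner_le_norm (𝕜 := ℝ) (D.toL2 (D.visc w)) (Z : D.H1).snd
    have h11 := mul_le_mul h1 (D.tr.le_opNorm Z) (norm_nonneg _) ((norm_nonneg _).trans h1)
    have h12 := mul_le_mul_of_nonneg_left (D.norm_fst_le (Z : D.H1)) (norm_nonneg (D.toL2 (D.convect w)))
    have h13 := mul_le_mul_of_nonneg_left (D.norm_snd_le (Z : D.H1)) (norm_nonneg (D.toL2 (D.visc w)))
    rw [h7]
    refine (norm_sub_le _ _).trans ((add_le_add_left (norm_sub_le _ _) _).trans ?_)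
    have h14 : ‖(Z : D.H1)‖ = ‖Z‖ := rfl
    rw [h14] at h12 h13
    linarith
  have h6 := pow_le_pow_left₀ (D.pair (D.toL2 f)).opNorm_nonneg h5 2
  nlinarith [sq_nonneg (R * ‖D.tr‖ - ‖D.toL2 (D.convect w)‖), sq_nonneg (R * ‖D.tr‖ - ‖D.toL2 (D.visc w)‖),
    sq_nonneg (‖D.toL2 (D.convect w)‖ - ‖D.toL2 (D.visc w)‖)]

end Data

/-! ### From classical to weak solutions -/

lemma memLp_two_of_norm_sq_le {E : Type*} [NormedAddCommGroup E] {f : ℝ → E} {g : ℝ → ℝ} {s : Set ℝ}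
    (hs : MeasurableSet s) (hf : ContinuousOn f s) (hg : IntegrableOn g s)
    (h : ∀ t ∈ s, ‖f t‖ ^ 2 ≤ g t) : MemLp f 2 (volume.restrict s) := by
  have hm := hf.aestronglyMeasurable (μ := volume) hs
  rw [memLp_two_iff_integrable_sq_norm hm]
  refine Integrable.mono' hg (hm.norm.pow 2) ?_
  filter_upwards [ae_restrict_mem hs] with t ht
  rw [Real.norm_of_nonneg (by positivity)]
  exact h t ht

namespace Data

variable (D : Data)

lemma j_nonneg (W : D.V) : 0 ≤ D.j W :=
  integral_nonneg fun _ => mul_nonneg D.k_pos.le (norm_nonneg _)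

variable {D}

/-- Continuity up to t = 0 makes the bound on the field uniform over (0, T]; no bound on its
gradient is claimed. -/
lemma IsRegular.exists_isBound {w : ℝ → Plane → Plane} (hr : D.IsRegular w) (T : ℝ) :
    ∃ M, ∀ t ∈ Ioc 0 T, D.IsBound M (w t) := by
  obtain ⟨M₁, h1, hM₁⟩ := D.exists_bound D.contDiff_ξ.continuous.continuousOn
  obtain ⟨M₂, h2, hM₂⟩ := D.exists_bound (D.continuousOn_grad D.contDiffOn_ξ_one)
  obtain ⟨M₃, hM₃⟩ := (isCompact_Icc.prod D.isCompact_K₀).exists_bound_of_continuousOn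
    (hr.cont.mono (prod_mono (Icc_subset_Ici_self : Icc 0 T ⊆ Ici 0) D.K₀_subset_K))
  refine ⟨max (max M₁ M₂) M₃, fun t ht => ⟨?_, fun x hx => ?_, fun x hx => ?_, fun x hx => ?_⟩⟩
  · exact h1.trans ((le_max_left _ _).trans (le_max_left _ _))
  · exact (hM₁ x (D.Ω_subset_K₀ hx)).trans ((le_max_left _ _).trans (le_max_left _ _))
  · exact (hM₂ x (D.Ω_subset_K₀ hx)).trans ((le_max_right _ _).trans (le_max_left _ _))
  · exact (hM₃ (t, x) ⟨⟨ht.1.le, ht.2⟩, D.Ω_subset_K₀ hx⟩).trans (le_max_right _ _)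

section

variable {v₀ : D.H} {w : ℝ → Plane → Plane} {p : ℝ → Plane → ℝ} (hc : D.IsClassicalSolution v₀ w p)
include hc

lemma IsClassicalSolution.admissible {t : ℝ} (ht : 0 < t) : D.IsAdmissible (w t) :=
  ⟨hc.regular.contDiff t ht, hc.regular.periodic t ht.le, hc.incompressible t ht, hc.top t ht,
    hc.bottom t ht⟩

lemma IsClassicalSolution.mom_eq {t : ℝ} (ht : 0 < t) :
    ∀ x ∈ D.Ω, D.mom (rate w t) (w t) x = -D.sgrad (p t) x := by
  intro x hx
  rw [mom, ← hc.momentum t ht x hx, rate]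
  abel

lemma IsClassicalSolution.variational {t : ℝ} (ht : 0 < t) (Θ : D.V) :
    0 ≤ inner ℝ (D.toH1 (D.resid (rate w t) (w t)) (D.visc (w t)))
        ((Θ - (hc.admissible ht).toV : D.V) : D.H1) + D.j Θ - D.j (hc.admissible ht).toV :=
  (hc.admissible ht).variational (hc.regular.continuousOn_rate ht) (hc.p_contDiff t ht)
    (hc.p_periodic t ht) (hc.mom_eq ht) (hc.tresca t ht) Θ

/-- Θ = 0 in the variational inequality; the friction term has the favourable sign. -/
lemma IsClassicalSolution.energy_le {t M : ℝ} (ht : 0 < t) (hM : D.IsBound M (w t)) :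
    D.ν / 2 * ‖D.toL2 (D.grad (w t))‖ ^ 2
      ≤ (M ^ 3 + (2 * M ^ 2 + D.ν * M) ^ 2 / (2 * D.ν)) * volume.real (D.Ω : Set Plane)
        - inner ℝ (D.toL2 (rate w t)) (D.toL2 (w t)) := by
  have h1 := hM.energy_le (hc.regular.continuousOn_rate ht) (hc.admissible ht).contDiff_one
  have h2 := hc.variational ht 0
  have h3 := D.j_nonneg (hc.admissible ht).toV
  rw [D.j_zero, zero_sub, Submodule.coe_neg, inner_neg_right] at h2
  change 0 ≤ -inner ℝ _ (D.toH1 (w t) (D.grad (w t))) + 0 - _ at h2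
  linarith

/-- The gradient may be unbounded as t → 0. The energy inequality bounds its square by a multiple of
the derivative of ct - ‖w‖²/2, which is nonnegative. That function is continuous on [0, T], so its
derivative is integrable. -/
lemma IsClassicalSolution.integrableOn_grad_sq {T : ℝ} :
    IntegrableOn (fun t => ‖D.toL2 (D.grad (w t))‖ ^ 2) (Ioc 0 T) := by
  have hr := hc.regular
  have hν := D.ν_pos
  obtain ⟨M, hM⟩ := hr.exists_isBound T
  set c := (M ^ 3 + (2 * M ^ 2 + D.ν * M) ^ 2 / (2 * D.ν)) * volume.real (D.Ω : Set Plane)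
  have hg : ContinuousOn (fun t => D.toL2 (D.grad (w t))) (Ioi 0) := D.continuousOn_toL2 hr.cont_grad
  have hle : ∀ t ∈ Ioc 0 T, D.ν / 2 * ‖D.toL2 (D.grad (w t))‖ ^ 2
      ≤ c - inner ℝ (D.toL2 (rate w t)) (D.toL2 (w t)) := fun t ht => hc.energy_le ht.1 (hM t ht)
  have hint : IntegrableOn (fun t => c - inner ℝ (D.toL2 (rate w t)) (D.toL2 (w t))) (Ioc 0 T) := by
    refine intervalIntegral.integrableOn_deriv_of_nonneg
      (g := fun t => c * t - 1 / 2 * ‖D.toL2 (w t)‖ ^ 2) ?_ (fun t ht => ?_) fun t ht => ?_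
    · refine (continuous_const.mul continuous_id).continuousOn.sub (continuousOn_const.mul ?_)
      exact (hr.continuousOn_toL2.mono Icc_subset_Ici_self).norm.pow 2
    · have h1 := ((hr.hasDerivAt_toL2 ht.1).norm_sq).const_mul (1 / 2)
      have h2 := ((hasDerivAt_id t).const_mul c).sub h1
      refine h2.congr_deriv ?_
      rw [real_inner_comm]
      ring
    · exact le_trans (by positivity) (hle t ⟨ht.1, ht.2.le⟩)
  refine (hint.const_mul (2 / D.ν)).mono' ?_ ?_
  · exact ((hg.mono Ioc_subset_Ioi_self).norm.pow 2).aestronglyMeasurable measurableSet_Ioc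
  · filter_upwards [ae_restrict_mem measurableSet_Ioc] with t ht
    rw [Real.norm_of_nonneg (by positivity), div_mul_eq_mul_div, le_div_iff₀ hν]
    have := hle t ht
    linarith

lemma IsClassicalSolution.toL2_zero : D.toL2 (w 0) = v₀ :=
  Lp.ext ((D.coeFn_toL2 (hc.regular.continuousOn le_rfl)).trans hc.initial)

/-- For t > 0 the field lies in `V`. At t = 0 it need not be differentiable, and membership comes
from the datum. -/
lemma IsClassicalSolution.toL2_mem_H {t : ℝ} (ht : 0 ≤ t) : D.toL2 (w t) ∈ D.H := by
  rcases ht.eq_or_lt with rfl | ht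
  · rw [hc.toL2_zero]
    exact v₀.2
  · exact D.fst_mem_H (hc.admissible ht).toH1_mem

lemma IsClassicalSolution.memLp_pair {T : ℝ} :
    MemLp (fun t => D.pair (D.toL2 (rate w t))) 2 (volume.restrict (Ioo 0 T)) := by
  have hr := hc.regular
  obtain ⟨M, hM⟩ := hr.exists_isBound T
  obtain ⟨A, B, hAB⟩ := D.exists_norm_pair_sq_le M
  have hcont : ContinuousOn (fun t => D.pair (D.toL2 (rate w t))) (Ioo 0 T) :=
    D.continuous_pair.comp_continuousOn (hr.continuousOn_toL2_rate.mono Ioo_subset_Ioi_self)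
  have hg := (hc.integrableOn_grad_sq (T := T)).mono_set Ioo_subset_Ioc_self
  exact memLp_two_of_norm_sq_le (E := StrongDual ℝ D.V) measurableSet_Ioo hcont
    ((integrable_const A).add (hg.const_mul B)) fun t ht =>
      hAB _ _ _ (hc.admissible ht.1) (hr.continuousOn_rate ht.1) (hM t ⟨ht.1, ht.2.le⟩)
        (hc.p_contDiff t ht.1) (hc.p_periodic t ht.1) (hc.mom_eq ht.1) (hc.tresca t ht.1)

/-- A classical solution is a weak solution. -/
theorem IsClassicalSolution.exists_isWeakSolution :
    ∃ v : ℝ → D.H, D.Represents w v ∧ D.IsWeakSolution v₀ v := by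
  classical
  have hr := hc.regular
  -- The default 0 is used for t < 0, and in `W` also at t = 0, where w need not belong to `V`.
  set v : ℝ → D.H := fun t => if h : 0 ≤ t then ⟨D.toL2 (w t), hc.toL2_mem_H h⟩ else 0 with hv
  set W : ℝ → D.V := fun t => if h : 0 < t then (hc.admissible h).toV else 0 with hW
  have hvt : ∀ t, 0 ≤ t → (v t : D.L2) = D.toL2 (w t) := fun t ht => by simp only [hv, dif_pos ht]
  have hWt : ∀ t, ∀ ht : 0 < t, W t = (hc.admissible ht).toV := fun t ht => by simp only [hW, dif_pos ht]
  have hWt' : ∀ t, 0 < t → (W t : D.H1) = D.toH1 (w t) (D.grad (w t)) := fun t ht => by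
    rw [hWt t ht]
    rfl
  refine ⟨v, fun t ht => ?_, W, fun t => D.pair (D.toL2 (rate w t)), fun T _ => ?_, ?_, fun T _ => ?_,
    fun T _ => hc.memLp_pair, fun ψ hψ hψc hψs Θ => ?_, fun Θ T _ => ?_, ?_⟩
  · rw [hvt t ht]
    exact D.coeFn_toL2 (hr.continuousOn ht)
  · rw [Topology.IsInducing.subtypeVal.continuousOn_iff]
    exact (hr.continuousOn_toL2.mono Icc_subset_Ici_self).congr fun t ht => hvt t ht.1
  · filter_upwards [ae_restrict_mem measurableSet_Ioi] with t ht
    rw [hWt' t ht, hvt t (le_of_lt ht), toH1_fst]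
  · have hcont : ContinuousOn W (Ioo 0 T) := by
      rw [Topology.IsInducing.subtypeVal.continuousOn_iff]
      exact (hr.continuousOn_toH1.mono Ioo_subset_Ioi_self).congr fun t ht => hWt' t ht.1
    have h1 : IntegrableOn (fun t => ‖D.toL2 (w t)‖ ^ 2) (Ioo 0 T) :=
      (((hr.continuousOn_toL2.mono Icc_subset_Ici_self).norm.pow 2).integrableOn_Icc).mono_set
        Ioo_subset_Icc_self
    have h2 := (hc.integrableOn_grad_sq (T := T)).mono_set Ioo_subset_Ioc_self
    refine memLp_two_of_norm_sq_le measurableSet_Ioo hcont (h1.add h2) fun t ht => le_of_eq ?_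
    have h3 : ‖W t‖ = ‖(W t : D.H1)‖ := rfl
    rw [h3, hWt' t ht.1, H1_norm_sq]
    rfl
  · simp only [pair_apply]
    rw [← hr.integral_deriv_mul_inner hψ hψc hψs]
    refine integral_congr_ae (Eventually.of_forall fun t => ?_)
    by_cases ht : 0 ≤ t
    · simp only [hvt t ht]
    · have : deriv ψ t = 0 := by
        by_contra h
        exact ht (le_of_lt (hψs (tsupport_deriv_subset (subset_tsupport _ h))))
      simp only [this, zero_mul]
  · have h0 : ∀ᵐ t ∂(volume.restrict (Icc 0 T)), t ≠ 0 :=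
      ae_restrict_of_ae (Measure.ae_ne volume 0)
    filter_upwards [ae_restrict_mem measurableSet_Icc, h0] with t ht ht0
    have ht' : 0 < t := lt_of_le_of_ne ht.1 ht0.symm
    have h1 := hc.variational ht' Θ
    rw [← hWt t ht', ← D.weak_form_eq (hr.continuousOn_rate ht') (hr.contDiff_one ht') (hWt' t ht')] at h1
    rw [pair_apply]
    linarith
  · refine Subtype.ext ?_
    rw [hvt 0 le_rfl, hc.toL2_zero]

end

end Data

/-! ### From almost every time to every time -/

/-- The exceptional set is open and null, hence empty. -/
lemma forall_mem_of_ae_mem {E : Type*} [TopologicalSpace E] {f : ℝ → E} {U : Set ℝ} {C : Set E}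
    (hU : IsOpen U) (hf : ContinuousOn f U) (hC : IsClosed C) (h : ∀ᵐ t, t ∈ U → f t ∈ C) :
    ∀ t ∈ U, f t ∈ C := by
  by_contra! hne
  obtain ⟨t, ht, htC⟩ := hne
  have ho : IsOpen (U ∩ f ⁻¹' Cᶜ) := hf.isOpen_inter_preimage hU hC.isOpen_compl
  refine (ho.measure_pos volume ⟨t, ht, htC⟩).ne' (measure_mono_null (fun s hs => ?_) h)
  simpa using ⟨hs.1, hs.2⟩

lemma integrable_smul_of_tsupport_subset {E : Type*} [NormedAddCommGroup E] [NormedSpace ℝ E]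
    {f : ℝ → E} {U : Set ℝ} (hf : LocallyIntegrableOn f U) {ψ : ℝ → ℝ} (hψ : Continuous ψ)
    (hc : HasCompactSupport ψ) (hs : tsupport ψ ⊆ U) : Integrable fun t => ψ t • f t := by
  have h1 := (hf.integrableOn_compact_subset hs hc).continuousOn_smul hψ.continuousOn hc
  refine (integrableOn_iff_integrable_of_support_subset (s := tsupport ψ) fun t ht => ?_).1 h1
  by_contra h
  exact ht (by simp [image_eq_zero_of_notMem_tsupport h])

lemma locallyIntegrableOn_of_continuousOn {E : Type*} [NormedAddCommGroup E] {f : ℝ → E} {U : Set ℝ}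
    (hU : IsOpen U) (hf : ContinuousOn f U) : LocallyIntegrableOn f U :=
  hf.locallyIntegrableOn hU.measurableSet

lemma locallyIntegrableOn_of_memLp {E : Type*} [NormedAddCommGroup E] {f : ℝ → E}
    (hf : ∀ T > 0, MemLp f 2 (volume.restrict (Ioo 0 T))) : LocallyIntegrableOn f (Ioi 0) := by
  intro t ht
  have ht0 : (0 : ℝ) < t := ht
  refine ⟨Ioo 0 (t + 1), mem_nhdsWithin_of_mem_nhds (Ioo_mem_nhds ht (by linarith)), ?_⟩
  exact (hf (t + 1) (by linarith)).integrable (by norm_num)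

/-- Testing against every x identifies the dual-valued integrals, so the fundamental lemma applies
in the dual space and the null set does not depend on x. -/
lemma ae_eq_of_integral_mul_apply {X : Type*} [NormedAddCommGroup X] [NormedSpace ℝ X]
    {f g : ℝ → StrongDual ℝ X} {U : Set ℝ} (hU : IsOpen U) (hf : LocallyIntegrableOn f U)
    (hg : LocallyIntegrableOn g U)
    (h : ∀ ψ : ℝ → ℝ, ContDiff ℝ ∞ ψ → HasCompactSupport ψ → tsupport ψ ⊆ U → ∀ x,
      ∫ t, ψ t * f t x = ∫ t, ψ t * g t x) :
    ∀ᵐ t, t ∈ U → f t = g t := by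
  have := hU.ae_eq_zero_of_integral_contDiff_smul_eq_zero (hf.sub hg) fun ψ hψ hc hs => ?_
  · filter_upwards [this] with t ht htU using sub_eq_zero.1 (ht htU)
  · have i1 := integrable_smul_of_tsupport_subset hf hψ.continuous hc hs
    have i2 := integrable_smul_of_tsupport_subset hg hψ.continuous hc hs
    simp only [Pi.sub_apply, smul_sub]
    rw [integral_sub i1 i2, sub_eq_zero]
    ext x
    rw [ContinuousLinearMap.integral_apply i1, ContinuousLinearMap.integral_apply i2]
    exact h ψ hψ hc hs x

namespace Data

variable (D : Data)

/-- Cauchy-Schwarz against the constant 1 on (0, L), and boundedness of the trace. -/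
lemma exists_j_le : ∃ C, 0 ≤ C ∧ ∀ W : D.V, D.j W ≤ C * ‖W‖ := by
  set I : Lp ℝ 2 D.μΓ := (memLp_const (1 : ℝ)).toLp _ with hI
  have hk := D.k_pos.le
  refine ⟨D.k * (‖D.tr‖ * ‖I‖), by positivity, fun W => ?_⟩
  set g := D.tr W with hg
  set N : Lp ℝ 2 D.μΓ := (Lp.memLp g).norm.toLp _ with hN
  have h1 : ‖N‖ = ‖g‖ := by
    rw [hN, Lp.norm_toLp, eLpNorm_norm, Lp.norm_def]
  have h2 : inner ℝ N I = ∫ s in Ioo 0 D.L, ‖g s‖ := by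
    rw [L2_inner_eq (MemLp.coeFn_toLp _) (MemLp.coeFn_toLp _)]
    simp
  have h3 : D.j W = D.k * inner ℝ N I := by
    rw [h2, ← integral_const_mul]
    rfl
  have h4 := (le_abs_self _).trans (abs_real_inner_le_norm N I)
  have h5 := mul_le_mul_of_nonneg_right (D.tr.le_opNorm W) (norm_nonneg I)
  rw [h1] at h4
  calc D.j W = D.k * inner ℝ N I := h3
    _ ≤ D.k * (‖D.tr‖ * ‖W‖ * ‖I‖) := mul_le_mul_of_nonneg_left (h4.trans h5) hk
    _ = D.k * (‖D.tr‖ * ‖I‖) * ‖W‖ := by ring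

/-- A subadditive functional with a linear bound is Lipschitz. -/
lemma continuous_j : Continuous D.j := by
  obtain ⟨C, hC0, hC⟩ := D.exists_j_le
  refine (LipschitzWith.of_le_add_mul ⟨C, hC0⟩ fun W Z => ?_).continuous
  have h1 := D.j_add_le Z (W - Z)
  rw [add_sub_cancel] at h1
  rw [dist_eq_norm]
  exact h1.trans (add_le_add_right (hC _) _)

section

variable {D} {w : ℝ → Plane → Plane} (hr : D.IsRegular w)
include hr

lemma IsRegular.continuousOn_resid_visc :
    ContinuousOn (fun t => D.toH1 (D.resid (rate w t) (w t)) (D.visc (w t))) (Ioi 0) := by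
  have hw : ContinuousOn (fun q : ℝ × Plane => w q.1 q.2) (Ioi 0 ×ˢ D.K) :=
    hr.cont.mono (prod_mono_left Ioi_subset_Ici_self)
  have hsnd : MapsTo Prod.snd (Ioi (0 : ℝ) ×ˢ D.K) D.K := fun q hq => hq.2
  have hξ : ContinuousOn (fun q : ℝ × Plane => D.ξ q.2) (Ioi 0 ×ˢ D.K) :=
    (D.contDiff_ξ.continuous.comp continuous_snd).continuousOn
  have hdξ : ∀ j, ContinuousOn (fun q : ℝ × Plane => D.pd j D.ξ q.2) (Ioi 0 ×ˢ D.K) := fun j =>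
    (D.continuousOn_pd D.contDiffOn_ξ_one j).comp continuousOn_snd hsnd
  have hgξ : ContinuousOn (fun q : ℝ × Plane => D.grad D.ξ q.2) (Ioi 0 ×ˢ D.K) :=
    (D.continuousOn_grad D.contDiffOn_ξ_one).comp continuousOn_snd hsnd
  have hconv : ∀ {a : ℝ × Plane → Plane} {b : Fin 2 → ℝ × Plane → Plane},
      ContinuousOn a (Ioi 0 ×ˢ D.K) → (∀ j, ContinuousOn (b j) (Ioi 0 ×ˢ D.K)) →
      ContinuousOn (fun q => ∑ j, a q j • b j q) (Ioi 0 ×ˢ D.K) := fun ha hb =>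
    continuousOn_finsetSum _ fun j _ => ((continuous_coord j).comp_continuousOn ha).smul (hb j)
  refine D.continuousOn_toH1 ?_ ?_
  · exact hr.cont_time.add ((hconv hw hr.cont_pd).add ((hconv hξ hr.cont_pd).add (hconv hw hdξ)))
  · exact ((continuous_const_smul D.ν).comp_continuousOn hr.cont_grad).add
      ((continuous_const_smul D.ν).comp_continuousOn hgξ)

lemma IsRegular.admissible_of_mem {t : ℝ} (ht : 0 < t) (h : D.toH1 (w t) (D.grad (w t)) ∈ D.V) :
    D.IsAdmissible (w t) := by
  have hw := hr.contDiff_one ht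
  have h1 : ((⟨_, h⟩ : D.V) : D.H1).fst =ᵐ[D.μ] w t := D.coeFn_toL2 hw.continuousOn
  have h2 : ((⟨_, h⟩ : D.V) : D.H1).snd =ᵐ[D.μ] D.grad (w t) := D.coeFn_toL2 (D.continuousOn_grad hw)
  refine ⟨hr.contDiff t ht, hr.periodic t ht.le, D.div_eq_zero hw h1 h2, fun x hx => ?_, fun x hx => ?_⟩
  · have hx' : x = pt (x 0) (D.h (x 0)) := plane_ext (by simp) (by simpa using hx.2)
    rw [hx']
    exact D.top_eq_zero hw h1 h2 _ ⟨hx.1.1.le, hx.1.2.le⟩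
  · have hx' : x = pt (x 0) 0 := plane_ext (by simp) (by simpa using hx.2)
    rw [inner_n, hx', D.bottom_eq_zero hw h1 h2 _ ⟨hx.1.1.le, hx.1.2.le⟩, neg_zero]

variable {v₀ : D.H} {v : ℝ → D.H} (hv : D.IsWeakSolution v₀ v) (hrep : D.Represents w v)
include hv hrep

/-- A regular weak solution satisfies the variational inequality at every positive time. -/
lemma IsRegular.variational : ∀ t > 0, ∃ hw : D.IsAdmissible (w t), ∀ Θ : D.V,
    0 ≤ inner ℝ (D.toH1 (D.resid (rate w t) (w t)) (D.visc (w t))) ((Θ - hw.toV : D.V) : D.H1)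
      + D.j Θ - D.j hw.toV := by
  classical
  obtain ⟨vV, vt, -, hvV, -, hvt, hder, hineq, -⟩ := hv
  have hgrad : ∀ t, 0 < t → ContinuousOn (D.grad (w t)) D.K := fun t ht =>
    D.continuousOn_grad (hr.contDiff_one ht)
  -- The weak problem identifies only the field underlying `vV t`; its second component is the
  -- gradient by uniqueness of weak gradients.
  have hae : ∀ᵐ t, t ∈ Ioi (0 : ℝ) → (vV t : D.H1) = D.toH1 (w t) (D.grad (w t)) := by
    filter_upwards [(ae_restrict_iff' measurableSet_Ioi).1 hvV] with t ht ht0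
    have h1 : (vV t : D.H1).fst =ᵐ[D.μ] w t := by
      rw [ht ht0]
      exact hrep t (le_of_lt ht0)
    exact D.eq_toH1 (hr.continuousOn (le_of_lt ht0)) (hgrad t ht0) h1
      (D.snd_eq_grad (vV t).2 (hr.contDiff_one ht0) h1)
  -- `V` is closed and t ↦ (w, ∇w) is continuous into L² × L², so membership extends to every t > 0.
  have hmem : ∀ t ∈ Ioi (0 : ℝ), D.toH1 (w t) (D.grad (w t)) ∈ (D.V : Set D.H1) := by
    refine forall_mem_of_ae_mem isOpen_Ioi hr.continuousOn_toH1 D.isClosed_V ?_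
    filter_upwards [hae] with t ht ht0
    rw [← ht ht0]
    exact (vV t).2
  have hadm : ∀ t ∈ Ioi (0 : ℝ), D.IsAdmissible (w t) := fun t ht =>
    hr.admissible_of_mem ht (hmem t ht)
  set W : ℝ → D.V := fun t => if h : 0 < t then (hadm t h).toV else 0 with hW
  have hWt : ∀ t, ∀ ht : 0 < t, W t = (hadm t ht).toV := fun t ht => by simp only [hW, dif_pos ht]
  have hWt' : ∀ t, 0 < t → (W t : D.H1) = D.toH1 (w t) (D.grad (w t)) := fun t ht => by
    rw [hWt t ht]
    rfl
  have hWc : ContinuousOn W (Ioi 0) := by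
    rw [Topology.IsInducing.subtypeVal.continuousOn_iff]
    exact hr.continuousOn_toH1.congr fun t ht => hWt' t ht
  -- The classical time derivative satisfies the identity that defines the distributional one, which
  -- is unique.
  have hvt' : ∀ᵐ t, t ∈ Ioi (0 : ℝ) → vt t = D.pair (D.toL2 (rate w t)) := by
    refine ae_eq_of_integral_mul_apply isOpen_Ioi
      (locallyIntegrableOn_of_memLp (E := StrongDual ℝ D.V) hvt)
      (locallyIntegrableOn_of_continuousOn (E := StrongDual ℝ D.V) isOpen_Ioi
        (D.continuous_pair.comp_continuousOn hr.continuousOn_toL2_rate)) fun ψ hψ hc hs Θ => ?_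
    · simp only [pair_apply]
      rw [← neg_inj, ← hder ψ hψ hc hs Θ, ← hr.integral_deriv_mul_inner hψ hc hs]
      refine integral_congr_ae (Eventually.of_forall fun t => ?_)
      by_cases ht : 0 ≤ t
      · have : (v t : D.L2) = D.toL2 (w t) :=
          Lp.ext ((hrep t ht).trans (D.coeFn_toL2 (hr.continuousOn ht)).symm)
        simp only [this]
      · have : deriv ψ t = 0 := by
          by_contra h
          exact ht (le_of_lt (hs (tsupport_deriv_subset (subset_tsupport _ h))))
        simp only [this, zero_mul]
  refine fun t ht => ⟨hadm t ht, fun Θ => ?_⟩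
  rw [← hWt t ht]
  -- The null set of times may depend on Θ, but for fixed Θ the expression is continuous on (0, ∞).
  refine forall_mem_of_ae_mem (C := Ici 0)
    (f := fun t => inner ℝ (D.toH1 (D.resid (rate w t) (w t)) (D.visc (w t))) ((Θ - W t : D.V) : D.H1)
      + D.j Θ - D.j (W t)) isOpen_Ioi ?_ isClosed_Ici ?_ t ht
  · have h1 : ContinuousOn (fun t => ((Θ - W t : D.V) : D.H1)) (Ioi 0) :=
      continuous_subtype_val.comp_continuousOn (continuousOn_const.sub hWc)
    exact ((hr.continuousOn_resid_visc.inner h1).add continuousOn_const).sub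
      (D.continuous_j.comp_continuousOn hWc)
  · have h1 : ∀ n : ℕ, ∀ᵐ t, t ∈ Icc (0 : ℝ) (n + 1) → _ := fun n =>
      (ae_restrict_iff' measurableSet_Icc).1 (hineq Θ (n + 1) (by positivity))
    filter_upwards [hae, hvt', ae_all_iff.2 h1] with s hs1 hs2 hs3 hs0
    have hs0' : 0 < s := hs0
    obtain ⟨n, hn⟩ := exists_nat_ge s
    have h2 := hs3 n ⟨hs0'.le, by linarith⟩
    have h3 : vV s = W s := Subtype.ext (by rw [hs1 hs0, hWt' s hs0'])
    rw [hs2 hs0, h3, pair_apply] at h2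
    have h4 := D.weak_form_eq (hr.continuousOn_rate hs0') (hr.contDiff_one hs0') (hWt' s hs0') (Θ - W s)
    rw [mem_Ici, ← h4]
    linarith

end

end Data

/-! ### The pressure as a distribution, and from weak to classical solutions -/

namespace Data

variable (D : Data)

/-- The distribution `φ ↦ ∫_Ω q φ`. -/
def toDistribution (q : Plane → ℝ) : 𝓓'(D.Ω, ℝ) where
  toFun := TestFunction.integralAgainstBilinCLM (ContinuousLinearMap.mul ℝ ℝ) volume q
  map_add' := map_add _
  map_smul' := map_smul _
  cont := ContinuousLinearMap.continuous _

lemma toDistribution_apply {q : Plane → ℝ} (hq : ContinuousOn q D.K) (φ : 𝓓(D.Ω, ℝ)) :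
    D.toDistribution q φ = ∫ x in (D.Ω : Set Plane), q x * φ x := by
  have hl : LocallyIntegrableOn q D.Ω volume :=
    (hq.mono D.Ω_subset_K).locallyIntegrableOn D.measurableSet_Ω
  refine (TestFunction.integralAgainstBilinCLM_eq_integral hl).trans ?_
  rw [setIntegral_eq_integral_of_forall_compl_eq_zero fun x hx => ?_]
  · simp [mul_comm]
  · rw [image_eq_zero_of_notMem_tsupport fun h => hx (φ.tsupport_subset h), mul_zero]

/-- For a C¹ function the distributional derivative is the classical one: test functions are
supported inside Ω, so integration by parts has no boundary terms. -/
lemma lineDeriv_toDistribution_apply {q : Plane → ℝ} (hq : ContDiffOn ℝ 1 q D.K) (i : Fin 2)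
    (φ : 𝓓(D.Ω, ℝ)) :
    (∂_{e i} (D.toDistribution q)) φ = ∫ x in (D.Ω : Set Plane), D.pd i q x * φ x := by
  have hφ : ContDiff ℝ ∞ φ := φ.contDiff
  have hd : Continuous fun x => fderiv ℝ φ x (e i) := (hφ.continuous_fderiv (by simp)).clm_apply
    continuous_const
  have h := D.integral_testFunction_mul hq hφ φ.tsupport_subset i
  have i1 : Integrable (fun x => fderiv ℝ φ x (e i) * q x) D.μ :=
    D.integrable (hd.continuousOn.mul hq.continuousOn)
  have i2 : Integrable (fun x => φ x * D.pd i q x) D.μ :=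
    D.integrable (hφ.continuous.continuousOn.mul (D.continuousOn_pd hq i))
  rw [integral_add i1 i2] at h
  rw [Distribution.lineDerivOp_apply_apply, map_neg, D.toDistribution_apply hq.continuousOn,
    ← sub_eq_zero, ← neg_eq_zero, neg_sub, sub_neg_eq_add, ← h, add_comm]
  congr 1
  · refine integral_congr_ae (Eventually.of_forall fun x => ?_)
    change q x * (TestFunction.lineDerivCLM ℝ (e i) φ : 𝓓(D.Ω, ℝ)) x = _
    rw [TestFunction.lineDerivCLM_apply]
    simp [hφ.differentiable (by simp) x |>.lineDeriv_eq_fderiv, mul_comm]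
  · simp only [mul_comm]

variable {D}

lemma IsClassicalSolution.isDistributionalPressure {v₀ : D.H} {w : ℝ → Plane → Plane}
    {p : ℝ → Plane → ℝ} (hc : D.IsClassicalSolution v₀ w p) {t : ℝ} (ht : 0 < t) :
    D.IsDistributionalPressure w t (D.toDistribution (p t)) := by
  intro i φ
  have hp := hc.p_contDiff t ht
  have hw := hc.regular.contDiff t ht
  have hw1 := hc.regular.contDiff_one ht
  have hφ : ContinuousOn φ D.K := φ.continuous.continuousOn
  have hm : ContinuousOn (fun x => (deriv (fun s => w s x) t - D.ν • D.lap (w t) x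
      + D.conv (w t) (w t) x) i * φ x) D.K :=
    ((continuous_coord i).comp_continuousOn (((hc.regular.continuousOn_rate ht).sub
      ((continuous_const_smul D.ν).comp_continuousOn (D.continuousOn_lap hw))).add
        (D.continuousOn_conv hw1.continuousOn (D.continuousOn_pd hw1)))).mul hφ
  have i1 : Integrable (fun x => D.pd i (p t) x * φ x) D.μ :=
    D.integrable ((D.continuousOn_pd hp i).mul hφ)
  rw [D.lineDeriv_toDistribution_apply hp, ← integral_add (D.integrable hm) i1]
  refine setIntegral_congr_fun D.measurableSet_Ω fun x hx => ?_
  have h := congrArg (fun y : Plane => y i) (hc.momentum t ht x hx)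
  have h1 : D.sgrad (p t) x i = D.pd i (p t) x := rfl
  simp only [PiLp.add_apply] at h ⊢
  rw [← h, h1]
  ring

/-- A regular weak solution has a pressure. -/
theorem IsWeakSolution.exists_isClassicalSolution {v₀ : D.H} {v : ℝ → D.H} {w : ℝ → Plane → Plane}
    (hv : D.IsWeakSolution v₀ v) (hr : D.IsRegular w) (hrep : D.Represents w v) :
    ∃ p : ℝ → Plane → ℝ, D.IsClassicalSolution v₀ w p := by
  have hvar := hr.variational hv hrep
  -- A pressure is chosen at each time separately; no regularity in t is asked of it, and its values
  -- for t ≤ 0 are irrelevant.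
  have hp : ∀ t : ℝ, ∃ p : Plane → ℝ, 0 < t → ContDiffOn ℝ 1 p D.K ∧
      (∀ x ∈ D.K, p (x + D.L • e 0) = p x) ∧ (∀ x ∈ D.Ω, D.mom (rate w t) (w t) x = -D.sgrad p x) ∧
      ∀ x ∈ D.Γ₀, D.Tresca (w t) p x := by
    intro t
    by_cases ht : 0 < t
    · obtain ⟨hw, hvw⟩ := hvar t ht
      obtain ⟨p, hp⟩ := hw.exists_pressure (hr.continuousOn_rate ht) (hr.rate_periodic ht) hvw
      exact ⟨p, fun _ => hp⟩
    · exact ⟨0, fun h => absurd h ht⟩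
  choose p hp using hp
  obtain ⟨-, -, -, -, -, -, -, -, hinit⟩ := hv
  refine ⟨p, hr, fun t ht => (hp t ht).1, fun t ht => (hp t ht).2.1, fun t ht x hx => ?_,
    fun t ht => (hvar t ht).1.div_eq, fun t ht => (hvar t ht).1.top, fun t ht => (hvar t ht).1.bottom,
    fun t ht => (hp t ht).2.2.2, ?_⟩
  · have h := (hp t ht).2.2.1 x hx
    rw [mom, rate] at h
    rw [← sub_eq_zero, ← sub_eq_zero.2 h]
    abel
  · have h := hrep 0 le_rfl
    rw [hinit] at h
    exact h.symm

end Data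

end TrescaFlow

end

theorem mainTheorem5 (D : TrescaFlow.Data) (v₀ : D.H) :
    (∀ (w : ℝ → TrescaFlow.Plane → TrescaFlow.Plane) (p : ℝ → TrescaFlow.Plane → ℝ),
      D.IsClassicalSolution v₀ w p →
        ∃ v : ℝ → D.H, D.Represents w v ∧ D.IsWeakSolution v₀ v) ∧
    (∀ (v : ℝ → D.H) (w : ℝ → TrescaFlow.Plane → TrescaFlow.Plane),
      D.IsWeakSolution v₀ v → D.IsRegular w → D.Represents w v →
        ∃ p : ℝ → TrescaFlow.Plane → ℝ, D.IsClassicalSolution v₀ w p ∧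
          ∀ t > 0, ∃ q : 𝓓'(D.Ω, ℝ), D.IsDistributionalPressure w t q ∧
            ∀ φ : 𝓓(D.Ω, ℝ), q φ = ∫ x in (D.Ω : Set TrescaFlow.Plane), p t x * φ x) := by
  refine ⟨fun w p hc => hc.exists_isWeakSolution, fun v w hv hr hrep => ?_⟩
  obtain ⟨p, hp⟩ := hv.exists_isClassicalSolution hr hrep
  exact ⟨p, hp, fun t ht => ⟨D.toDistribution (p t), hp.isDistributionalPressure ht,
    fun φ => D.toDistribution_apply (hp.p_contDiff t ht).continuousOn φ⟩⟩
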